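/- Let $0<q<1$, let $a,b,c,d$ be nonzero complex numbers, $\nu\in\mathbb C$, and put $x(z)=\frac12(q^z+q^{-z})$, $x_1(z)=x(z+\frac12)$, $\Delta f(z)=f(z+1)-f(z)$, $\nabla f(z)=f(z)-f(z-1)$. We use the standard notation $(a_1,\dots,a_r;q)_\infty$, ${}_r\varphi_s$ and $${}_8W_7(A;a_1,\dots,a_5;q,t)={}_8\varphi_7\left(\begin{matrix}A,\,q\sqrt A,\,-q\sqrt A,\,a_1,\dots,a_5\\ \sqrt A,\,-\sqrt A,\,qA/a_1,\dots,qA/a_5\end{matrix};q,t\right).$$ Call $t$ *regular* if $t\notin\{q^{-n}:n=0,1,2,\dots\}$. Let $$u_\nu(x(z);a,b,c;d)=\frac{(bcq^\nu,q^{1-\nu}/ad;q)_\infty}{(bc,q/ad;q)_\infty}\,{}_4\varphi_3\left(\begin{matrix}q^{-\nu},abcdq^{\nu-1},aq^z,aq^{-z}\\ ab,ac,ad\end{matrix};q,q\right)$$ $$\quad+\frac{(q^{-\nu},abcdq^{\nu-1},qb/d,qc/d;q)_\infty}{(ab,ac,bc,ad/q;q)_\infty}\,\frac{(aq^z,aq^{-z};q)_\infty}{(q^{1+z}/d,q^{1-z}/d;q)_\infty}\,{}_4\varphi_3\left(\begin{matrix}q^{1-\nu}/ad,bcq^\nu,q^{1+z}/d,q^{1-z}/d\\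 qb/d,qc/d,q^2/ad\end{matrix};q,q\right).$$ This expression is defined for parameters that are *generic*, meaning that $ab,ac,bc,qb/d,qc/d$ are regular and $ad\notin q^{\mathbb Z}$, and for $z$ with $q^{1+z}/d,\ q^{1-z}/d$ regular. (i) If $a,b,c,d$ are generic and $|bcq^\nu|<1$, then $$u_\nu(x(z);a,b,c;d)=\frac{(qa/d,bcq^\nu,q^{1-\nu+z}/d,q^{1-\nu-z}/d;q)_\infty}{(q^{1-\nu}a/d,bc,q^{1+z}/d,q^{1-z}/d;q)_\infty}\,{}_8W_7\!\left(\tfrac{aq^{-\nu}}d;q^{-\nu},\tfrac{q^{1-\nu}}{bd},\tfrac{q^{1-\nu}}{cd},aq^z,aq^{-z};q,bcq^\nu\right)$$ whenever $aq^{-\nu}/d,\ qa/d,\ q^{1-\nu\pm z}/d,\ q^{1\pm z}/d$ are regular. From here to the end of (v), let $(a,b,c,d)$ and $(a,b,d,c)$ both be generic, and let $u(z)=u_\nu(x(z);a,b,c;d)$ and $v(z)=u_\nu(x(z);a,b,d;c)$. (ii) $u$ and $v$ both satisfy $$\sigma(z)\frac{\Delta}{\nabla x_1(z)}\left(\frac{\nabla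 f(z)}{\nabla x(z)}\right)+\tau(z)\frac{\Delta f(z)}{\Delta x(z)}+\lambda_\nu f(z)=0,$$ $$\sigma(z)=q^{-2z}(q^z-a)(q^z-b)(q^z-c)(q^z-d),\qquad \lambda_\nu=\frac{4q^{3/2}}{(1-q)^2}(1-q^{-\nu})(1-abcdq^{\nu-1}),$$ $$\tau(z)=\frac{2q^{1/2}}{1-q}\bigl(abc+abd+acd+bcd-a-b-c-d+2(1-abcd)x(z)\bigr),$$ at every $z$ with $q^{2z}\notin\{1,q,q^{-1}\}$ and with $q^{\pm z}/d$ regular (for $u$), respectively $q^{\pm z}/c$ regular (for $v$). (iii) Let $W(u,v)(z)=u(z)\frac{\nabla v(z)}{\nabla x(z)}-v(z)\frac{\nabla u(z)}{\nabla x(z)}$. If $q^{2z}\ne q$ and $q^z/c,q^{1-z}/c,q^z/d,q^{1-z}/d$ are regular, then $$W(u,v)(z)=\frac{2q\,(c/d,qd/c,q^{-\nu},abcdq^{\nu-1},abq^\nu,q^{1-\nu}/cd;q)_\infty}{(1-q)\,c\,(ab,ab,ac,ad,bc,bd;q)_\infty}\cdot\frac{(aq^z,aq^{1-z},bq^z,bq^{1-z};q)_\infty}{(q^z/c,q^{1-z}/c,q^z/d,q^{1-z}/d;q)_\infty}.$$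 (iv) Suppose that $q^\nu\notin\{q^n:n=0,1,2,\dots\}$ (for real $\nu$: $\nu$ is not a nonnegative integer), $c/d\notin q^{\mathbb Z}$, and $abcdq^{\nu-1},abq^\nu,q^{1-\nu}/cd$ are regular. Let $S$ be the set of $z$ as in (iii) for which also $aq^z,aq^{1-z},bq^z,bq^{1-z}$ are regular. Then $W(u,v)(z)\neq0$ for all $z\in S$. Moreover, if $\alpha,\beta$ are functions of period $1$ with $\alpha u+\beta v=0$ wherever $u$ and $v$ are both defined, then $\alpha=\beta=0$ on $S$; in particular $u$ and $v$ are linearly independent over $\mathbb C$. (v) If $\nu$ is a nonnegative integer, then $u=kv$, wherever both are defined, for some constant $k\ne0$. (vi) The following bilinear identity for four ${}_8\varphi_7$-series holds. Let $$T(c,d)=\frac{d\,(ac,adq;q)_\infty}{(q^{2-\nu}a/c,q^{1-\nu}a/d;q)_\infty}\cdot\frac{(q^{1-\nu+z}/c,q^{2-\nu-z}/c,q^{1-\nu+z}/d,q^{1-\nu-z}/d;q)_\infty}{(q^z/c,q^{1-z}/c,q^{1+z}/d,q^{1-z}/d;q)_\infty}$$ $$\times{}_8W_7\!\left(\tfrac{q^{1-\nu}a}c;q^{1-\nu},\tfrac{q^{1-\nu}}{bc},\tfrac{q^{1-\nu}}{cd},aq^z,aq^{1-z};q,bdq^\nu\right){}_8W_7\!\left(\tfrac{q^{-\nu}a}d;q^{-\nu},\tfrac{q^{1-\nu}}{bd},\tfrac{q^{1-\nu}}{cd},aq^z,aq^{-z};q,bcq^\nu\right)$$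 and let $T(d,c)$ be the same expression with $c$ and $d$ interchanged. If $|bcq^\nu|<1$, $|bdq^\nu|<1$ and $ab$, $ac$, $ad$, $qa/c$, $qa/d$, $q^{-\nu}a/c$, $q^{-\nu}a/d$, $q^{1-\nu\pm z}/c$, $q^{1-\nu\pm z}/d$, $q^z/c$, $q^{1-z}/c$, $q^z/d$, $q^{1-z}/d$ are regular, then $$T(c,d)-T(d,c)=\frac{d\,(c/d,qd/c,q^{1-\nu},abcdq^\nu,abq^\nu,q^{1-\nu}/cd;q)_\infty}{(ab,abq,qa/c,qa/d,bcq^\nu,bdq^\nu;q)_\infty}\cdot\frac{(aq^z,aq^{1-z},bq^z,bq^{1-z};q)_\infty}{(q^z/c,q^{1-z}/c,q^z/d,q^{1-z}/d;q)_\infty}.$$ -/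

import Mathlib

namespace AskeyWilson

noncomputable section

/-! ### Basic hypergeometric series -/

/-- The finite `q`-shifted factorial `(a; q)_n = ∏_{k < n} (1 - a q^k)`. -/
def qPoch (q : ℝ) (a : ℂ) (n : ℕ) : ℂ :=
  ∏ k ∈ Finset.range n, (1 - a * (q : ℂ) ^ k)

/-- `(a₁, …, a_r; q)_n`. -/
def qPochs (q : ℝ) (as : List ℂ) (n : ℕ) : ℂ :=
  (as.map fun a => qPoch q a n).prod

/-- The infinite `q`-shifted factorial `(a; q)_∞` (used for `0 < q < 1`). -/
def qPochInf (q : ℝ) (a : ℂ) : ℂ :=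
  ∏' k : ℕ, (1 - a * (q : ℂ) ^ k)

/-- `(a₁, …, a_r; q)_∞`. -/
def qPochsInf (q : ℝ) (as : List ℂ) : ℂ :=
  (as.map fun a => qPochInf q a).prod

/-- The basic hypergeometric series `_rφ_s(a₁, …, a_r; b₁, …, b_s; q, t)`. -/
def basicHyp (q : ℝ) (as bs : List ℂ) (t : ℂ) : ℂ :=
  ∑' n : ℕ, qPochs q as n / qPochs q ((q : ℂ) :: bs) n
    * ((-1) ^ n * (q : ℂ) ^ (n.choose 2)) ^ (1 + (bs.length : ℤ) - (as.length : ℤ)) * t ^ n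

/-- The very-well-poised series `_{2r+2}W_{2r+1}(A; a₁, …, a_{2r-1}; q, t)`; it does not depend on
the choice of the square root of `A`. With five parameters `a_i` this is `₈W₇`. -/
def veryWellPoised (q : ℝ) (A : ℂ) (l : List ℂ) (t : ℂ) : ℂ :=
  basicHyp q
    (A :: ((q : ℂ) * A ^ (1 / 2 : ℂ)) :: (-((q : ℂ) * A ^ (1 / 2 : ℂ))) :: l)
    (A ^ (1 / 2 : ℂ) :: (-(A ^ (1 / 2 : ℂ))) :: l.map fun e => (q : ℂ) * A / e) t

/-- `t ∉ {q^(-n) : n = 0, 1, 2, …}`, that is, `(t; q)_n ≠ 0` for every `n`. -/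
def Regular (q : ℝ) (t : ℂ) : Prop :=
  ∀ n : ℕ, t * (q : ℂ) ^ n ≠ 1

/-! ### The difference equation of hypergeometric type on the `q`-quadratic lattice -/

/-- `Δ f(z) = f(z + 1) - f(z)`. -/
def fwd (f : ℂ → ℂ) (z : ℂ) : ℂ := f (z + 1) - f z

/-- `∇ f(z) = f(z) - f(z - 1)`. -/
def bwd (f : ℂ → ℂ) (z : ℂ) : ℂ := f z - f (z - 1)

/-- The lattice `x(z) = (q^z + q^(-z)) / 2`. -/
def lat (q : ℝ) (z : ℂ) : ℂ := ((q : ℂ) ^ z + (q : ℂ) ^ (-z)) / 2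

/-- The shifted lattice `x₁(z) = x(z + 1/2)`. -/
def lat1 (q : ℝ) (z : ℂ) : ℂ := lat q (z + 1 / 2)

/-- The coefficient `σ(z)`. -/
def sigma (q : ℝ) (a b c d z : ℂ) : ℂ :=
  (q : ℂ) ^ (-2 * z) * ((q : ℂ) ^ z - a) * ((q : ℂ) ^ z - b) * ((q : ℂ) ^ z - c)
    * ((q : ℂ) ^ z - d)

/-- The coefficient `τ(z)`. -/
def tau (q : ℝ) (a b c d z : ℂ) : ℂ :=
  2 * (q : ℂ) ^ (1 / 2 : ℂ) / (1 - (q : ℂ))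
    * (a * b * c + a * b * d + a * c * d + b * c * d - a - b - c - d
      + 2 * (1 - a * b * c * d) * lat q z)

/-- The eigenvalue `λ_ν`. -/
def eigenvalue (q : ℝ) (a b c d ν : ℂ) : ℂ :=
  4 * (q : ℂ) ^ (3 / 2 : ℂ) / (1 - (q : ℂ)) ^ 2 * (1 - (q : ℂ) ^ (-ν))
    * (1 - a * b * c * d * (q : ℂ) ^ (ν - 1))

/-- The difference equation
`σ(z) Δ/∇x₁(z) (∇f(z)/∇x(z)) + τ(z) Δf(z)/Δx(z) + λ f(z) = 0` at the point `z`. -/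
def SolvesAt (q : ℝ) (a b c d lam : ℂ) (f : ℂ → ℂ) (z : ℂ) : Prop :=
  sigma q a b c d z * (fwd (fun s => bwd f s / bwd (lat q) s) z / bwd (lat1 q) z)
    + tau q a b c d z * (fwd f z / fwd (lat q) z) + lam * f z = 0

/-- The analog of the Wronskian,
`W(f, g)(z) = f(z) ∇g(z)/∇x(z) - g(z) ∇f(z)/∇x(z)`. -/
def wronskian (q : ℝ) (f g : ℂ → ℂ) (z : ℂ) : ℂ :=
  f z * (bwd g z / bwd (lat q) z) - g z * (bwd f z / bwd (lat q) z)

/-! ### The solution `u_ν(x(z); a, b, c; d)` -/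

/-- The function `u_ν(x(z); a, b, c; d)` for all complex `ν`, as the sum of two balanced `₄φ₃`. -/
def u (q : ℝ) (ν a b c d z : ℂ) : ℂ :=
  qPochsInf q [b * c * (q : ℂ) ^ ν, (q : ℂ) ^ (1 - ν) / (a * d)]
      / qPochsInf q [b * c, (q : ℂ) / (a * d)]
    * basicHyp q
        [(q : ℂ) ^ (-ν), a * b * c * d * (q : ℂ) ^ (ν - 1), a * (q : ℂ) ^ z, a * (q : ℂ) ^ (-z)]
        [a * b, a * c, a * d] q
  + qPochsInf q [(q : ℂ) ^ (-ν), a * b * c * d * (q : ℂ) ^ (ν - 1),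
        (q : ℂ) * b / d, (q : ℂ) * c / d]
      / qPochsInf q [a * b, a * c, b * c, a * d / (q : ℂ)]
    * (qPochsInf q [a * (q : ℂ) ^ z, a * (q : ℂ) ^ (-z)]
      / qPochsInf q [(q : ℂ) ^ (1 + z) / d, (q : ℂ) ^ (1 - z) / d])
    * basicHyp q
        [(q : ℂ) ^ (1 - ν) / (a * d), b * c * (q : ℂ) ^ ν,
          (q : ℂ) ^ (1 + z) / d, (q : ℂ) ^ (1 - z) / d]
        [(q : ℂ) * b / d, (q : ℂ) * c / d, (q : ℂ) ^ 2 / (a * d)] q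

/-- The very-well-poised `₈φ₇` form of `u_ν(x(z); a, b, c; d)`, for `|b c q^ν| < 1`. -/
def uSeries (q : ℝ) (ν a b c d z : ℂ) : ℂ :=
  qPochsInf q [(q : ℂ) * a / d, b * c * (q : ℂ) ^ ν,
        (q : ℂ) ^ (1 - ν + z) / d, (q : ℂ) ^ (1 - ν - z) / d]
      / qPochsInf q [(q : ℂ) ^ (1 - ν) * a / d, b * c,
        (q : ℂ) ^ (1 + z) / d, (q : ℂ) ^ (1 - z) / d]
    * basicHyp q
        [a * (q : ℂ) ^ (-ν) / d,
          (q : ℂ) * (a * (q : ℂ) ^ (-ν) / d) ^ (1 / 2 : ℂ),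
          -((q : ℂ) * (a * (q : ℂ) ^ (-ν) / d) ^ (1 / 2 : ℂ)),
          (q : ℂ) ^ (-ν), (q : ℂ) ^ (1 - ν) / (b * d), (q : ℂ) ^ (1 - ν) / (c * d),
          a * (q : ℂ) ^ z, a * (q : ℂ) ^ (-z)]
        [(a * (q : ℂ) ^ (-ν) / d) ^ (1 / 2 : ℂ),
          -((a * (q : ℂ) ^ (-ν) / d) ^ (1 / 2 : ℂ)),
          a * (q : ℂ) / d, a * b, a * c,
          (q : ℂ) ^ (1 - ν + z) / d, (q : ℂ) ^ (1 - ν - z) / d]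
        (b * c * (q : ℂ) ^ ν)

/-- The parameters for which no denominator in the definition of `u_ν(x; a, b, c; d)` that is free
of `z` vanishes. -/
structure Generic (q : ℝ) (a b c d : ℂ) : Prop where
  ab : Regular q (a * b)
  ac : Regular q (a * c)
  bc : Regular q (b * c)
  ad : ∀ n : ℤ, a * d ≠ (q : ℂ) ^ n
  bd : Regular q ((q : ℂ) * b / d)
  cd : Regular q ((q : ℂ) * c / d)

/-- The points `z` at which `u_ν(x(z); a, b, c; d)` has no pole: `(q^(1+z)/d, q^(1-z)/d; q)_∞ ≠ 0`. -/
def InDomain (q : ℝ) (d z : ℂ) : Prop :=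
  Regular q ((q : ℂ) ^ (1 + z) / d) ∧ Regular q ((q : ℂ) ^ (1 - z) / d)

/-- The points `z` at which `(e q^z, e q^(1-z); q)_∞ ≠ 0`. -/
def NonzeroAt (q : ℝ) (e z : ℂ) : Prop :=
  Regular q (e * (q : ℂ) ^ z) ∧ Regular q (e * (q : ℂ) ^ (1 - z))

/-! ### The bilinear identity -/

/-- The first of the two products of `₈W₇` series in the bilinear identity; the other one arises
from it by interchanging `c` and `d`. -/
def bilinearTerm (q : ℝ) (ν a b c d z : ℂ) : ℂ :=
  d * qPochsInf q [a * c, a * d * (q : ℂ)]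
      / qPochsInf q [(q : ℂ) ^ (2 - ν) * a / c, (q : ℂ) ^ (1 - ν) * a / d]
    * (qPochsInf q [(q : ℂ) ^ (1 - ν + z) / c, (q : ℂ) ^ (2 - ν - z) / c,
          (q : ℂ) ^ (1 - ν + z) / d, (q : ℂ) ^ (1 - ν - z) / d]
      / qPochsInf q [(q : ℂ) ^ z / c, (q : ℂ) ^ (1 - z) / c,
          (q : ℂ) ^ (1 + z) / d, (q : ℂ) ^ (1 - z) / d])
    * veryWellPoised q ((q : ℂ) ^ (1 - ν) * a / c)
        [(q : ℂ) ^ (1 - ν), (q : ℂ) ^ (1 - ν) / (b * c), (q : ℂ) ^ (1 - ν) / (c * d),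
          a * (q : ℂ) ^ z, a * (q : ℂ) ^ (1 - z)] (b * d * (q : ℂ) ^ ν)
    * veryWellPoised q ((q : ℂ) ^ (-ν) * a / d)
        [(q : ℂ) ^ (-ν), (q : ℂ) ^ (1 - ν) / (b * d), (q : ℂ) ^ (1 - ν) / (c * d),
          a * (q : ℂ) ^ z, a * (q : ℂ) ^ (-z)] (b * c * (q : ℂ) ^ ν)

end

end AskeyWilson

open AskeyWilson

/-! Write a = q^α, b = q^β, c = q^γ, d = q^δ. Multiplied by suitable infinite products, `u` becomes
`uHat`, entire in z and in all exponents, and the very-well-poised series becomes `vwpHat`,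
holomorphic where |q^(β+γ+ν)| < 1. An identity between such functions need only be proved off a
countable set of values of a perturbation parameter; continuity does the rest. All auxiliary
genericity assumptions are removed in this way.

Difference equation. It is a constant multiple of the eigenvalue equation of the Askey–Wilson
operator `awOp`. Applied to (aq^z, aq^(-z); q)_s with complex s, the operator yields only the
functions of index s and s - 1 (`awOp_awBasis`). A series over s + ℕ therefore telescopes if the
lowering coefficient vanishes at s, as it does for s = 0 and for q^s = q/(ad). Each of these two
series leaves a boundary term at infinity; the terms are the same function of z up to a factor, and
the weights in `u` make them cancel (`uHat_isSolution`). The summands of the very-well-poised series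
telescope as well (`awOp_vwpBasis`), with a boundary term that tends to 0 (`vwpHat_isSolution`).

Wronskian. The Wronskian of two solutions obeys a first-order difference equation. Cleared of
denominators, it has the same multipliers as an explicit product of infinite factorials, and both
are entire with period 2πi/log q. Their ratio is an elliptic function without poles, hence constant
(`proportional_of_ratio_relation`). If the two solutions have the same poles, the constant is 0; so
a solution with given poles is unique up to a factor, provided that its Wronskian with some other
solution is not zero (`IsSolution.proportional`).

Constants. For u and v the constant is read off at z = γ, up to the unknown value of `uHat` there.
Exchanging a and c gives another solution with the same poles; uniqueness and a comparison at z = 1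
- δ and z = γ yield that value (`uHat_third`) and with it the Wronskian (`qwron_uHat`). Uniqueness
and a comparison at z = α also identify `uHat` with `vwpHat` (`uHat_eq_vwpHat`).

Bilinear identity. The divided difference of a solution is again of the form `u`, with all
parameters multiplied by q^(1/2) and ν lowered by 1 (`uHat_sub_shift`). Substituting this into the
Wronskian formula and expressing every function by its very-well-poised series gives the identity.
-/

namespace AskeyWilson

open Filter Topology Complex

noncomputable section

/-- `q ^ w` for complex `w`, as an exponential. -/
def qexp (q : ℝ) (w : ℂ) : ℂ := cexp (Real.log q * w)

/-- `(q ^ w; q)_∞`. -/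
def qeps (q : ℝ) (w : ℂ) : ℂ := qPochInf q (qexp q w)

/-- The theta function `(q ^ w, q ^ (1 - w); q)_∞`. -/
def qtheta (q : ℝ) (w : ℂ) : ℂ := qeps q w * qeps q (1 - w)

/-- `(q ^ w; q)_n`. -/
def qrho (q : ℝ) (w : ℂ) (n : ℕ) : ℂ := qPoch q (qexp q w) n

/-- The imaginary period `2πi / log q` of `w ↦ q ^ w`. -/
def qperiod (q : ℝ) : ℂ := 2 * Real.pi * I / Real.log q

variable {q : ℝ}

local notation "𝐞" => qexp q
local notation "ε" => qeps q
local notation "θ" => qtheta q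
local notation "ρ" => qrho q

section

/-! ### The exponential -/

lemma qexp_add (x y : ℂ) : 𝐞 (x + y) = 𝐞 x * 𝐞 y := by
  simp [qexp, mul_add, Complex.exp_add]

lemma qexp_neg (x : ℂ) : 𝐞 (-x) = (𝐞 x)⁻¹ := by
  simp [qexp, Complex.exp_neg]

lemma qexp_sub (x y : ℂ) : 𝐞 (x - y) = 𝐞 x / 𝐞 y := by
  simp [qexp, mul_sub, Complex.exp_sub]

@[simp] lemma qexp_zero : 𝐞 0 = 1 := by simp [qexp]

@[simp] lemma qexp_ne_zero (x : ℂ) : 𝐞 x ≠ 0 := Complex.exp_ne_zero _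

lemma qexp_nat_mul (n : ℕ) (x : ℂ) : 𝐞 (n * x) = 𝐞 x ^ n := by
  rw [qexp, qexp, ← Complex.exp_nat_mul]; ring_nf

lemma qexp_eq_one_of_add_eq_zero {x y : ℂ} (h : x + y = 0) (hx : 𝐞 x = 1) : 𝐞 y = 1 := by
  rw [← neg_eq_of_add_eq_zero_right h, qexp_neg, hx, inv_one]

lemma qexp_two_mul (x : ℂ) : 𝐞 (2 * x) = 𝐞 x ^ 2 := by
  exact_mod_cast qexp_nat_mul (q := q) 2 x

@[fun_prop] lemma differentiable_qexp : Differentiable ℂ 𝐞 := by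
  unfold qexp; fun_prop

@[fun_prop] lemma continuous_qexp : Continuous 𝐞 := differentiable_qexp.continuous

section

variable [hq : Fact (0 < q ∧ q < 1)]

include hq

lemma q_pos : 0 < q := hq.out.1
lemma q_lt_one : q < 1 := hq.out.2
lemma q_cast_ne_zero : (q : ℂ) ≠ 0 := by exact_mod_cast (q_pos (q := q)).ne'
lemma q_cast_ne_one : (q : ℂ) ≠ 1 := by exact_mod_cast (q_lt_one (q := q)).ne
lemma log_q_neg : Real.log q < 0 := Real.log_neg q_pos q_lt_one
lemma norm_q : ‖(q : ℂ)‖ = q := by simp [abs_of_pos (q_pos (q := q))]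

lemma qexp_one : 𝐞 1 = q := by
  rw [qexp, mul_one, ← Complex.ofReal_exp, Real.exp_log q_pos]

lemma qexp_nat (n : ℕ) : 𝐞 n = (q : ℂ) ^ n := by
  rw [← mul_one (n : ℂ), qexp_nat_mul, qexp_one]

lemma qexp_int (n : ℤ) : 𝐞 n = (q : ℂ) ^ n := by
  rcases n with n | n
  · simpa using qexp_nat n
  · rw [Int.cast_negSucc, qexp_neg, qexp_nat, zpow_negSucc]

lemma cpow_eq_qexp (w : ℂ) : (q : ℂ) ^ w = 𝐞 w := by
  rw [cpow_def_of_ne_zero q_cast_ne_zero, qexp, Complex.ofReal_log q_pos.le]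

lemma exists_qexp_eq {a : ℂ} (ha : a ≠ 0) : ∃ α, 𝐞 α = a := by
  have h : (Real.log q : ℂ) ≠ 0 := by exact_mod_cast (log_q_neg (q := q)).ne
  exact ⟨Complex.log a / Real.log q, by rw [qexp, mul_div_cancel₀ _ h, Complex.exp_log ha]⟩

lemma qexp_period : 𝐞 (qperiod q) = 1 := by
  have h : (Real.log q : ℂ) ≠ 0 := by exact_mod_cast (log_q_neg (q := q)).ne
  rw [qexp, qperiod, mul_div_cancel₀ _ h, Complex.exp_two_pi_mul_I]

@[simp] lemma qexp_add_period (w : ℂ) : 𝐞 (w + qperiod q) = 𝐞 w := by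
  rw [qexp_add, qexp_period, mul_one]

@[simp] lemma qexp_sub_period (w : ℂ) : 𝐞 (w - qperiod q) = 𝐞 w := by
  rw [qexp_sub, qexp_period, div_one]

/-- Two solutions differ by an integer multiple of 2πi/log q. The zeros of `ε` and `θ` are countable
unions of such sets, which makes it harmless to exclude them. -/
lemma countable_qexp_eq (a : ℂ) : {w | 𝐞 w = a}.Countable := by
  have h : (Real.log q : ℂ) ≠ 0 := by exact_mod_cast (log_q_neg (q := q)).ne
  by_cases ha : ∃ w, 𝐞 w = a
  · obtain ⟨w0, hw0⟩ := ha
    refine (Set.countable_range fun n : ℤ => w0 + n * (2 * Real.pi * I) / Real.log q).mono ?_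
    intro w hw
    have : 𝐞 w = 𝐞 w0 := by rw [hw0]; exact hw
    obtain ⟨n, hn⟩ := Complex.exp_eq_exp_iff_exists_int.1 this
    refine ⟨n, ?_⟩
    dsimp only
    field_simp
    rw [hn]
    ring
  · convert Set.countable_empty (α := ℂ)
    ext w
    simpa using fun h => ha ⟨w, h⟩

/-! ### The finite and the infinite product -/

lemma summable_norm_mul_pow (a : ℂ) : Summable fun k : ℕ => ‖a * (q : ℂ) ^ k‖ := by
  simp_rw [norm_mul, norm_pow, norm_q]
  exact (summable_geometric_of_lt_one q_pos.le q_lt_one).mul_left _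

lemma tsum_norm_mul_pow (a : ℂ) : ∑' k : ℕ, ‖a * (q : ℂ) ^ k‖ = ‖a‖ * (1 - q)⁻¹ := by
  simp_rw [norm_mul, norm_pow, norm_q]
  rw [tsum_mul_left, tsum_geometric_of_lt_one q_pos.le q_lt_one]

lemma multipliable_one_sub_mul_pow (a : ℂ) : Multipliable fun k : ℕ => 1 - a * (q : ℂ) ^ k := by
  simp_rw [sub_eq_add_neg]
  exact multipliable_one_add_of_summable (by simpa using summable_norm_mul_pow a)

lemma tendsto_qPoch (a : ℂ) : Tendsto (qPoch q a) atTop (𝓝 (qPochInf q a)) :=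
  (multipliable_one_sub_mul_pow a).hasProd.tendsto_prod_nat

omit hq in
lemma qPoch_succ_left (a : ℂ) (n : ℕ) : qPoch q a (n + 1) = (1 - a) * qPoch q (a * q) n := by
  rw [qPoch, Finset.prod_range_succ', mul_comm, qPoch]
  simp [pow_succ, mul_assoc, mul_comm]

omit hq in
lemma qPoch_succ (a : ℂ) (n : ℕ) : qPoch q a (n + 1) = qPoch q a n * (1 - a * q ^ n) :=
  Finset.prod_range_succ _ _

lemma qPochInf_eq (a : ℂ) : qPochInf q a = (1 - a) * qPochInf q (a * q) := by
  have h1 := (tendsto_qPoch (q := q) a).comp (tendsto_add_atTop_nat 1)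
  have h2 := (tendsto_qPoch (q := q) (a * q)).const_mul (1 - a)
  refine tendsto_nhds_unique h1 (h2.congr fun n => ?_)
  simp [qPoch_succ_left]

lemma qPoch_mul_qPochInf (a : ℂ) (n : ℕ) :
    qPoch q a n * qPochInf q (a * q ^ n) = qPochInf q a := by
  induction n with
  | zero => simp [qPoch]
  | succ n ih => rw [← ih, qPoch_succ, qPochInf_eq (a * q ^ n), pow_succ]; ring_nf

lemma qPochInf_ne_zero_iff (a : ℂ) : qPochInf q a ≠ 0 ↔ Regular q a := by
  constructor
  · intro h n hn
    apply h
    rw [← qPoch_mul_qPochInf a (n + 1), qPoch_succ, hn]; simp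
  · intro h
    have := tprod_one_add_ne_zero_of_summable (f := fun k : ℕ => -(a * (q : ℂ) ^ k))
      (fun k => by rw [← sub_eq_add_neg, sub_ne_zero]; exact (h k).symm)
      (by simpa using summable_norm_mul_pow a)
    simpa [qPochInf, sub_eq_add_neg] using this

lemma norm_qPoch_le (a : ℂ) (n : ℕ) : ‖qPoch q a n‖ ≤ Real.exp (‖a‖ * (1 - q)⁻¹) := by
  rw [qPoch, norm_prod]
  calc ∏ k ∈ Finset.range n, ‖1 - a * (q : ℂ) ^ k‖
      ≤ ∏ k ∈ Finset.range n, Real.exp ‖a * (q : ℂ) ^ k‖ := by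
        refine Finset.prod_le_prod (fun _ _ => norm_nonneg _) fun k _ => ?_
        refine (norm_sub_le _ _).trans ?_
        rw [norm_one, add_comm]
        exact Real.add_one_le_exp _
    _ = Real.exp (∑ k ∈ Finset.range n, ‖a * (q : ℂ) ^ k‖) := (Real.exp_sum _ _).symm
    _ ≤ _ := by
        rw [Real.exp_le_exp, ← tsum_norm_mul_pow]
        exact (summable_norm_mul_pow a).sum_le_tsum _ fun _ _ => norm_nonneg _

lemma norm_qPochInf_le (a : ℂ) : ‖qPochInf q a‖ ≤ Real.exp (‖a‖ * (1 - q)⁻¹) :=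
  le_of_tendsto (tendsto_qPoch a).norm (Eventually.of_forall fun n => norm_qPoch_le a n)

/-- On a set bounded by R the k-th factor differs from 1 by at most R q^k, so the product converges
locally uniformly. -/
lemma differentiable_qPochInf : Differentiable ℂ (qPochInf q) := by
  have key : HasProdLocallyUniformlyOn (fun (k : ℕ) (a : ℂ) => 1 + -(a * (q : ℂ) ^ k))
      (fun a => ∏' k : ℕ, (1 + -(a * (q : ℂ) ^ k))) Set.univ := by
    apply hasProdLocallyUniformlyOn_of_forall_compact isOpen_univ
    intro K _ hK
    obtain ⟨R, hR⟩ := hK.isBounded.exists_norm_le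
    refine ((summable_geometric_of_lt_one (q_pos (q := q)).le q_lt_one).mul_left
      R).hasProdUniformlyOn_nat_one_add hK (.of_forall fun n x hx => ?_) (fun _ => by fun_prop)
    rw [norm_neg, norm_mul, norm_pow, norm_q]
    exact mul_le_mul_of_nonneg_right (hR x hx) (pow_nonneg q_pos.le _)
  have h2 := key.differentiableOn (.of_forall fun s => by
    simpa [Finset.prod_fn] using DifferentiableOn.finsetProd (fun _ _ => by fun_prop)) isOpen_univ
  rw [differentiableOn_univ] at h2
  unfold qPochInf
  simpa [← sub_eq_add_neg] using h2

@[fun_prop] lemma differentiable_qeps : Differentiable ℂ ε :=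
  differentiable_qPochInf.comp differentiable_qexp

@[fun_prop] lemma differentiable_qtheta : Differentiable ℂ θ := by
  unfold qtheta; fun_prop

omit hq in
@[fun_prop] lemma differentiable_qrho (n : ℕ) : Differentiable ℂ fun w => ρ w n := by
  unfold qrho qPoch; fun_prop

lemma qeps_eq (w : ℂ) : ε w = (1 - 𝐞 w) * ε (w + 1) := by
  rw [qeps, qPochInf_eq, qeps, qexp_add, qexp_one]

@[simp] lemma qeps_zero : ε 0 = 0 := by rw [qeps_eq]; simp

omit hq in
@[simp] lemma qrho_zero_right (w : ℂ) : ρ w 0 = 1 := by simp [qrho, qPoch]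

lemma qrho_succ (w : ℂ) (n : ℕ) : ρ w (n + 1) = ρ w n * (1 - 𝐞 (w + n)) := by
  rw [qrho, qPoch_succ, qexp_add, qexp_nat, qrho]

lemma qrho_succ_left (w : ℂ) (n : ℕ) : ρ w (n + 1) = (1 - 𝐞 w) * ρ (w + 1) n := by
  rw [qrho, qPoch_succ_left, qrho, qexp_add, qexp_one]

lemma qrho_zero_left {n : ℕ} (hn : n ≠ 0) : ρ 0 n = 0 := by
  obtain ⟨m, rfl⟩ := Nat.exists_eq_succ_of_ne_zero hn
  rw [Nat.succ_eq_add_one, qrho_succ_left]; simp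

lemma qrho_mul_qeps (w : ℂ) (n : ℕ) : ρ w n * ε (w + n) = ε w := by
  rw [qrho, qeps, qexp_add, qexp_nat, qPoch_mul_qPochInf, qeps]

lemma qeps_ne_zero_iff (w : ℂ) : ε w ≠ 0 ↔ Regular q (𝐞 w) := qPochInf_ne_zero_iff _

lemma qeps_ne_zero_iff' (w : ℂ) : ε w ≠ 0 ↔ ∀ n : ℕ, 𝐞 (w + n) ≠ 1 := by
  simp [qeps_ne_zero_iff, Regular, qexp_add, qexp_nat]

lemma qeps_add_ne_zero {w : ℂ} (h : ε w ≠ 0) (n : ℕ) : ε (w + n) ≠ 0 := by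
  rw [← qrho_mul_qeps w n] at h; exact right_ne_zero_of_mul h

lemma qrho_ne_zero {w : ℂ} (h : ε w ≠ 0) (n : ℕ) : ρ w n ≠ 0 := by
  rw [← qrho_mul_qeps w n] at h; exact left_ne_zero_of_mul h

lemma qrho_eq_div {w : ℂ} {n : ℕ} (h : ε (w + n) ≠ 0) : ρ w n = ε w / ε (w + n) := by
  rw [eq_div_iff h, qrho_mul_qeps]

@[simp] lemma qeps_add_period (w : ℂ) : ε (w + qperiod q) = ε w := by simp [qeps]
@[simp] lemma qeps_sub_period (w : ℂ) : ε (w - qperiod q) = ε w := by simp [qeps]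
@[simp] lemma qrho_add_period (w : ℂ) : ρ (w + qperiod q) = ρ w := by ext; simp [qrho]
@[simp] lemma qrho_sub_period (w : ℂ) : ρ (w - qperiod q) = ρ w := by ext; simp [qrho]

lemma tendsto_qexp_add_nat (w : ℂ) : Tendsto (fun n : ℕ => 𝐞 (w + n)) atTop (𝓝 0) := by
  simp_rw [qexp_add, qexp_nat]
  have : Tendsto (fun n : ℕ => (q : ℂ) ^ n) atTop (𝓝 0) :=
    tendsto_pow_atTop_nhds_zero_of_norm_lt_one (by rw [norm_q]; exact q_lt_one)
  simpa using this.const_mul (𝐞 w)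

lemma tendsto_qeps_add_nat (w : ℂ) : Tendsto (fun n : ℕ => ε (w + n)) atTop (𝓝 1) := by
  have h : qPochInf q 0 = 1 := by simp [qPochInf]
  rw [← h]
  exact (differentiable_qPochInf.continuous.tendsto 0).comp (tendsto_qexp_add_nat w)

lemma tendsto_qrho (w : ℂ) : Tendsto (ρ w) atTop (𝓝 (ε w)) := tendsto_qPoch _

lemma qtheta_add_one (w : ℂ) : θ (w + 1) = -(𝐞 w)⁻¹ * θ w := by
  rw [qtheta, qtheta, qeps_eq w, qeps_eq (1 - (w + 1)), show 1 - (w + 1) + 1 = 1 - w by ring,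
    show 1 - (w + 1) = -w by ring, qexp_neg]
  have := qexp_ne_zero (q := q) w
  field_simp
  ring

/-- One factor of `θ` accounts for the nonnegative integers, the other for the negative ones.
Hypotheses are phrased with `θ` because this condition, unlike the one for `ε`, survives integer
shifts and reflections of the exponent. -/
lemma qtheta_ne_zero_iff (w : ℂ) : θ w ≠ 0 ↔ ∀ n : ℤ, 𝐞 (w + n) ≠ 1 := by
  rw [qtheta, mul_ne_zero_iff, qeps_ne_zero_iff', qeps_ne_zero_iff']
  constructor
  · rintro ⟨h1, h2⟩ n
    rcases n with n | n
    · simpa using h1 n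
    · have := h2 n
      exact fun h => this (qexp_eq_one_of_add_eq_zero (by push_cast; ring) h)
  · intro h
    refine ⟨fun n => by simpa using h n, fun n => ?_⟩
    exact fun h' => h (-(n + 1)) (qexp_eq_one_of_add_eq_zero (by push_cast; ring) h')

lemma qtheta_ne_zero_iff' (w : ℂ) : θ w ≠ 0 ↔ ∀ n : ℤ, 𝐞 w ≠ (q : ℂ) ^ n := by
  rw [qtheta_ne_zero_iff, ← (Equiv.neg ℤ).forall_congr_right]
  refine forall_congr' fun n => not_congr ?_
  rw [Equiv.neg_apply, Int.cast_neg, ← sub_eq_add_neg, qexp_sub, qexp_int,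
    div_eq_one_iff_eq (zpow_ne_zero _ q_cast_ne_zero)]

lemma qeps_ne_zero_of_qtheta {w : ℂ} (h : θ w ≠ 0) (n : ℤ) : ε (w + n) ≠ 0 := by
  rw [qeps_ne_zero_iff']
  intro m
  have := (qtheta_ne_zero_iff w).1 h (n + m)
  push_cast at this
  rwa [add_assoc]

lemma qeps_ne_zero_of_qtheta' {w v : ℂ} (h : θ w ≠ 0) (n : ℤ) (hv : v = n - w) : ε v ≠ 0 := by
  rw [qeps_ne_zero_iff']
  intro m hm
  exact (qtheta_ne_zero_iff w).1 h (-(n + m))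
    (qexp_eq_one_of_add_eq_zero (by rw [hv]; push_cast; ring) hm)

/-! ### Points outside a countable set -/

lemma countable_qeps_eq_zero : {w | ε w = 0}.Countable := by
  have : {w | ε w = 0} ⊆ ⋃ n : ℕ, {w | 𝐞 w = ((q : ℂ) ^ n)⁻¹} := by
    intro w hw
    have : ¬ ε w ≠ 0 := by simpa using hw
    rw [qeps_ne_zero_iff'] at this
    push Not at this
    obtain ⟨n, hn⟩ := this
    rw [qexp_add, qexp_nat] at hn
    exact Set.mem_iUnion.2 ⟨n, eq_inv_of_mul_eq_one_left hn⟩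
  exact (Set.countable_iUnion fun n => countable_qexp_eq _).mono this

omit hq in
lemma eventually_cocountable_comp {P : ℂ → Prop} (h : {w | ¬ P w}.Countable) {k : ℂ} (hk : k ≠ 0)
    (x : ℂ) : ∀ᶠ s in cocountable, P (x + k * s) := by
  rw [Filter.Eventually, mem_cocountable]
  refine (h.preimage (f := fun s => x + k * s) fun s t hst => ?_).mono fun s hs => hs
  simpa [hk] using hst

lemma eventually_qeps_ne_zero {k : ℂ} (hk : k ≠ 0) (x : ℂ) :
    ∀ᶠ s in cocountable, ε (x + k * s) ≠ 0 :=
  eventually_cocountable_comp (P := fun w => ε w ≠ 0)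
    (by simpa using countable_qeps_eq_zero (q := q)) hk x

lemma eventually_qtheta_ne_zero {k : ℂ} (hk : k ≠ 0) (x : ℂ) :
    ∀ᶠ s in cocountable, θ (x + k * s) ≠ 0 := by
  filter_upwards [eventually_qeps_ne_zero (q := q) hk x,
    eventually_qeps_ne_zero (q := q) (neg_ne_zero.2 hk) (1 - x)]
    with s h1 h2
  refine mul_ne_zero h1 ?_
  convert h2 using 2
  ring

lemma eventually_qexp_ne {k : ℂ} (hk : k ≠ 0) (x a : ℂ) :
    ∀ᶠ s in cocountable, 𝐞 (x + k * s) ≠ a :=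
  eventually_cocountable_comp (P := fun w => qexp q w ≠ a) (by simpa using countable_qexp_eq (q := q) a) hk x

omit hq in
lemma dense_of_eventually_cocountable {P : ℂ → Prop} (h : ∀ᶠ s in cocountable, P s) :
    Dense {s | P s} := by
  rw [Filter.Eventually, mem_cocountable] at h
  simpa using h.dense_compl ℂ

-- A set with countable complement is dense in ℂ, hence dense in every open set. Typically s
-- perturbs the parameters along a line, and the identity is wanted at s = 0, where genericity may
-- fail.
omit hq in
lemma eqOn_of_eventually_cocountable {F G : ℂ → ℂ} {U : Set ℂ} (hU : IsOpen U)
    (h : ∀ᶠ s in cocountable, s ∈ U → F s = G s) (hF : ContinuousOn F U) (hG : ContinuousOn G U) :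
    Set.EqOn F G U := by
  have hd := dense_of_eventually_cocountable h
  refine Set.EqOn.of_subset_closure (s := U ∩ {s | s ∈ U → F s = G s})
    (fun s hs => hs.2 hs.1) hF hG Set.inter_subset_left ?_
  exact hd.open_subset_closure_inter hU

omit hq in
lemma eq_of_eventually_cocountable {F G : ℂ → ℂ}
    (h : ∀ᶠ s in cocountable, F s = G s) (hF : Continuous F) (hG : Continuous G) (s : ℂ) :
    F s = G s :=
  eqOn_of_eventually_cocountable isOpen_univ (h.mono fun _ h _ => h) hF.continuousOn
    hG.continuousOn (Set.mem_univ s)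

end

end

section

/-! ### Locally bounded families and the series they generate -/

/-- A sequence of entire functions that is locally bounded, uniformly in the index. -/
def LocBdd (F : ℕ → ℂ → ℂ) : Prop :=
  (∀ n, Differentiable ℂ (F n)) ∧ ∀ x, ∃ C, ∀ᶠ y in 𝓝 x, ∀ n, ‖F n y‖ ≤ C

lemma LocBdd.mul {F G : ℕ → ℂ → ℂ} (hF : LocBdd F) (hG : LocBdd G) :
    LocBdd fun n s => F n s * G n s := by
  refine ⟨fun n => (hF.1 n).mul (hG.1 n), fun x => ?_⟩
  obtain ⟨C, hC⟩ := hF.2 x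
  obtain ⟨D, hD⟩ := hG.2 x
  refine ⟨C * D, ?_⟩
  filter_upwards [hC, hD] with y h1 h2 n
  rw [norm_mul]
  exact mul_le_mul (h1 n) (h2 n) (norm_nonneg _) ((norm_nonneg _).trans (h1 n))

lemma LocBdd.sub {F G : ℕ → ℂ → ℂ} (hF : LocBdd F) (hG : LocBdd G) :
    LocBdd fun n s => F n s - G n s := by
  refine ⟨fun n => (hF.1 n).sub (hG.1 n), fun x => ?_⟩
  obtain ⟨C, hC⟩ := hF.2 x
  obtain ⟨D, hD⟩ := hG.2 x
  refine ⟨C + D, ?_⟩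
  filter_upwards [hC, hD] with y h1 h2 n
  exact (norm_sub_le _ _).trans (add_le_add (h1 n) (h2 n))

lemma hasSum_of_eq {f g : ℕ → ℂ} {a : ℂ} (h : HasSum g a) (e : ∀ n, f n = g n) : HasSum f a := by
  rwa [funext e]

lemma eventually_norm_le {f : ℂ → ℂ} (hf : Continuous f) (x : ℂ) :
    ∀ᶠ y in 𝓝 x, ‖f y‖ ≤ ‖f x‖ + 1 :=
  (hf.norm.tendsto x).eventually_le_const (lt_add_one _)

lemma locBdd_const (c : ℂ) : LocBdd fun _ _ => c :=
  ⟨fun _ => differentiable_const _, fun _ => ⟨‖c‖, Eventually.of_forall fun _ _ => le_rfl⟩⟩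

lemma LocBdd.summable {F : ℕ → ℂ → ℂ} (hF : LocBdd F) {t : ℂ} (ht : ‖t‖ < 1) (s : ℂ) :
    Summable fun n => F n s * t ^ n := by
  obtain ⟨C, hC⟩ := hF.2 s
  refine Summable.of_norm_bounded
    (g := fun n => C * ‖t‖ ^ n) ((summable_geometric_of_lt_one (norm_nonneg _) ht).mul_left C)
    fun n => ?_
  rw [norm_mul, norm_pow]
  exact mul_le_mul_of_nonneg_right (hC.self_of_nhds n) (pow_nonneg (norm_nonneg _) _)

/-- Weierstrass's test with the majorant C r^n near x, where |t x| < r < 1. The ratio t may vary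
with s, as it does in the very-well-poised series, whose argument depends on the parameters. -/
lemma LocBdd.differentiableOn_tsum {F : ℕ → ℂ → ℂ} (hF : LocBdd F) {t : ℂ → ℂ}
    (ht : Differentiable ℂ t) : DifferentiableOn ℂ (fun s => ∑' n, F n s * t s ^ n)
      {s | ‖t s‖ < 1} := by
  intro x hx
  obtain ⟨C, hC⟩ := hF.2 x
  obtain ⟨r, hr1, hr2⟩ := exists_between (show ‖t x‖ < 1 from hx)
  have hr : ∀ᶠ y in 𝓝 x, ‖t y‖ < r := (ht.continuous.norm.tendsto x).eventually_lt_const hr1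
  obtain ⟨V, hV, hVo, hxV⟩ := eventually_nhds_iff.1 (hC.and hr)
  have := Complex.differentiableOn_tsum_of_summable_norm (U := V) (F := fun n s => F n s * t s ^ n)
    ((summable_geometric_of_lt_one ((norm_nonneg _).trans hr1.le) hr2).mul_left C)
    (fun n => ((hF.1 n).mul (ht.pow n)).differentiableOn) hVo fun n y hy => by
      rw [norm_mul, norm_pow]
      have h1 := (hV y hy).1 n
      exact mul_le_mul h1 (pow_le_pow_left₀ (norm_nonneg _) (hV y hy).2.le n)
        (pow_nonneg (norm_nonneg _) _) ((norm_nonneg _).trans h1)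
  exact (this.differentiableAt (hVo.mem_nhds hxV)).differentiableWithinAt

variable [hq : Fact (0 < q ∧ q < 1)]

include hq

lemma locBdd_qrho {f : ℂ → ℂ} (hf : Differentiable ℂ f) : LocBdd fun n s => ρ (f s) n := by
  refine ⟨fun n => (differentiable_qrho n).comp hf,
    fun x => ⟨Real.exp ((‖𝐞 (f x)‖ + 1) * (1 - q)⁻¹), ?_⟩⟩
  · filter_upwards [eventually_norm_le ((continuous_qexp (q := q)).comp hf.continuous) x]
      with y hy n
    refine (norm_qPoch_le _ n).trans (Real.exp_le_exp.2 (mul_le_mul_of_nonneg_right hy ?_))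
    exact inv_nonneg.2 (sub_nonneg.2 (q_lt_one (q := q)).le)

lemma norm_qexp_add_nat_le (w : ℂ) (n : ℕ) : ‖𝐞 (w + n)‖ ≤ ‖𝐞 w‖ := by
  rw [qexp_add, qexp_nat, norm_mul, norm_pow, norm_q]
  exact mul_le_of_le_one_right (norm_nonneg _) (pow_le_one₀ q_pos.le (q_lt_one (q := q)).le)

lemma locBdd_qeps {f : ℂ → ℂ} (hf : Differentiable ℂ f) : LocBdd fun n s => ε (f s + n) := by
  refine ⟨fun n => by fun_prop, fun x => ⟨Real.exp ((‖𝐞 (f x)‖ + 1) * (1 - q)⁻¹), ?_⟩⟩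
  · filter_upwards [eventually_norm_le ((continuous_qexp (q := q)).comp hf.continuous) x]
      with y hy n
    refine (norm_qPochInf_le _).trans (Real.exp_le_exp.2 (mul_le_mul_of_nonneg_right
      ((norm_qexp_add_nat_le _ n).trans hy) ?_))
    exact inv_nonneg.2 (sub_nonneg.2 (q_lt_one (q := q)).le)

lemma locBdd_qexp {f : ℂ → ℂ} (hf : Differentiable ℂ f) :
    LocBdd fun n s => 𝐞 (f s + 2 * n) := by
  refine ⟨fun n => by fun_prop, fun x => ⟨‖𝐞 (f x)‖ + 1, ?_⟩⟩
  · filter_upwards [eventually_norm_le ((continuous_qexp (q := q)).comp hf.continuous) x]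
      with y hy n
    have := norm_qexp_add_nat_le (q := q) (f y) (2 * n)
    push_cast at this
    exact this.trans hy

omit hq in
/-- The balanced `₄φ₃` series with exponents as parameters, multiplied by the infinite products
that make it entire. -/
def balSeries (q : ℝ) (x₁ x₂ x₃ x₄ y₁ y₂ y₃ : ℂ) : ℂ :=
  ∑' n : ℕ, (qrho q x₁ n * qrho q x₂ n * qrho q x₃ n * qrho q x₄ n
    * (qeps q (1 + n) * qeps q (y₁ + n) * qeps q (y₂ + n) * qeps q (y₃ + n))) * (q : ℂ) ^ n

omit hq in
/-- The function `u_ν(x(z); a, b, c; d)` in terms of exponents, multiplied by the infinite products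
that make it entire. -/
def uHat (q : ℝ) (α β γ δ ν z : ℂ) : ℂ :=
  qeps q (β + γ + ν) * qeps q (1 - ν - α - δ) * (qeps q (1 + z - δ) * qeps q (1 - z - δ))
    * balSeries q (-ν) (α + β + γ + δ + ν - 1) (α + z) (α - z) (α + β) (α + γ) (α + δ)
  - qexp q (1 - α - δ) * (qeps q (-ν) * qeps q (α + β + γ + δ + ν - 1))
    * (qeps q (α + z) * qeps q (α - z))
    * balSeries q (1 - ν - α - δ) (β + γ + ν) (1 + z - δ) (1 - z - δ) (1 + β - δ) (1 + γ - δ)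
      (2 - α - δ)

omit hq in
/-- The summands, without the power, of `vwpHat`. -/
def vwpTerm (q : ℝ) (α β γ δ ν : ℂ) (n : ℕ) (z : ℂ) : ℂ :=
  (1 - qexp q (α - ν - δ + 2 * n)) * (qrho q (α - ν - δ) n * qrho q (-ν) n
    * qrho q (1 - ν - β - δ) n * qrho q (1 - ν - γ - δ) n * (qrho q (α + z) n * qrho q (α - z) n))
    * (qeps q (1 + n) * qeps q (1 + α - δ + n) * qeps q (α + β + n) * qeps q (α + γ + n)
      * (qeps q (1 - ν + z - δ + n) * qeps q (1 - ν - z - δ + n)))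

omit hq in
/-- The very-well-poised series for `u_ν(x(z); a, b, c; d)` in terms of exponents, multiplied by
the infinite products that remove its poles. -/
def vwpHat (q : ℝ) (α β γ δ ν z : ℂ) : ℂ :=
  ∑' n : ℕ, vwpTerm q α β γ δ ν n z * qexp q (β + γ + ν) ^ n

lemma locBdd_balSeries {x₁ x₂ x₃ x₄ y₁ y₂ y₃ : ℂ → ℂ}
    (h₁ : Differentiable ℂ x₁) (h₂ : Differentiable ℂ x₂) (h₃ : Differentiable ℂ x₃)
    (h₄ : Differentiable ℂ x₄) (k₁ : Differentiable ℂ y₁) (k₂ : Differentiable ℂ y₂)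
    (k₃ : Differentiable ℂ y₃) :
    LocBdd fun n s => ρ (x₁ s) n * ρ (x₂ s) n * ρ (x₃ s) n * ρ (x₄ s) n
      * (ε (1 + n) * ε (y₁ s + n) * ε (y₂ s + n) * ε (y₃ s + n)) :=
  ((((locBdd_qrho h₁).mul (locBdd_qrho h₂)).mul (locBdd_qrho h₃)).mul (locBdd_qrho h₄)).mul
    ((((locBdd_qeps (differentiable_const 1)).mul (locBdd_qeps k₁)).mul (locBdd_qeps k₂)).mul
      (locBdd_qeps k₃))

lemma summable_balSeries (x₁ x₂ x₃ x₄ y₁ y₂ y₃ : ℂ) :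
    Summable fun n : ℕ => (ρ x₁ n * ρ x₂ n * ρ x₃ n * ρ x₄ n
      * (ε (1 + n) * ε (y₁ + n) * ε (y₂ + n) * ε (y₃ + n))) * (q : ℂ) ^ n :=
  (locBdd_balSeries (differentiable_const x₁) (differentiable_const x₂) (differentiable_const x₃)
    (differentiable_const x₄) (differentiable_const y₁) (differentiable_const y₂)
    (differentiable_const y₃)).summable (by rw [norm_q]; exact q_lt_one) 0

lemma hasSum_balSeries (x₁ x₂ x₃ x₄ y₁ y₂ y₃ : ℂ) :
    HasSum (fun n : ℕ => (ρ x₁ n * ρ x₂ n * ρ x₃ n * ρ x₄ n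
      * (ε (1 + n) * ε (y₁ + n) * ε (y₂ + n) * ε (y₃ + n))) * (q : ℂ) ^ n)
      (balSeries q x₁ x₂ x₃ x₄ y₁ y₂ y₃) :=
  (summable_balSeries x₁ x₂ x₃ x₄ y₁ y₂ y₃).hasSum

@[fun_prop]
lemma differentiable_balSeries {x₁ x₂ x₃ x₄ y₁ y₂ y₃ : ℂ → ℂ}
    (h₁ : Differentiable ℂ x₁) (h₂ : Differentiable ℂ x₂) (h₃ : Differentiable ℂ x₃)
    (h₄ : Differentiable ℂ x₄) (k₁ : Differentiable ℂ y₁) (k₂ : Differentiable ℂ y₂)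
    (k₃ : Differentiable ℂ y₃) :
    Differentiable ℂ fun s => balSeries q (x₁ s) (x₂ s) (x₃ s) (x₄ s) (y₁ s) (y₂ s) (y₃ s) := by
  have := (locBdd_balSeries (q := q) h₁ h₂ h₃ h₄ k₁ k₂ k₃).differentiableOn_tsum
    (differentiable_const (q : ℂ))
  rw [norm_q] at this
  unfold balSeries
  simpa [q_lt_one, differentiableOn_univ] using this

@[fun_prop]
lemma differentiable_uHat {α β γ δ ν z : ℂ → ℂ} (hα : Differentiable ℂ α)
    (hβ : Differentiable ℂ β) (hγ : Differentiable ℂ γ) (hδ : Differentiable ℂ δ)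
    (hν : Differentiable ℂ ν) (hz : Differentiable ℂ z) :
    Differentiable ℂ fun s => uHat q (α s) (β s) (γ s) (δ s) (ν s) (z s) := by
  unfold uHat; fun_prop

lemma locBdd_vwpTerm {α β γ δ ν z : ℂ → ℂ} (hα : Differentiable ℂ α)
    (hβ : Differentiable ℂ β) (hγ : Differentiable ℂ γ) (hδ : Differentiable ℂ δ)
    (hν : Differentiable ℂ ν) (hz : Differentiable ℂ z) :
    LocBdd fun n s => vwpTerm q (α s) (β s) (γ s) (δ s) (ν s) n (z s) := by
  unfold vwpTerm
  refine (((locBdd_const 1).sub (locBdd_qexp (by fun_prop))).mul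
    (((((locBdd_qrho ?_).mul (locBdd_qrho ?_)).mul (locBdd_qrho ?_)).mul (locBdd_qrho ?_)).mul
      ((locBdd_qrho ?_).mul (locBdd_qrho ?_)))).mul
    (((((locBdd_qeps ?_).mul (locBdd_qeps ?_)).mul (locBdd_qeps ?_)).mul (locBdd_qeps ?_)).mul
      ((locBdd_qeps ?_).mul (locBdd_qeps ?_))) <;> fun_prop

lemma differentiableOn_vwpHat {α β γ δ ν z : ℂ → ℂ} (hα : Differentiable ℂ α)
    (hβ : Differentiable ℂ β) (hγ : Differentiable ℂ γ) (hδ : Differentiable ℂ δ)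
    (hν : Differentiable ℂ ν) (hz : Differentiable ℂ z) :
    DifferentiableOn ℂ (fun s => vwpHat q (α s) (β s) (γ s) (δ s) (ν s) (z s))
      {s | ‖𝐞 (β s + γ s + ν s)‖ < 1} :=
  (locBdd_vwpTerm hα hβ hγ hδ hν hz).differentiableOn_tsum (t := fun s => 𝐞 (β s + γ s + ν s))
    (by fun_prop)

lemma summable_vwpHat (α β γ δ ν z : ℂ) (h : ‖𝐞 (β + γ + ν)‖ < 1) :
    Summable fun n : ℕ => vwpTerm q α β γ δ ν n z * 𝐞 (β + γ + ν) ^ n :=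
  (locBdd_vwpTerm (differentiable_const α) (differentiable_const β) (differentiable_const γ)
    (differentiable_const δ) (differentiable_const ν) (differentiable_const z)).summable h 0

/-! ### Passage from the series in the statement -/

omit hq in
lemma qPoch_qexp (x : ℂ) (n : ℕ) : qPoch q (𝐞 x) n = ρ x n := rfl
omit hq in
lemma qPochInf_qexp (x : ℂ) : qPochInf q (𝐞 x) = ε x := rfl
omit hq in
lemma qPochs_nil (n : ℕ) : qPochs q [] n = 1 := rfl
omit hq in
lemma qPochs_cons (a : ℂ) (l : List ℂ) (n : ℕ) :
    qPochs q (a :: l) n = qPoch q a n * qPochs q l n := rfl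
omit hq in
lemma qPochsInf_nil : qPochsInf q [] = 1 := rfl
omit hq in
lemma qPochsInf_cons (a : ℂ) (l : List ℂ) :
    qPochsInf q (a :: l) = qPochInf q a * qPochsInf q l := rfl

lemma qeps_one_ne_zero : ε 1 ≠ 0 := by
  rw [qeps_ne_zero_iff']
  intro n h
  rw [show (1 : ℂ) + n = ((n + 1 : ℕ) : ℂ) by push_cast; ring, qexp_nat] at h
  have := congrArg norm h
  rw [norm_pow, norm_q, norm_one] at this
  exact absurd this (pow_lt_one₀ q_pos.le q_lt_one n.succ_ne_zero).ne

/-- Since (y; q)_n (y q^n; q)_∞ = (y; q)_∞, dividing the n-th summand by (y; q)_n amounts to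
inserting (y q^n; q)_∞ and dividing the whole sum by (y; q)_∞. The factor (q; q)_n is treated alike,
whence `ε 1`. -/
lemma basicHyp_eq_balSeries {a₁ a₂ a₃ a₄ b₁ b₂ b₃ : ℂ} (x₁ x₂ x₃ x₄ y₁ y₂ y₃ : ℂ)
    (h₁ : a₁ = 𝐞 x₁) (h₂ : a₂ = 𝐞 x₂) (h₃ : a₃ = 𝐞 x₃) (h₄ : a₄ = 𝐞 x₄)
    (k₁ : b₁ = 𝐞 y₁) (k₂ : b₂ = 𝐞 y₂) (k₃ : b₃ = 𝐞 y₃)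
    (n₁ : ε y₁ ≠ 0) (n₂ : ε y₂ ≠ 0) (n₃ : ε y₃ ≠ 0) :
    basicHyp q [a₁, a₂, a₃, a₄] [b₁, b₂, b₃] q
      = balSeries q x₁ x₂ x₃ x₄ y₁ y₂ y₃ / (ε 1 * ε y₁ * ε y₂ * ε y₃) := by
  rw [balSeries, basicHyp, ← tsum_div_const]
  refine tsum_congr fun n => ?_
  subst h₁ h₂ h₃ h₄ k₁ k₂ k₃
  rw [← qexp_one]
  simp only [qPochs_cons, qPochs_nil, mul_one, List.length_cons, List.length_nil]
  norm_num
  simp only [qPoch_qexp]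
  have n₀ := qeps_one_ne_zero (q := q)
  have m₀ := qeps_add_ne_zero n₀ n
  have m₁ := qeps_add_ne_zero n₁ n
  have m₂ := qeps_add_ne_zero n₂ n
  have m₃ := qeps_add_ne_zero n₃ n
  rw [← qrho_mul_qeps 1 n, ← qrho_mul_qeps y₁ n, ← qrho_mul_qeps y₂ n, ← qrho_mul_qeps y₃ n]
  have p₀ := qrho_ne_zero n₀ n
  have p₁ := qrho_ne_zero n₁ n
  have p₂ := qrho_ne_zero n₂ n
  have p₃ := qrho_ne_zero n₃ n
  field_simp

/-- The factor by which `u_ν(x(z); a, b, c; d)` differs from `uHat`. -/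
lemma u_eq_uHat {α β γ δ ν z : ℂ} (hαβ : ε (α + β) ≠ 0) (hαγ : ε (α + γ) ≠ 0)
    (hβγ : ε (β + γ) ≠ 0) (hαδ : θ (α + δ) ≠ 0) (hβδ : ε (1 + β - δ) ≠ 0)
    (hγδ : ε (1 + γ - δ) ≠ 0) (hz1 : ε (1 + z - δ) ≠ 0) (hz2 : ε (1 - z - δ) ≠ 0) :
    u q ν (𝐞 α) (𝐞 β) (𝐞 γ) (𝐞 δ) z = uHat q α β γ δ ν z / (ε (1 + z - δ) * ε (1 - z - δ))
      / (ε (α + β) * ε (α + γ) * ε (β + γ) * ε 1 * θ (α + δ)) := by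
  have h1 : ε (α + δ) ≠ 0 := by simpa using qeps_ne_zero_of_qtheta hαδ 0
  have h2 : ε (1 - α - δ) ≠ 0 := qeps_ne_zero_of_qtheta' hαδ 1 (by push_cast; ring)
  have h3 : ε (2 - α - δ) ≠ 0 := qeps_ne_zero_of_qtheta' hαδ 2 (by push_cast; ring)
  have h4 : ε (α + δ - 1) = (1 - 𝐞 (α + δ - 1)) * ε (α + δ) := by
    rw [qeps_eq]; ring_nf
  have h5 : ε (1 - α - δ) = (1 - 𝐞 (1 - α - δ)) * ε (2 - α - δ) := by
    rw [qeps_eq]; ring_nf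
  have h6 : 1 - 𝐞 (1 - α - δ) ≠ 0 := fun h => h2 (by rw [h5, h, zero_mul])
  have e0 := qexp_ne_zero (q := q) α
  have e1 := qexp_ne_zero (q := q) δ
  have e2 := q_cast_ne_zero (q := q)
  have h7 : 1 - 𝐞 (α + δ - 1) ≠ 0 := by
    rw [show α + δ - 1 = -(1 - α - δ) by ring, qexp_neg]
    intro h
    apply h6
    have := sub_eq_zero.1 h
    rw [← inv_inj, inv_one, inv_inv] at this
    rw [← this, sub_self]
  rw [u, basicHyp_eq_balSeries (-ν) (α + β + γ + δ + ν - 1) (α + z) (α - z) (α + β) (α + γ) (α + δ)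
    _ _ _ _ _ _ _ hαβ hαγ h1,
    basicHyp_eq_balSeries (1 - ν - α - δ) (β + γ + ν) (1 + z - δ) (1 - z - δ) (1 + β - δ)
      (1 + γ - δ) (2 - α - δ) _ _ _ _ _ _ _ hβδ hγδ h3, uHat]
  · simp only [qPochsInf_cons, qPochsInf_nil, mul_one, cpow_eq_qexp]
    simp only [← qexp_one, ← qexp_add, ← qexp_sub]
    simp only [qPochInf_qexp]
    have r1 : 1 - ν - (α + δ) = 1 - ν - α - δ := by ring
    have r2 : 1 - (α + δ) = 1 - α - δ := by ring
    have r3 : α + β + γ + δ + (ν - 1) = α + β + γ + δ + ν - 1 := by ring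
    have r4 : α + -z = α - z := by ring
    rw [r1, r2, r3, r4, h4, qtheta, r2, h5]
    have n0 := qeps_one_ne_zero (q := q)
    -- The factor 1 - ad/q of (ad/q; q)_∞ is traded for 1 - q/(ad). With E = q/(ad), the relation 1
    -- - E⁻¹ = -(1 - E)/E is the source of the minus sign and of the factor q^(1-α-δ) in `uHat`.
    have h8 : 𝐞 (α + δ - 1) = (𝐞 (1 - α - δ))⁻¹ := by rw [← qexp_neg]; ring_nf
    rw [h8] at h7 ⊢
    set E := 𝐞 (1 - α - δ) with hE
    have hE0 : E ≠ 0 := qexp_ne_zero _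
    have h9 : 1 - E⁻¹ = -(1 - E) / E := by field_simp; ring
    rw [h9]
    field_simp
    ring
  all_goals try simp only [cpow_eq_qexp]
  all_goals simp only [← qexp_one, ← qexp_add, ← qexp_sub, pow_two]
  all_goals congr 1
  all_goals ring

-- (r, -r; q)_n is the product of the 1 - r² q^(2k), and passing from r to qr shifts k by one, so
-- that only the end factors differ. For r² = A the quotient is the very-well-poised factor (1 - A
-- q^(2n))/(1 - A).
omit hq in
lemma qPoch_mul_qPoch_neg (r : ℂ) (n : ℕ) :
    qPoch q ((q : ℂ) * r) n * qPoch q (-((q : ℂ) * r)) n * (1 - r ^ 2)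
      = qPoch q r n * qPoch q (-r) n * (1 - r ^ 2 * (q : ℂ) ^ (2 * n)) := by
  induction n with
  | zero => simp [qPoch]
  | succ n ih =>
    simp only [qPoch_succ]
    linear_combination ((1 - (q : ℂ) * r * q ^ n) * (1 - -((q : ℂ) * r) * q ^ n)) * ih

omit hq in
lemma qPoch_sqrt_ne_zero {r : ℂ} (h : Regular q (r ^ 2)) (n : ℕ) :
    qPoch q r n * qPoch q (-r) n ≠ 0 := by
  simp only [qPoch, ← Finset.prod_mul_distrib]
  refine Finset.prod_ne_zero_iff.2 fun k _ h0 => h (2 * k) ?_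
  linear_combination -h0

/-- A very-well-poised `₈φ₇` series in the normalization of `vwpHat`. -/
lemma basicHyp_eq_vwpHat {A e₁ e₂ e₃ e₄ e₅ f₁ f₂ f₃ f₄ f₅ t : ℂ} {α β γ δ ν z : ℂ}
    (hA : A = 𝐞 (α - ν - δ)) (h₁ : e₁ = 𝐞 (-ν)) (h₂ : e₂ = 𝐞 (1 - ν - β - δ))
    (h₃ : e₃ = 𝐞 (1 - ν - γ - δ)) (h₄ : e₄ = 𝐞 (α + z)) (h₅ : e₅ = 𝐞 (α - z))
    (k₁ : f₁ = 𝐞 (1 + α - δ)) (k₂ : f₂ = 𝐞 (α + β)) (k₃ : f₃ = 𝐞 (α + γ))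
    (k : f₄ = 𝐞 (1 - ν - z - δ) ∧ f₅ = 𝐞 (1 - ν + z - δ) ∨
      f₄ = 𝐞 (1 - ν + z - δ) ∧ f₅ = 𝐞 (1 - ν - z - δ))
    (ht : t = 𝐞 (β + γ + ν)) (n₀ : ε (α - ν - δ) ≠ 0)
    (n₁ : ε (1 + α - δ) ≠ 0) (n₂ : ε (α + β) ≠ 0) (n₃ : ε (α + γ) ≠ 0)
    (n₄ : ε (1 - ν + z - δ) ≠ 0) (n₅ : ε (1 - ν - z - δ) ≠ 0) :
    basicHyp q
      [A, (q : ℂ) * A ^ (1 / 2 : ℂ), -((q : ℂ) * A ^ (1 / 2 : ℂ)), e₁, e₂, e₃, e₄, e₅]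
      [A ^ (1 / 2 : ℂ), -(A ^ (1 / 2 : ℂ)), f₁, f₂, f₃, f₄, f₅] t
      = vwpHat q α β γ δ ν z / ((1 - A) * ε 1 * ε (1 + α - δ) * ε (α + β) * ε (α + γ)
        * ε (1 - ν + z - δ) * ε (1 - ν - z - δ)) := by
  rw [vwpHat, basicHyp, ← tsum_div_const]
  refine tsum_congr fun n => ?_
  have hr : (A ^ (1 / 2 : ℂ)) ^ 2 = A := by
    rw [one_div]; exact Complex.cpow_nat_inv_pow A two_ne_zero
  have hreg : Regular q A := by rw [hA]; exact (qeps_ne_zero_iff _).1 n₀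
  have s1 := qPoch_mul_qPoch_neg (q := q) (A ^ (1 / 2 : ℂ)) n
  have s2 := qPoch_sqrt_ne_zero (r := A ^ (1 / 2 : ℂ)) (by rwa [hr]) n
  rw [hr] at s1
  have s3 : 1 - A ≠ 0 := by
    intro h
    apply hreg 0
    linear_combination -h
  simp only [qPochs_cons, qPochs_nil, mul_one, List.length_cons, List.length_nil]
  norm_num
  have s4 : A * (q : ℂ) ^ (2 * n) = 𝐞 (α - ν - δ + 2 * n) := by
    rw [hA, qexp_add, ← qexp_nat]; push_cast; rfl
  rw [s4] at s1
  have s5 : qPoch q ((q : ℂ) * A ^ (1 / 2 : ℂ)) n * qPoch q (-((q : ℂ) * A ^ (1 / 2 : ℂ))) n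
    / (qPoch q (A ^ (1 / 2 : ℂ)) n * qPoch q (-(A ^ (1 / 2 : ℂ))) n)
      = (1 - 𝐞 (α - ν - δ + 2 * n)) / (1 - A) := by
    rw [div_eq_div_iff s2 s3, s1]; ring
  have n₆ := qeps_one_ne_zero (q := q)
  -- The last two lower parameters occur in one order in `uSeries` and in the opposite order in
  -- `veryWellPoised`.
  have key : qPoch q f₄ n * qPoch q f₅ n = ρ (1 - ν + z - δ) n * ρ (1 - ν - z - δ) n := by
    rcases k with ⟨rfl, rfl⟩ | ⟨rfl, rfl⟩
    · rw [mul_comm]; rfl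
    · rfl
  have s6 : qPoch q A n *
          (qPoch q ((q : ℂ) * A ^ (1 / 2 : ℂ)) n *
            (qPoch q (-((q : ℂ) * A ^ (1 / 2 : ℂ))) n *
              (qPoch q e₁ n * (qPoch q e₂ n * (qPoch q e₃ n * (qPoch q e₄ n * qPoch q e₅ n)))))) /
        (qPoch q (q : ℂ) n *
          (qPoch q (A ^ (1 / 2 : ℂ)) n *
            (qPoch q (-(A ^ (1 / 2 : ℂ))) n *
              (qPoch q f₁ n * (qPoch q f₂ n * (qPoch q f₃ n * (qPoch q f₄ n * qPoch q f₅ n)))))))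
      = (qPoch q ((q : ℂ) * A ^ (1 / 2 : ℂ)) n * qPoch q (-((q : ℂ) * A ^ (1 / 2 : ℂ))) n
    / (qPoch q (A ^ (1 / 2 : ℂ)) n * qPoch q (-(A ^ (1 / 2 : ℂ))) n)) *
        (qPoch q A n * qPoch q e₁ n * qPoch q e₂ n * qPoch q e₃ n * (qPoch q e₄ n * qPoch q e₅ n)
        / (qPoch q (q : ℂ) n * qPoch q f₁ n * qPoch q f₂ n * qPoch q f₃ n *
          (qPoch q f₄ n * qPoch q f₅ n))) := by
    rw [div_mul_div_comm]
    congr 1 <;> ring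
  norm_num at s6 s5
  rw [s6, s5, key, vwpTerm, ht]
  subst h₁ h₂ h₃ h₄ h₅ k₁ k₂ k₃
  conv_lhs => rw [← qexp_one]
  have s7 : qPoch q A n = ρ (α - ν - δ) n := by rw [hA]; rfl
  rw [s7]
  simp only [qPoch_qexp]
  have m₁ := qeps_add_ne_zero n₁ n
  have m₂ := qeps_add_ne_zero n₂ n
  have m₃ := qeps_add_ne_zero n₃ n
  have m₄ := qeps_add_ne_zero n₄ n
  have m₅ := qeps_add_ne_zero n₅ n
  have m₆ := qeps_add_ne_zero n₆ n
  rw [← qrho_mul_qeps 1 n, ← qrho_mul_qeps (1 + α - δ) n, ← qrho_mul_qeps (α + β) n,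
    ← qrho_mul_qeps (α + γ) n, ← qrho_mul_qeps (1 - ν + z - δ) n, ← qrho_mul_qeps (1 - ν - z - δ) n]
  have p₁ := qrho_ne_zero n₁ n
  have p₂ := qrho_ne_zero n₂ n
  have p₃ := qrho_ne_zero n₃ n
  have p₄ := qrho_ne_zero n₄ n
  have p₅ := qrho_ne_zero n₅ n
  have p₆ := qrho_ne_zero n₆ n
  field_simp

end

section

/-! ### The Askey–Wilson operator -/

/-- The coefficient of the Askey–Wilson operator. -/
def awCoeff (q : ℝ) (α β γ δ z : ℂ) : ℂ :=
  (1 - qexp q (α + z)) * (1 - qexp q (β + z)) * (1 - qexp q (γ + z)) * (1 - qexp q (δ + z))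
    / ((1 - qexp q (2 * z)) * (1 - qexp q (2 * z + 1)))

/-- The Askey–Wilson operator minus its eigenvalue. -/
def awOp (q : ℝ) (α β γ δ ν : ℂ) (f : ℂ → ℂ) (z : ℂ) : ℂ :=
  awCoeff q α β γ δ z * (f (z + 1) - f z) + awCoeff q α β γ δ (-z) * (f (z - 1) - f z)
    - (qexp q (-ν) - 1) * (1 - qexp q (α + β + γ + δ + ν - 1)) * f z

/-- The functions on which the Askey–Wilson operator is triangular. -/
def awBasis (q : ℝ) (α s z : ℂ) : ℂ :=
  qeps q (α + z) * qeps q (α - z) / (qeps q (α + s + z) * qeps q (α + s - z))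

/-- The denominator of `u_ν(x(z); a, b, c; d)`. -/
def qden (q : ℝ) (δ z : ℂ) : ℂ := qeps q (1 + z - δ) * qeps q (1 - z - δ)

lemma hasSum_awOp {α β γ δ ν z : ℂ} {F : ℕ → ℂ → ℂ} {f : ℂ → ℂ}
    (h0 : HasSum (fun n => F n z) (f z)) (h1 : HasSum (fun n => F n (z + 1)) (f (z + 1)))
    (h2 : HasSum (fun n => F n (z - 1)) (f (z - 1))) :
    HasSum (fun n => awOp q α β γ δ ν (F n) z) (awOp q α β γ δ ν f z) :=
  (((h1.sub h0).mul_left _).add ((h2.sub h0).mul_left _)).sub (h0.mul_left _)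

lemma awOp_const_mul {α β γ δ ν z c : ℂ} {f : ℂ → ℂ} :
    awOp q α β γ δ ν (fun z => c * f z) z = c * awOp q α β γ δ ν f z := by
  unfold awOp; ring

lemma awOp_sub {α β γ δ ν z : ℂ} {f g : ℂ → ℂ} :
    awOp q α β γ δ ν (fun z => f z - g z) z
      = awOp q α β γ δ ν f z - awOp q α β γ δ ν g z := by
  unfold awOp; ring

/-- The rational identity behind the triangular action. -/
lemma awOp_rational {a b c d S y Q w : ℂ} (hQ : Q ≠ 0) (hy : y ≠ 0) (hS : S ≠ 0) (hw : w ≠ 0)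
    (h1 : y ^ 2 ≠ 1) (h2 : Q * y ^ 2 ≠ 1) (h3 : Q ≠ y ^ 2) (h4 : a * y ≠ 1) (h5 : a ≠ y)
    (h6 : Q ≠ a * S * y) (h7 : Q * y ≠ a * S) :
    (1 - a * y) * (1 - b * y) * (1 - c * y) * (1 - d * y) / ((1 - y ^ 2) * (1 - y ^ 2 * Q))
        * ((1 - a * S * y) * (1 - a / (Q * y)) / ((1 - a * y) * (1 - a * S / (Q * y))) - 1)
      + (1 - a / y) * (1 - b / y) * (1 - c / y) * (1 - d / y)
          / ((1 - 1 / y ^ 2) * (1 - Q / y ^ 2))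
        * ((1 - a * S / y) * (1 - a * y / Q) / ((1 - a / y) * (1 - a * S * y / Q)) - 1)
      - (1 / w - 1) * (1 - a * b * c * d * w / Q)
    = 1 / S * (1 - S / w) * (1 - a * b * c * d * w * S / Q)
      - 1 / S * (1 - S) * (1 - a * b * S / Q) * (1 - a * c * S / Q) * (1 - a * d * S / Q)
        / ((1 - a * S * y / Q) * (1 - a * S / (Q * y))) := by
  have k1 : 1 - y ^ 2 ≠ 0 := sub_ne_zero.2 h1.symm
  have k1' : 1 - 1 / y ^ 2 ≠ 0 := by
    rw [sub_ne_zero]; intro h; apply h1; field_simp at h; exact h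
  have k2 : 1 - y ^ 2 * Q ≠ 0 := by rw [sub_ne_zero, mul_comm]; exact h2.symm
  have k3 : 1 - Q / y ^ 2 ≠ 0 := by
    rw [sub_ne_zero]; intro h; apply h3; field_simp at h; exact h.symm
  have k4 : 1 - a * y ≠ 0 := sub_ne_zero.2 h4.symm
  have k5 : 1 - a / y ≠ 0 := by
    rw [sub_ne_zero]; intro h; apply h5; field_simp at h; exact h.symm
  have k6 : Q - a * S * y ≠ 0 := sub_ne_zero.2 h6
  have k7 : Q * y - a * S ≠ 0 := sub_ne_zero.2 h7
  have k7' : y * Q - a * S ≠ 0 := by rwa [mul_comm y]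
  have k8 : y ^ 2 - 1 ≠ 0 := sub_ne_zero.2 h1
  have e6 : 1 - a * S * y / Q = (Q - a * S * y) / Q := by field_simp
  have e7 : 1 - a * S / (Q * y) = (Q * y - a * S) / (Q * y) := by field_simp
  -- The bracket has the factor 1 - y²Q, and the one in `t2` the factor 1 - Q/y². These cancel the
  -- poles of the coefficients that depend on the step, and both terms retain a factor 1 - S.
  have t1 : (1 - a * y) * (1 - b * y) * (1 - c * y) * (1 - d * y)
        / ((1 - y ^ 2) * (1 - y ^ 2 * Q))
        * ((1 - a * S * y) * (1 - a / (Q * y)) / ((1 - a * y) * (1 - a * S / (Q * y))) - 1)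
      = (1 - S) * (-a * (1 - b * y) * (1 - c * y) * (1 - d * y)
          / ((1 - y ^ 2) * (Q * y - a * S))) := by
    rw [e7]
    have : (1 - a * S * y) * (1 - a / (Q * y)) / ((1 - a * y) * ((Q * y - a * S) / (Q * y))) - 1
      = (1 - S) * (1 - y ^ 2 * Q) * (-a) / ((1 - a * y) * (Q * y - a * S)) := by
      field_simp
      ring
    rw [this]
    field_simp
  have t2 : (1 - a / y) * (1 - b / y) * (1 - c / y) * (1 - d / y)
          / ((1 - 1 / y ^ 2) * (1 - Q / y ^ 2))
        * ((1 - a * S / y) * (1 - a * y / Q) / ((1 - a / y) * (1 - a * S * y / Q)) - 1)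
      = (1 - S) * (-a * (1 - b / y) * (1 - c / y) * (1 - d / y) * y
          / ((1 - 1 / y ^ 2) * (Q - a * S * y))) := by
    rw [e6]
    have : (1 - a * S / y) * (1 - a * y / Q) / ((1 - a / y) * ((Q - a * S * y) / Q)) - 1
      = (1 - S) * (1 - Q / y ^ 2) * (-a * y) / ((1 - a / y) * (Q - a * S * y)) := by
      field_simp
      ring
    rw [this]
    field_simp
  rw [t1, t2, e6, e7]
  have t3 : (1 : ℂ) - 1 / y ^ 2 = (y ^ 2 - 1) / y ^ 2 := by field_simp
  rw [t3, show (1 : ℂ) - y ^ 2 = -(y ^ 2 - 1) by ring]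
  -- The denominators stay opaque while fractions are cleared and are expanded only for the final
  -- polynomial identity.
  obtain ⟨D₁, hD₁⟩ : ∃ D, D = Q - a * S * y := ⟨_, rfl⟩
  obtain ⟨D₂, hD₂⟩ : ∃ D, D = Q * y - a * S := ⟨_, rfl⟩
  obtain ⟨D₃, hD₃⟩ : ∃ D, D = y ^ 2 - 1 := ⟨_, rfl⟩
  rw [← hD₁] at k6
  rw [← hD₂] at k7
  rw [← hD₃] at k8
  rw [← hD₁, ← hD₂, ← hD₃]
  field_simp
  rw [hD₁, hD₂, hD₃]
  ring

end

/-! ### Triangularity of the Askey–Wilson operator -/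

section

variable [hq : Fact (0 < q ∧ q < 1)]

include hq

lemma qeps_ne_of_qtheta {w v : ℂ} (h : θ w ≠ 0) (n : ℤ) (hv : v = w + n) : ε v ≠ 0 :=
  hv ▸ qeps_ne_zero_of_qtheta h n

lemma one_sub_qexp_ne_of_qtheta {w v : ℂ} (h : θ w ≠ 0) (n : ℤ) (hv : v = w + n) :
    𝐞 v ≠ 1 := hv ▸ (qtheta_ne_zero_iff w).1 h n

lemma awBasis_add_one {α s z : ℂ} (h1 : θ (α + z) ≠ 0) (h3 : θ (α + s + z) ≠ 0)
    (h4 : θ (α + s - z) ≠ 0) :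
    awBasis q α s (z + 1) = awBasis q α s z
      * ((1 - 𝐞 (α + s + z)) * (1 - 𝐞 (α - z - 1))
        / ((1 - 𝐞 (α + z)) * (1 - 𝐞 (α + s - z - 1)))) := by
  have e1 := qeps_eq (q := q) (α + z)
  have e2 := qeps_eq (q := q) (α - z - 1)
  have e3 := qeps_eq (q := q) (α + s + z)
  have e4 := qeps_eq (q := q) (α + s - z - 1)
  rw [sub_add_cancel] at e2 e4
  have n1 : 1 - 𝐞 (α + z) ≠ 0 :=
    sub_ne_zero.2 (one_sub_qexp_ne_of_qtheta h1 0 (by push_cast; ring)).symm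
  have n4 : 1 - 𝐞 (α + s - z - 1) ≠ 0 :=
    sub_ne_zero.2 (one_sub_qexp_ne_of_qtheta h4 (-1) (by push_cast; ring)).symm
  have n5 : ε (α + s - z) ≠ 0 := qeps_ne_of_qtheta h4 0 (by push_cast; ring)
  simp only [awBasis]
  rw [show α + (z + 1) = α + z + 1 by ring, show α - (z + 1) = α - z - 1 by ring,
    show α + s + (z + 1) = α + s + z + 1 by ring, show α + s - (z + 1) = α + s - z - 1 by ring,
    e1, e2, e3, e4]
  have n6 : 1 - 𝐞 (α + s + z) ≠ 0 :=
    sub_ne_zero.2 (one_sub_qexp_ne_of_qtheta h3 0 (by push_cast; ring)).symm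
  field_simp

omit hq in
lemma awBasis_neg (α s z : ℂ) : awBasis q α s (-z) = awBasis q α s z := by
  unfold awBasis
  rw [sub_neg_eq_add, sub_neg_eq_add, ← sub_eq_add_neg, ← sub_eq_add_neg,
    mul_comm (ε (α - z)), mul_comm (ε (α + s - z))]

lemma awBasis_sub_one {α s z : ℂ} (h2 : θ (α - z) ≠ 0) (h3 : θ (α + s + z) ≠ 0)
    (h4 : θ (α + s - z) ≠ 0) :
    awBasis q α s (z - 1) = awBasis q α s z
      * ((1 - 𝐞 (α + s - z)) * (1 - 𝐞 (α + z - 1))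
        / ((1 - 𝐞 (α - z)) * (1 - 𝐞 (α + s + z - 1)))) := by
  have := awBasis_add_one (q := q) (α := α) (s := s) (z := -z) (by rwa [← sub_eq_add_neg])
    (by rwa [← sub_eq_add_neg]) (by rwa [sub_neg_eq_add])
  rw [show -z + 1 = -(z - 1) by ring, awBasis_neg, awBasis_neg] at this
  simpa only [sub_neg_eq_add, ← sub_eq_add_neg] using this

lemma awBasis_index_sub_one (α s z : ℂ) :
    awBasis q α (s - 1) z
      = awBasis q α s z / ((1 - 𝐞 (α + s + z - 1)) * (1 - 𝐞 (α + s - z - 1))) := by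
  have e3 := qeps_eq (q := q) (α + s + z - 1)
  have e4 := qeps_eq (q := q) (α + s - z - 1)
  rw [sub_add_cancel] at e3 e4
  simp only [awBasis]
  rw [show α + (s - 1) + z = α + s + z - 1 by ring, show α + (s - 1) - z = α + s - z - 1 by ring,
    e3, e4, div_div]
  congr 1
  ring

/-- The points at which the Askey–Wilson operator has no pole. -/
def AwRegular (q : ℝ) (z : ℂ) : Prop :=
  qexp q (2 * z) ≠ 1 ∧ qexp q (2 * z) ≠ q ∧ qexp q (2 * z) * q ≠ 1

lemma eventually_awRegular : ∀ᶠ z in cocountable, AwRegular q z := by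
  have h1 := eventually_qexp_ne (q := q) two_ne_zero 0 1
  have h2 := eventually_qexp_ne (q := q) two_ne_zero 0 q
  have h3 := eventually_qexp_ne (q := q) two_ne_zero 0 (q : ℂ)⁻¹
  filter_upwards [h1, h2, h3] with z h1 h2 h3
  rw [zero_add] at h1 h2 h3
  exact ⟨h1, h2, fun h => h3 (eq_inv_of_mul_eq_one_left h)⟩

/-- The triangular action of the Askey–Wilson operator. -/
lemma awOp_awBasis {α β γ δ ν s z : ℂ} (hz : AwRegular q z) (h1 : θ (α + z) ≠ 0)
    (h2 : θ (α - z) ≠ 0) (h3 : θ (α + s + z) ≠ 0) (h4 : θ (α + s - z) ≠ 0) :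
    awOp q α β γ δ ν (awBasis q α s) z
      = 𝐞 (-s) * (1 - 𝐞 (s - ν)) * (1 - 𝐞 (α + β + γ + δ + ν + s - 1)) * awBasis q α s z
        - 𝐞 (-s) * (1 - 𝐞 s) * (1 - 𝐞 (α + β + s - 1)) * (1 - 𝐞 (α + γ + s - 1))
          * (1 - 𝐞 (α + δ + s - 1)) * awBasis q α (s - 1) z := by
  obtain ⟨z1, z2, z3⟩ := hz
  have n1 := one_sub_qexp_ne_of_qtheta h1 0 (v := α + z) (by push_cast; ring)
  have n2 := one_sub_qexp_ne_of_qtheta h2 0 (v := α - z) (by push_cast; ring)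
  have n3 := one_sub_qexp_ne_of_qtheta h3 (-1) (v := α + s + z - 1) (by push_cast; ring)
  have n4 := one_sub_qexp_ne_of_qtheta h4 (-1) (v := α + s - z - 1) (by push_cast; ring)
  have key := awOp_rational (a := 𝐞 α) (b := 𝐞 β) (c := 𝐞 γ) (d := 𝐞 δ) (S := 𝐞 s) (y := 𝐞 z)
    (Q := q) (w := 𝐞 ν) q_cast_ne_zero (qexp_ne_zero _) (qexp_ne_zero _) (qexp_ne_zero _)
    (by rwa [← qexp_two_mul]) (by rwa [← qexp_two_mul, mul_comm])
    (by rw [← qexp_two_mul]; exact z2.symm) (by rwa [← qexp_add])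
    (by rwa [qexp_sub, ne_eq, div_eq_one_iff_eq (qexp_ne_zero _)] at n2)
    (by rw [qexp_sub, ne_eq, div_eq_one_iff_eq (qexp_ne_zero _), qexp_one] at n3
        rw [← qexp_add, ← qexp_add]; exact fun h => n3 h.symm)
    (by rw [sub_sub, qexp_sub, ne_eq, div_eq_one_iff_eq (qexp_ne_zero _), qexp_add z, qexp_one] at n4
        rw [← qexp_add, mul_comm]; exact fun h => n4 h.symm)
  rw [awOp, awBasis_add_one h1 h3 h4, awBasis_sub_one h2 h3 h4, awBasis_index_sub_one]
  unfold awCoeff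
  simp only [qexp_add, qexp_sub, qexp_neg, qexp_two_mul, qexp_one]
  linear_combination (awBasis q α s z) * key

end

/-! ### The rational identity behind the very-well-poised series -/

section

-- The content of `awOp_vwpBasis` after division by the basis function, with N = q^n, M =
-- q^(1-ν-δ+n), y = q^z and Q = q. Both sides have degree at most one in b and in c and are
-- symmetric in them, so the identity splits into the coefficients of 1, b + c and bc. The
-- denominators are separate variables, so that they can be cleared before being expanded.
set_option maxHeartbeats 1000000 in
lemma vwp_rational {a b c d N M y Q : ℂ} (hb : b ≠ 0) (hc : c ≠ 0) (hd : d ≠ 0) (hN : N ≠ 0)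
    (hM : M ≠ 0) (hQ : Q ≠ 0) (hy : y ≠ 0) {D1 D2 D3 D4 D5 D6 D7 : ℂ}
   (h1 : D1 ≠ 0) (h2 : D2 ≠ 0) (h3 : D3 ≠ 0) (h4 : D4 ≠ 0) (h5 : D5 ≠ 0)
   (h6 : D6 ≠ 0) (h7 : D7 ≠ 0)
   (e1 : D1 = 1 - y ^ 2) (e2 : D2 = 1 - Q * y ^ 2) (e3 : D3 = y ^ 2 - Q)
   (e4 : D4 = Q - a * N * y) (e5 : D5 = Q * y - a * N) (e6 : D6 = 1 - M * y) (e7 : D7 = y - M) :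
   (1 - a * M * N / Q) * (
     (1 - b * y) * (1 - c * y) / (D1 * D2) *
        (-y * (d - Q * y) * (1 - a * N * y) * (Q * y - a) * (Q * y - M) / (Q * y * D5 * D6) 
           - (1 - a * y) * (1 - d * y))
    + y * (y - b) * (y - c) / (-D1 * D3) *
        (- (d * y - Q) * (y - a * N) * (Q - a * y) * (Q - M * y) / (y * Q * D4 * D7)
           - (y - a) * (y - d) / y)
    - (d * M / (Q * N) - 1) * (1 - a * b * c * N / M))
   = d / Q * (M / N - a) * (b * c * Q * N / (d * M) * (1 - a * M / Q) * (1 - d * M / Q) * (1 - M / b) * (1 - M / c) * y / (D6 * D7)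
       - (1 - N) * (1 - a * b * N / Q) * (1 - a * c * N / Q) * (1 - a * N / d) * Q ^ 2 * y / (D4 * D5)) := by
  obtain ⟨g, hg⟩ : ∃ g, g = a * (Q * N - d * M) / Q := ⟨_, rfl⟩
  obtain ⟨g', hg'⟩ : ∃ g, g = a * d + a ^ 2 * d * N * M / Q + (a + d) * M - Q - a * N * M
    - a ^ 2 * N - a * d * N := ⟨_, rfl⟩
  -- As in the balanced case, the bracket contains the step-dependent denominator `D2`, and the next
  -- one contains `D3`. The remaining quadratics have the same coefficients in reversed order,
  -- because the second bracket arises from the first by y ↦ 1/y.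
  have t1 : -y * (d - Q * y) * (1 - a * N * y) * (Q * y - a) * (Q * y - M) / (Q * y * D5 * D6) 
           - (1 - a * y) * (1 - d * y) = D2 * (g + g' * y + Q * g * y ^ 2) / (D5 * D6) := by
    rw [hg, hg']
    field_simp
    rw [e2, e5, e6]
    ring
  have t2 : (- (d * y - Q) * (y - a * N) * (Q - a * y) * (Q - M * y) / (y * Q * D4 * D7)
           - (y - a) * (y - d) / y) = D3 * (g * y ^ 2 + g' * y + Q * g) / (y * D4 * D7) := by
    rw [hg, hg']
    field_simp
    rw [e3, e4, e7]
    ring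
  rw [t1, t2]
  have t3 : ∀ k X : ℂ, k / (D1 * D2) * (D2 * X / (D5 * D6)) = k * X / (D1 * D5 * D6) := by
    intro k X; field_simp
  have t4 : ∀ k X : ℂ, y * k / (-D1 * D3) * (D3 * X / (y * D4 * D7)) = - (k * X / (D1 * D4 * D7)) := by
    intro k X; field_simp
  rw [mul_assoc y, t3, t4]
  -- The right-hand side sorted by 1, b + c and bc; the identities `k0`, `k1`, `k2` match the three
  -- coefficients.
  have c1 : d / Q * (M / N - a) * (b * c * Q * N / (d * M) * (1 - a * M / Q) * (1 - d * M / Q) * (1 - M / b) * (1 - M / c) * y / (D6 * D7)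
       - (1 - N) * (1 - a * b * N / Q) * (1 - a * c * N / Q) * (1 - a * N / d) * Q ^ 2 * y / (D4 * D5))
      = (M - a * N) * y * ((1 - a * M / Q) * (1 - d * M / Q) * M / (D6 * D7)
        - (1 - N) * (d - a * N) * Q / N / (D4 * D5))
      + (b + c) * ((M - a * N) * y * (-(1 - a * M / Q) * (1 - d * M / Q) / (D6 * D7)
        + (1 - N) * (d - a * N) * a / (D4 * D5)))
      + b * c * ((M - a * N) * y * ((1 - a * M / Q) * (1 - d * M / Q) / M / (D6 * D7)
        - (1 - N) * (d - a * N) * a ^ 2 * N / Q / (D4 * D5))) := by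
    field_simp
    ring
  rw [c1]
  have k0 : (1 - a * M * N / Q) * ((g + g' * y + Q * g * y ^ 2) / (D1 * D5 * D6)
      - y ^ 2 * (g * y ^ 2 + g' * y + Q * g) / (D1 * D4 * D7) - (d * M / (Q * N) - 1))
      = (M - a * N) * y * ((1 - a * M / Q) * (1 - d * M / Q) * M / (D6 * D7)
       - (1 - N) * (d - a * N) * Q / N / (D4 * D5)) := by
    rw [hg, hg']
    field_simp
    rw [e1, e4, e5, e6, e7]
    ring
  have k1 : (1 - a * M * N / Q) * (-y * (g + g' * y + Q * g * y ^ 2) / (D1 * D5 * D6)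
      + y * (g * y ^ 2 + g' * y + Q * g) / (D1 * D4 * D7))
      = (M - a * N) * y * (-(1 - a * M / Q) * (1 - d * M / Q) / (D6 * D7)
       + (1 - N) * (d - a * N) * a / (D4 * D5)) := by
    rw [hg, hg']
    field_simp
    rw [e1, e4, e5, e6, e7]
    ring
  have k2 : (1 - a * M * N / Q) * (y ^ 2 * (g + g' * y + Q * g * y ^ 2) / (D1 * D5 * D6)
      - (g * y ^ 2 + g' * y + Q * g) / (D1 * D4 * D7) + (d * M / (Q * N) - 1) * (a * N / M))
      = (M - a * N) * y * ((1 - a * M / Q) * (1 - d * M / Q) / M / (D6 * D7)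
       - (1 - N) * (d - a * N) * a ^ 2 * N / Q / (D4 * D5)) := by
    rw [hg, hg']
    field_simp
    rw [e1, e4, e5, e6, e7]
    ring
  linear_combination k0 + (b + c) * k1 + b * c * k2

variable [hq : Fact (0 < q ∧ q < 1)]

include hq

/-! ### The function `uHat` solves the difference equation -/

/-- Coefficients of the balanced series with respect to `awBasis`. -/
def balCoeff (q : ℝ) (α β γ δ ν s : ℂ) (n : ℕ) : ℂ :=
  qrho q (s - ν) n * qrho q (α + β + γ + δ + ν + s - 1) n
    * (qeps q (s + 1 + n) * qeps q (α + β + s + n) * qeps q (α + γ + s + n)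
      * qeps q (α + δ + s + n)) * (q : ℂ) ^ n

/-- The part of index s + n produced by the n-th summand cancels the part lowered from the next one,
so a partial sum is its upper boundary term. The lower boundary term is killed by `hs`, which holds
for s = 0 and for s = 1 - α - δ because `ε 0 = 0`. -/
lemma sum_awOp_balanced {α β γ δ ν s z : ℂ} (hz : AwRegular q z) (h1 : θ (α + z) ≠ 0)
    (h2 : θ (α - z) ≠ 0) (h3 : θ (α + s + z) ≠ 0) (h4 : θ (α + s - z) ≠ 0)
    (hs : ε s * ε (α + δ + s - 1) = 0) (N : ℕ) :
    ∑ n ∈ Finset.range N,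
        awOp q α β γ δ ν (fun w => balCoeff q α β γ δ ν s n * awBasis q α (s + n) w) z
      = 𝐞 (-s) * (ρ (s - ν) N * ρ (α + β + γ + δ + ν + s - 1) N) *
        (ε (s + N) * ε (α + β + s - 1 + N) * ε (α + γ + s - 1 + N) * ε (α + δ + s - 1 + N))
        * awBasis q α (s - 1 + N) z := by
  induction N with
  | zero =>
    simp only [Finset.range_zero, Finset.sum_empty, Nat.cast_zero, add_zero]
    linear_combination (-𝐞 (-s) * (ρ (s - ν) 0 * ρ (α + β + γ + δ + ν + s - 1) 0) *
        (ε (α + β + s - 1) * ε (α + γ + s - 1)) * awBasis q α (s - 1) z) * hs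
  | succ N ih =>
    have h3' : θ (α + (s + N) + z) ≠ 0 := by
      rw [qtheta_ne_zero_iff] at h3 ⊢
      intro n
      have := h3 (N + n)
      push_cast at this
      convert this using 2
      ring
    have h4' : θ (α + (s + N) - z) ≠ 0 := by
      rw [qtheta_ne_zero_iff] at h4 ⊢
      intro n
      have := h4 (N + n)
      push_cast at this
      convert this using 2
      ring
    rw [Finset.sum_range_succ, ih, awOp_const_mul, awOp_awBasis hz h1 h2 h3' h4', balCoeff,
      qrho_succ, qrho_succ]
    push_cast
    rw [show s + (N : ℂ) - 1 = s - 1 + N by ring, show s + ((N : ℂ) + 1) = s + 1 + N by ring,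
      show α + β + s - 1 + ((N : ℂ) + 1) = α + β + s + N by ring,
      show α + γ + s - 1 + ((N : ℂ) + 1) = α + γ + s + N by ring,
      show α + δ + s - 1 + ((N : ℂ) + 1) = α + δ + s + N by ring,
      show s - 1 + ((N : ℂ) + 1) = s + N by ring,
      show s + (N : ℂ) - ν = s - ν + N by ring,
      show α + β + γ + δ + ν + (s + (N : ℂ)) - 1 = α + β + γ + δ + ν + s - 1 + N by ring,
      show α + β + (s + (N : ℂ)) - 1 = α + β + s - 1 + N by ring,
      show α + γ + (s + (N : ℂ)) - 1 = α + γ + s - 1 + N by ring,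
      show α + δ + (s + (N : ℂ)) - 1 = α + δ + s - 1 + N by ring,
      qeps_eq (s + N), qeps_eq (α + β + s - 1 + N), qeps_eq (α + γ + s - 1 + N),
      qeps_eq (α + δ + s - 1 + N), show s + (N : ℂ) + 1 = s + 1 + N by ring,
      show α + β + s - 1 + (N : ℂ) + 1 = α + β + s + N by ring,
      show α + γ + s - 1 + (N : ℂ) + 1 = α + γ + s + N by ring,
      show α + δ + s - 1 + (N : ℂ) + 1 = α + δ + s + N by ring]
    have e : 𝐞 (-(s + (N : ℂ))) * (q : ℂ) ^ N = 𝐞 (-s) := by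
      rw [← qexp_nat, ← qexp_add]; congr 1; ring
    rw [← e]
    ring

/-- The Askey–Wilson operator applied to a balanced series leaves only a boundary term. -/
lemma awOp_balanced {α β γ δ ν s z : ℂ} {f : ℂ → ℂ} (hz : AwRegular q z) (h1 : θ (α + z) ≠ 0)
    (h2 : θ (α - z) ≠ 0) (h3 : θ (α + s + z) ≠ 0) (h4 : θ (α + s - z) ≠ 0)
    (hs : ε s * ε (α + δ + s - 1) = 0)
    (k0 : HasSum (fun n => balCoeff q α β γ δ ν s n * awBasis q α (s + n) z) (f z))
    (k1 : HasSum (fun n => balCoeff q α β γ δ ν s n * awBasis q α (s + n) (z + 1)) (f (z + 1)))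
    (k2 : HasSum (fun n => balCoeff q α β γ δ ν s n * awBasis q α (s + n) (z - 1)) (f (z - 1))) :
    awOp q α β γ δ ν f z = 𝐞 (-s) * (ε (s - ν) * ε (α + β + γ + δ + ν + s - 1))
      * (ε (α + z) * ε (α - z)) := by
  have key := (hasSum_awOp (q := q) (α := α) (β := β) (γ := γ) (δ := δ) (ν := ν)
    (F := fun n w => balCoeff q α β γ δ ν s n * awBasis q α (s + n) w) k0 k1 k2).tendsto_sum_nat
  simp_rw [sum_awOp_balanced hz h1 h2 h3 h4 hs] at key
  refine tendsto_nhds_unique key ?_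
  have t := tendsto_qeps_add_nat (q := q)
  have tb : Tendsto (fun N : ℕ => awBasis q α (s - 1 + N) z) atTop
      (𝓝 (ε (α + z) * ε (α - z) / (1 * 1))) := by
    unfold awBasis
    refine Tendsto.div tendsto_const_nhds (Tendsto.mul ?_ ?_) (by simp)
    · refine (t (α + s - 1 + z)).congr fun n => ?_
      congr 1; ring
    · refine (t (α + s - 1 - z)).congr fun n => ?_
      congr 1; ring
  have := ((((tendsto_qrho (q := q) (s - ν)).mul
    (tendsto_qrho (q := q) (α + β + γ + δ + ν + s - 1))).const_mul (𝐞 (-s))).mul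
    ((((t s).mul (t (α + β + s - 1))).mul (t (α + γ + s - 1))).mul (t (α + δ + s - 1)))).mul tb
  simpa using this

lemma awBasis_zero_add_nat {α z : ℂ} (h1 : θ (α + z) ≠ 0) (h2 : θ (α - z) ≠ 0) (n : ℕ) :
    awBasis q α (0 + n) z = ρ (α + z) n * ρ (α - z) n := by
  have n1 : ε (α + z + n) ≠ 0 := by exact_mod_cast qeps_ne_zero_of_qtheta h1 n
  have n2 : ε (α - z + n) ≠ 0 := by exact_mod_cast qeps_ne_zero_of_qtheta h2 n
  rw [qrho_eq_div n1, qrho_eq_div n2, awBasis, div_mul_div_comm]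
  ring_nf

lemma qtheta_ne_zero_add_int {w v : ℂ} (h : θ w ≠ 0) (n : ℤ) (hv : v = w + n) : θ v ≠ 0 := by
  rw [qtheta_ne_zero_iff] at h ⊢
  intro m
  have := h (n + m)
  push_cast at this
  rwa [hv, add_assoc]

lemma qtheta_ne_zero_sub {w v : ℂ} (h : θ w ≠ 0) (n : ℤ) (hv : v = n - w) : θ v ≠ 0 := by
  rw [qtheta_ne_zero_iff] at h ⊢
  intro m hm
  exact h (-(n + m)) (qexp_eq_one_of_add_eq_zero (by rw [hv]; push_cast; ring) hm)

/-- For s = 1 - α - δ the exponents α + s ± z become 1 - δ ± z; this is where the poles of the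
second series come from. -/
lemma awBasis_second {α δ z : ℂ} (h1 : θ (δ + z) ≠ 0) (h2 : θ (δ - z) ≠ 0) (n : ℕ) :
    awBasis q α (1 - α - δ + n) z
      = ε (α + z) * ε (α - z) / qden q δ z * (ρ (1 + z - δ) n * ρ (1 - z - δ) n) := by
  have n1 : ε (1 + z - δ + n) ≠ 0 := qeps_ne_zero_of_qtheta' h2 (1 + n) (by push_cast; ring)
  have n2 : ε (1 - z - δ + n) ≠ 0 := qeps_ne_zero_of_qtheta' h1 (1 + n) (by push_cast; ring)
  have n3 : ε (1 + z - δ) ≠ 0 := qeps_ne_zero_of_qtheta' h2 1 (by push_cast; ring)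
  have n4 : ε (1 - z - δ) ≠ 0 := qeps_ne_zero_of_qtheta' h1 1 (by push_cast; ring)
  rw [qrho_eq_div n1, qrho_eq_div n2, awBasis, qden,
    show α + (1 - α - δ + n) + z = 1 + z - δ + n by ring,
    show α + (1 - α - δ + n) - z = 1 - z - δ + n by ring]
  field_simp

omit hq in
lemma uHat_div_qden {α β γ δ ν z : ℂ} (h : qden q δ z ≠ 0) :
    uHat q α β γ δ ν z / qden q δ z
      = (ε (β + γ + ν) * ε (1 - ν - α - δ))
        * balSeries q (-ν) (α + β + γ + δ + ν - 1) (α + z) (α - z) (α + β) (α + γ) (α + δ)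
      - 𝐞 (1 - α - δ) * (ε (-ν) * ε (α + β + γ + δ + ν - 1))
        * (ε (α + z) * ε (α - z) / qden q δ z
        * balSeries q (1 - ν - α - δ) (β + γ + ν) (1 + z - δ) (1 - z - δ) (1 + β - δ) (1 + γ - δ)
      (2 - α - δ)) := by
  rw [uHat, ← qden]
  field_simp

lemma qden_ne_zero {δ z : ℂ} (h1 : θ (δ + z) ≠ 0) (h2 : θ (δ - z) ≠ 0) : qden q δ z ≠ 0 :=
  mul_ne_zero (qeps_ne_zero_of_qtheta' h2 1 (by push_cast; ring))
    (qeps_ne_zero_of_qtheta' h1 1 (by push_cast; ring))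

omit hq in
lemma awOp_congr {α β γ δ ν z : ℂ} {f g : ℂ → ℂ} (h0 : f z = g z) (h1 : f (z + 1) = g (z + 1))
    (h2 : f (z - 1) = g (z - 1)) : awOp q α β γ δ ν f z = awOp q α β γ δ ν g z := by
  rw [awOp, awOp, h0, h1, h2]

/-- A function `f` without poles for which `f / qden q δ` solves the difference equation. -/
structure IsSolution (q : ℝ) (α β γ δ ν d : ℂ) (f : ℂ → ℂ) : Prop where
  differentiable : Differentiable ℂ f
  periodic : ∀ z, f (z + qperiod q) = f z
  solves : ∀ᶠ z in cocountable, awOp q α β γ δ ν (fun w => f w / qden q d w) z = 0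

/-- The first series (s = 0) and the second one (s = 1 - α - δ) each leave a multiple of `ε (α + z)
* ε (α - z)`. In `uHat` each series is weighted by the boundary constant of the other, so that the
two contributions cancel. -/
lemma uHat_isSolution (α β γ δ ν : ℂ) :
    IsSolution q α β γ δ ν δ (fun z => uHat q α β γ δ ν z) := by
  refine ⟨by fun_prop, fun z => ?_, ?_⟩
  · simp only [uHat, balSeries, ← add_assoc, ← sub_sub, qeps_add_period, qeps_sub_period,
      qrho_add_period, qrho_sub_period, add_sub_right_comm _ (qperiod q), sub_right_comm _ (qperiod q)]
  · have g1 := eventually_qtheta_ne_zero (q := q) one_ne_zero α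
    have g2 := eventually_qtheta_ne_zero (q := q) (neg_ne_zero.2 one_ne_zero) α
    have g3 := eventually_qtheta_ne_zero (q := q) one_ne_zero δ
    have g4 := eventually_qtheta_ne_zero (q := q) (neg_ne_zero.2 one_ne_zero) δ
    filter_upwards [g1, g2, g3, g4, eventually_awRegular (q := q)] with z g1 g2 g3 g4 hz
    rw [one_mul] at g1 g3
    rw [neg_mul, one_mul, ← sub_eq_add_neg] at g2 g4
    have A1 : awOp q α β γ δ ν (fun w => balSeries q (-ν) (α + β + γ + δ + ν - 1) (α + w) (α - w)
        (α + β) (α + γ) (α + δ)) z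
        = 𝐞 (-0) * (ε (0 - ν) * ε (α + β + γ + δ + ν + 0 - 1)) * (ε (α + z) * ε (α - z)) := by
      have hb : ∀ w, θ (α + w) ≠ 0 → θ (α - w) ≠ 0 →
          HasSum (fun n : ℕ => balCoeff q α β γ δ ν 0 n * awBasis q α (0 + n) w)
            (balSeries q (-ν) (α + β + γ + δ + ν - 1) (α + w) (α - w)
              (α + β) (α + γ) (α + δ)) := by
        intro w h1 h2
        have := (hasSum_balSeries (q := q) (-ν) (α + β + γ + δ + ν - 1) (α + w) (α - w)
          (α + β) (α + γ) (α + δ))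
        refine hasSum_of_eq this fun n => ?_
        rw [awBasis_zero_add_nat h1 h2, balCoeff]
        simp only [zero_sub, add_zero, zero_add]
        ring
      refine awOp_balanced hz g1 g2 (by rwa [add_zero]) (by rwa [add_zero]) (by simp)
        (hb z g1 g2) (hb _ ?_ ?_) (hb _ ?_ ?_)
      · exact qtheta_ne_zero_add_int g1 1 (by push_cast; ring)
      · exact qtheta_ne_zero_add_int g2 (-1) (by push_cast; ring)
      · exact qtheta_ne_zero_add_int g1 (-1) (by push_cast; ring)
      · exact qtheta_ne_zero_add_int g2 1 (by push_cast; ring)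
    have A2 : awOp q α β γ δ ν (fun w => ε (α + w) * ε (α - w) / qden q δ w
          * balSeries q (1 - ν - α - δ) (β + γ + ν) (1 + w - δ) (1 - w - δ) (1 + β - δ) (1 + γ - δ)
      (2 - α - δ)) z
        = 𝐞 (-(1 - α - δ)) * (ε (1 - α - δ - ν) * ε (α + β + γ + δ + ν + (1 - α - δ) - 1))
          * (ε (α + z) * ε (α - z)) := by
      have hb : ∀ w, θ (δ + w) ≠ 0 → θ (δ - w) ≠ 0 →
          HasSum (fun n : ℕ => balCoeff q α β γ δ ν (1 - α - δ) n * awBasis q α (1 - α - δ + n) w)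
            (ε (α + w) * ε (α - w) / qden q δ w
          * balSeries q (1 - ν - α - δ) (β + γ + ν) (1 + w - δ) (1 - w - δ) (1 + β - δ) (1 + γ - δ)
      (2 - α - δ)) := by
        intro w h1 h2
        have := (hasSum_balSeries (q := q) (1 - ν - α - δ) (β + γ + ν) (1 + w - δ) (1 - w - δ)
          (1 + β - δ) (1 + γ - δ) (2 - α - δ)).mul_left (ε (α + w) * ε (α - w) / qden q δ w)
        refine hasSum_of_eq this fun n => ?_
        rw [awBasis_second h1 h2, balCoeff,
          show 1 - α - δ - ν = 1 - ν - α - δ by ring,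
          show α + β + γ + δ + ν + (1 - α - δ) - 1 = β + γ + ν by ring,
          show 1 - α - δ + 1 + (n : ℂ) = 2 - α - δ + n by ring,
          show α + β + (1 - α - δ) + (n : ℂ) = 1 + β - δ + n by ring,
          show α + γ + (1 - α - δ) + (n : ℂ) = 1 + γ - δ + n by ring,
          show α + δ + (1 - α - δ) + (n : ℂ) = 1 + n by ring]
        ring
      refine awOp_balanced hz g1 g2 ?_ ?_ (by ring_nf; simp) (hb z g3 g4) (hb _ ?_ ?_) (hb _ ?_ ?_)
      · exact qtheta_ne_zero_sub g4 1 (by push_cast; ring)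
      · exact qtheta_ne_zero_sub g3 1 (by push_cast; ring)
      · exact qtheta_ne_zero_add_int g3 1 (by push_cast; ring)
      · exact qtheta_ne_zero_add_int g4 (-1) (by push_cast; ring)
      · exact qtheta_ne_zero_add_int g3 (-1) (by push_cast; ring)
      · exact qtheta_ne_zero_add_int g4 1 (by push_cast; ring)
    have A3 : awOp q α β γ δ ν (fun w => uHat q α β γ δ ν w / qden q δ w) z
        = awOp q α β γ δ ν (fun w => (ε (β + γ + ν) * ε (1 - ν - α - δ))
        * balSeries q (-ν) (α + β + γ + δ + ν - 1) (α + w) (α - w) (α + β) (α + γ) (α + δ)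
      - 𝐞 (1 - α - δ) * (ε (-ν) * ε (α + β + γ + δ + ν - 1))
        * (ε (α + w) * ε (α - w) / qden q δ w
        * balSeries q (1 - ν - α - δ) (β + γ + ν) (1 + w - δ) (1 - w - δ) (1 + β - δ) (1 + γ - δ)
      (2 - α - δ))) z := by
      refine awOp_congr (uHat_div_qden (qden_ne_zero g3 g4)) (uHat_div_qden (qden_ne_zero ?_ ?_))
        (uHat_div_qden (qden_ne_zero ?_ ?_))
      · exact qtheta_ne_zero_add_int g3 1 (by push_cast; ring)
      · exact qtheta_ne_zero_add_int g4 (-1) (by push_cast; ring)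
      · exact qtheta_ne_zero_add_int g3 (-1) (by push_cast; ring)
      · exact qtheta_ne_zero_add_int g4 1 (by push_cast; ring)
    rw [A3, awOp_sub, awOp_const_mul, awOp_const_mul, A1, A2,
      show 1 - α - δ - ν = 1 - ν - α - δ by ring,
      show α + β + γ + δ + ν + (1 - α - δ) - 1 = β + γ + ν by ring, qexp_neg (1 - α - δ)]
    have := qexp_ne_zero (q := q) (1 - α - δ)
    simp only [zero_sub, add_zero, neg_zero, qexp_zero]
    field_simp
    ring

end

section

variable [hq : Fact (0 < q ∧ q < 1)]

/-! ### The function `vwpHat` solves the difference equation -/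

-- The ratio of `vwpBasis` at z + 1 and z has 1 - ay and 1 - 1/(dy) in its denominator. They absorb
-- two factors of the operator's coefficient, which leaves the shape required by `vwp_rational`;
-- `vwp_ratio_inv` does the same for the step to z - 1.
omit hq in
lemma vwp_ratio {a b c d N M y Q : ℂ} (hd : d ≠ 0) (hQ : Q ≠ 0) (hy : y ≠ 0)
    (n5 : Q * y - a * N ≠ 0) (n6 : 1 - M * y ≠ 0) (n8 : 1 - a * y ≠ 0) (n9 : 1 - d * y ≠ 0) :
    (1 - a * y) * (1 - b * y) * (1 - c * y) * (1 - d * y) / ((1 - y ^ 2) * (1 - Q * y ^ 2))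
      * ((1 - a * N * y) * (1 - a / (Q * y)) / ((1 - a * y) * (1 - a * N / (Q * y)))
        * ((1 - M / (Q * y)) / (1 - M * y)) * ((1 - Q * y / d) / (1 - 1 / (d * y))) - 1)
    = (1 - b * y) * (1 - c * y) / ((1 - y ^ 2) * (1 - Q * y ^ 2)) *
        (-y * (d - Q * y) * (1 - a * N * y) * (Q * y - a) * (Q * y - M)
          / (Q * y * (Q * y - a * N) * (1 - M * y)) - (1 - a * y) * (1 - d * y)) := by
  have e5 : 1 - a * N / (Q * y) = (Q * y - a * N) / (Q * y) := by field_simp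
  have e9 : 1 - 1 / (d * y) = -(1 - d * y) / (d * y) := by field_simp; ring
  rw [e5, e9]
  obtain ⟨D₅, h5⟩ : ∃ D, D = Q * y - a * N := ⟨_, rfl⟩
  obtain ⟨D₆, h6⟩ : ∃ D, D = 1 - M * y := ⟨_, rfl⟩
  obtain ⟨D₈, h8⟩ : ∃ D, D = 1 - a * y := ⟨_, rfl⟩
  obtain ⟨D₉, h9⟩ : ∃ D, D = 1 - d * y := ⟨_, rfl⟩
  rw [← h5] at n5
  rw [← h6] at n6
  rw [← h8] at n8
  rw [← h9] at n9
  rw [← h5, ← h6, ← h8, ← h9]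
  field_simp

omit hq in
lemma vwp_ratio_inv {a b c d N M y Q : ℂ} (hd : d ≠ 0) (hQ : Q ≠ 0) (hy : y ≠ 0)
    (n1 : 1 - y ^ 2 ≠ 0) (n3 : y ^ 2 - Q ≠ 0)
    (n4 : Q - a * N * y ≠ 0) (n7 : y - M ≠ 0) (n8 : y - a ≠ 0) (n9 : y - d ≠ 0) :
    (1 - a / y) * (1 - b / y) * (1 - c / y) * (1 - d / y) / ((1 - 1 / y ^ 2) * (1 - Q / y ^ 2))
      * ((1 - a * N / y) * (1 - a * y / Q) / ((1 - a / y) * (1 - a * N * y / Q))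
        * ((1 - M * y / Q) / (1 - M / y)) * ((1 - Q / (y * d)) / (1 - y / d)) - 1)
    = y * (y - b) * (y - c) / (-(1 - y ^ 2) * (y ^ 2 - Q)) *
        (- (d * y - Q) * (y - a * N) * (Q - a * y) * (Q - M * y)
          / (y * Q * (Q - a * N * y) * (y - M)) - (y - a) * (y - d) / y) := by
  have e1 : 1 - 1 / y ^ 2 = -(1 - y ^ 2) / y ^ 2 := by field_simp; ring
  have e3 : 1 - Q / y ^ 2 = (y ^ 2 - Q) / y ^ 2 := by field_simp
  have e4 : 1 - a * N * y / Q = (Q - a * N * y) / Q := by field_simp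
  have e7 : 1 - M / y = (y - M) / y := by field_simp
  have e8 : 1 - a / y = (y - a) / y := by field_simp
  have e9 : 1 - y / d = -(y - d) / d := by field_simp; ring
  rw [e1, e3, e4, e7, e8, e9, show 1 - d / y = (y - d) / y by field_simp]
  obtain ⟨D₁, h1⟩ : ∃ D, D = 1 - y ^ 2 := ⟨_, rfl⟩
  obtain ⟨D₃, h3⟩ : ∃ D, D = y ^ 2 - Q := ⟨_, rfl⟩
  obtain ⟨D₄, h4⟩ : ∃ D, D = Q - a * N * y := ⟨_, rfl⟩
  obtain ⟨D₇, h7⟩ : ∃ D, D = y - M := ⟨_, rfl⟩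
  obtain ⟨D₈, h8⟩ : ∃ D, D = y - a := ⟨_, rfl⟩
  obtain ⟨D₉, h9⟩ : ∃ D, D = y - d := ⟨_, rfl⟩
  rw [← h1] at n1
  rw [← h3] at n3
  rw [← h4] at n4
  rw [← h7] at n7
  rw [← h8] at n8
  rw [← h9] at n9
  rw [← h1, ← h3, ← h4, ← h7, ← h8, ← h9]
  field_simp

/-- The functions occurring in the very-well-poised series. -/
def vwpBasis (q : ℝ) (α δ ν : ℂ) (n : ℕ) (z : ℂ) : ℂ :=
  qrho q (α + z) n * qrho q (α - z) n
    * (qeps q (1 - ν + z - δ + n) * qeps q (1 - ν - z - δ + n)) / qden q δ z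

omit hq in
lemma vwpBasis_neg (α δ ν : ℂ) (n : ℕ) (z : ℂ) :
    vwpBasis q α δ ν n (-z) = vwpBasis q α δ ν n z := by
  unfold vwpBasis qden
  simp only [sub_neg_eq_add, ← sub_eq_add_neg]
  ring

include hq

lemma vwpBasis_add_one {α δ ν z : ℂ} (n : ℕ) (h1 : θ (α + z) ≠ 0) (h2 : θ (α - z) ≠ 0)
    (g3 : θ (δ + z) ≠ 0) (g4 : θ (δ - z) ≠ 0) (g5 : θ (δ + ν - z) ≠ 0) :
    vwpBasis q α δ ν n (z + 1) = vwpBasis q α δ ν n z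
      * ((1 - 𝐞 (α + z + n)) * (1 - 𝐞 (α - z - 1))
          / ((1 - 𝐞 (α + z)) * (1 - 𝐞 (α - z - 1 + n)))
        * ((1 - 𝐞 (-ν - z - δ + n)) / (1 - 𝐞 (1 - ν + z - δ + n)))
        * ((1 - 𝐞 (1 + z - δ)) / (1 - 𝐞 (-z - δ)))) := by
  have r1 := (qrho_succ_left (q := q) (α + z) n).symm.trans (qrho_succ _ _)
  have r2 := (qrho_succ_left (q := q) (α - z - 1) n).symm.trans (qrho_succ _ _)
  have e1 := qeps_eq (q := q) (1 - ν + z - δ + n)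
  have e2 := qeps_eq (q := q) (-ν - z - δ + n)
  have e3 := qeps_eq (q := q) (1 + z - δ)
  have e4 := qeps_eq (q := q) (-z - δ)
  have m1 : 1 - 𝐞 (α + z) ≠ 0 :=
    sub_ne_zero.2 (one_sub_qexp_ne_of_qtheta h1 0 (by push_cast; ring)).symm
  have m2 : 1 - 𝐞 (α - z - 1 + n) ≠ 0 :=
    sub_ne_zero.2 (one_sub_qexp_ne_of_qtheta h2 (n - 1) (by push_cast; ring)).symm
  have m3 : 1 - 𝐞 (1 - ν + z - δ + n) ≠ 0 := sub_ne_zero.2 (one_sub_qexp_ne_of_qtheta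
    (qtheta_ne_zero_sub g5 (1 + n) rfl) 0 (by push_cast; ring)).symm
  have m4 : 1 - 𝐞 (1 + z - δ) ≠ 0 := sub_ne_zero.2 (one_sub_qexp_ne_of_qtheta
    (qtheta_ne_zero_sub g4 1 rfl) 0 (by push_cast; ring)).symm
  have m5 : 1 - 𝐞 (-z - δ) ≠ 0 := sub_ne_zero.2 (one_sub_qexp_ne_of_qtheta
    (qtheta_ne_zero_sub g3 0 rfl) 0 (by push_cast; ring)).symm
  have m6 : ε (1 + z - δ + 1) ≠ 0 := qeps_ne_zero_of_qtheta' g4 2 (by push_cast; ring)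
  have m7 : ε (1 - z - δ) ≠ 0 := qeps_ne_zero_of_qtheta' g3 1 (by push_cast; ring)
  unfold vwpBasis qden
  rw [show α + (z + 1) = α + z + 1 by ring, show α - (z + 1) = α - z - 1 by ring,
    show 1 - ν + (z + 1) - δ + (n : ℂ) = 1 - ν + z - δ + n + 1 by ring,
    show 1 - ν - (z + 1) - δ + (n : ℂ) = -ν - z - δ + n by ring,
    show 1 + (z + 1) - δ = 1 + z - δ + 1 by ring, show 1 - (z + 1) - δ = -z - δ by ring]
  rw [sub_add_cancel] at r2
  rw [show -ν - z - δ + (n : ℂ) + 1 = 1 - ν - z - δ + n by ring] at e2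
  rw [show -z - δ + 1 = 1 - z - δ by ring] at e4
  rw [e1, e2, e3, e4]
  rw [eq_div_of_mul_eq m1 ((mul_comm _ _).trans r1),
    (eq_div_of_mul_eq m2 r2.symm : ρ (α - z - 1) n = _)]
  field_simp

lemma vwpBasis_sub_one {α δ ν z : ℂ} (n : ℕ) (h1 : θ (α + z) ≠ 0) (h2 : θ (α - z) ≠ 0)
    (g3 : θ (δ + z) ≠ 0) (g4 : θ (δ - z) ≠ 0) (g6 : θ (δ + ν + z) ≠ 0) :
    vwpBasis q α δ ν n (z - 1) = vwpBasis q α δ ν n z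
      * ((1 - 𝐞 (α - z + n)) * (1 - 𝐞 (α + z - 1))
          / ((1 - 𝐞 (α - z)) * (1 - 𝐞 (α + z - 1 + n)))
        * ((1 - 𝐞 (-ν + z - δ + n)) / (1 - 𝐞 (1 - ν - z - δ + n)))
        * ((1 - 𝐞 (1 - z - δ)) / (1 - 𝐞 (z - δ)))) := by
  have := vwpBasis_add_one (q := q) (α := α) (δ := δ) (ν := ν) (z := -z) n
    (by rwa [← sub_eq_add_neg]) (by rwa [sub_neg_eq_add]) (by rwa [← sub_eq_add_neg])
    (by rwa [sub_neg_eq_add]) (by rwa [sub_neg_eq_add])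
  rw [show -z + 1 = -(z - 1) by ring, vwpBasis_neg, vwpBasis_neg] at this
  simpa only [sub_neg_eq_add, ← sub_eq_add_neg, neg_neg] using this

lemma vwpBasis_succ {α δ ν z : ℂ} (n : ℕ) (g5 : θ (δ + ν - z) ≠ 0) (g6 : θ (δ + ν + z) ≠ 0) :
    vwpBasis q α δ ν (n + 1) z = vwpBasis q α δ ν n z
      * ((1 - 𝐞 (α + z + n)) * (1 - 𝐞 (α - z + n))
        / ((1 - 𝐞 (1 - ν + z - δ + n)) * (1 - 𝐞 (1 - ν - z - δ + n)))) := by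
  have e1 := qeps_eq (q := q) (1 - ν + z - δ + n)
  have e2 := qeps_eq (q := q) (1 - ν - z - δ + n)
  have m3 : 1 - 𝐞 (1 - ν + z - δ + n) ≠ 0 := sub_ne_zero.2 (one_sub_qexp_ne_of_qtheta
    (qtheta_ne_zero_sub g5 (1 + n) rfl) 0 (by push_cast; ring)).symm
  have m4 : 1 - 𝐞 (1 - ν - z - δ + n) ≠ 0 := sub_ne_zero.2 (one_sub_qexp_ne_of_qtheta
    (qtheta_ne_zero_sub g6 (1 + n) rfl) 0 (by push_cast; ring)).symm
  unfold vwpBasis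
  push_cast
  rw [qrho_succ, qrho_succ, e1, e2, ← add_assoc, ← add_assoc]
  field_simp

set_option linter.unusedVariables false in
/-- The Askey–Wilson operator applied to a summand of the very-well-poised series. -/
lemma awOp_vwpBasis {α β γ δ ν z : ℂ} (n : ℕ) (hz : AwRegular q z) (h1 : θ (α + z) ≠ 0)
    (h2 : θ (α - z) ≠ 0) (g3 : θ (δ + z) ≠ 0) (g4 : θ (δ - z) ≠ 0) (g5 : θ (δ + ν - z) ≠ 0)
    (g6 : θ (δ + ν + z) ≠ 0) :
    (1 - 𝐞 (α - ν - δ + 2 * n)) * awOp q α β γ δ ν (vwpBasis q α δ ν n) z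
      = (𝐞 (-ν) - 𝐞 (α + δ - 1)) * (𝐞 (β + γ + ν) * (1 - 𝐞 (α - ν - δ + n)) * (1 - 𝐞 (-ν + n))
          * (1 - 𝐞 (1 - ν - β - δ + n)) * (1 - 𝐞 (1 - ν - γ - δ + n))
          / ((1 - 𝐞 (1 - ν + z - δ + n)) * (1 - 𝐞 (1 - ν - z - δ + n)))
        - (1 - 𝐞 n) * (1 - 𝐞 (α + β - 1 + n)) * (1 - 𝐞 (α + γ - 1 + n)) * (1 - 𝐞 (α - δ + n))
          / ((1 - 𝐞 (α + z - 1 + n)) * (1 - 𝐞 (α - z - 1 + n)))) * vwpBasis q α δ ν n z := by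
  obtain ⟨z1, z2, z3⟩ := hz
  rw [qexp_two_mul] at z1 z2 z3
  -- Replacing ν by M makes every factor that contains ν a monomial in M, q^n, q^z and the
  -- parameters.
  obtain ⟨M, hM⟩ : ∃ M, M = 𝐞 (1 - ν - δ + n) := ⟨_, rfl⟩
  have hw : 𝐞 (-ν) = 𝐞 δ * M / (q * 𝐞 n) := by
    rw [hM, ← qexp_one, ← qexp_add, ← qexp_add, ← qexp_sub]; congr 1; ring
  have hy := qexp_ne_zero (q := q) z
  have ha := qexp_ne_zero (q := q) α
  have hd := qexp_ne_zero (q := q) δ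
  have hQ := q_cast_ne_zero (q := q)
  have hN := qexp_ne_zero (q := q) (n : ℂ)
  have hM0 : M ≠ 0 := hM ▸ qexp_ne_zero _
  have d1 : 1 - 𝐞 z ^ 2 ≠ 0 := sub_ne_zero.2 z1.symm
  have d2 : 1 - q * 𝐞 z ^ 2 ≠ 0 := by rw [mul_comm]; exact sub_ne_zero.2 z3.symm
  have d3 : 𝐞 z ^ 2 - q ≠ 0 := sub_ne_zero.2 z2
  have k4 : 𝐞 (α + z - 1 + n) = 𝐞 α * 𝐞 n * 𝐞 z / q := by
    rw [qexp_add, qexp_sub, qexp_add, qexp_one]; ring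
  have k5 : 𝐞 (α - z - 1 + n) = 𝐞 α * 𝐞 n / (q * 𝐞 z) := by
    rw [qexp_add, qexp_sub, qexp_sub, qexp_one]; field_simp
  have k6 : 𝐞 (1 - ν + z - δ + n) = M * 𝐞 z := by
    rw [hM, ← qexp_add]; congr 1; ring
  have k7 : 𝐞 (1 - ν - z - δ + n) = M / 𝐞 z := by
    rw [hM, ← qexp_sub]; congr 1; ring
  have d4 : q - 𝐞 α * 𝐞 n * 𝐞 z ≠ 0 := by
    have := one_sub_qexp_ne_of_qtheta h1 (n - 1) (v := α + z - 1 + n) (by push_cast; ring)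
    rw [k4, ne_eq, div_eq_one_iff_eq hQ] at this
    exact sub_ne_zero.2 (Ne.symm this)
  have d5 : q * 𝐞 z - 𝐞 α * 𝐞 n ≠ 0 := by
    have := one_sub_qexp_ne_of_qtheta h2 (n - 1) (v := α - z - 1 + n) (by push_cast; ring)
    rw [k5, ne_eq, div_eq_one_iff_eq (mul_ne_zero hQ hy)] at this
    exact sub_ne_zero.2 (Ne.symm this)
  have d6 : 1 - M * 𝐞 z ≠ 0 := by
    rw [← k6]
    exact sub_ne_zero.2 (one_sub_qexp_ne_of_qtheta
      (qtheta_ne_zero_sub g5 (1 + n) rfl) 0 (by push_cast; ring)).symm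
  have d7 : 𝐞 z - M ≠ 0 := by
    have := one_sub_qexp_ne_of_qtheta (q := q)
      (qtheta_ne_zero_sub g6 (1 + n) rfl) 0 (v := 1 - ν - z - δ + n) (by push_cast; ring)
    rw [k7, ne_eq, div_eq_one_iff_eq hy] at this
    exact sub_ne_zero.2 (Ne.symm this)
  have d8 : 1 - 𝐞 α * 𝐞 z ≠ 0 := by
    rw [← qexp_add]
    exact sub_ne_zero.2 (one_sub_qexp_ne_of_qtheta h1 0 (by push_cast; ring)).symm
  have d8' : 𝐞 z - 𝐞 α ≠ 0 := by
    have := one_sub_qexp_ne_of_qtheta h2 0 (v := α - z) (by push_cast; ring)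
    rw [qexp_sub, ne_eq, div_eq_one_iff_eq hy] at this
    exact sub_ne_zero.2 (Ne.symm this)
  have d9 : 1 - 𝐞 δ * 𝐞 z ≠ 0 := by
    rw [← qexp_add]
    exact sub_ne_zero.2 (one_sub_qexp_ne_of_qtheta g3 0 (by push_cast; ring)).symm
  have d9' : 𝐞 z - 𝐞 δ ≠ 0 := by
    have := one_sub_qexp_ne_of_qtheta g4 0 (v := δ - z) (by push_cast; ring)
    rw [qexp_sub, ne_eq, div_eq_one_iff_eq hy] at this
    exact sub_ne_zero.2 (Ne.symm this)
  have key := vwp_rational (a := 𝐞 α) (b := 𝐞 β) (c := 𝐞 γ) (d := 𝐞 δ) (N := 𝐞 n) (M := M)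
    (y := 𝐞 z) (Q := q) (qexp_ne_zero _) (qexp_ne_zero _) hd hN hM0 hQ hy d1 d2 d3 d4 d5 d6 d7
    rfl rfl rfl rfl rfl rfl rfl
  rw [← vwp_ratio hd hQ hy d5 d6 d8 d9, ← vwp_ratio_inv hd hQ hy d1 d3 d4 d7 d8' d9'] at key
  have l1 : 𝐞 (α - ν - δ + 2 * n) = 𝐞 α * M * 𝐞 n / q := by
    rw [hM, ← qexp_one, ← qexp_add, ← qexp_add, ← qexp_sub]; congr 1; ring
  have l2 : 𝐞 (α - ν - δ + n) = 𝐞 α * M / q := by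
    rw [hM, ← qexp_one, ← qexp_add, ← qexp_sub]; congr 1; ring
  have l3 : 𝐞 (-ν + n) = 𝐞 δ * M / q := by
    rw [hM, ← qexp_one, ← qexp_add, ← qexp_sub]; congr 1; ring
  have l4 : 𝐞 (1 - ν - β - δ + n) = M / 𝐞 β := by
    rw [hM, ← qexp_sub]; congr 1; ring
  have l5 : 𝐞 (1 - ν - γ - δ + n) = M / 𝐞 γ := by
    rw [hM, ← qexp_sub]; congr 1; ring
  have l6 : 𝐞 (β + γ + ν) = 𝐞 β * 𝐞 γ * q * 𝐞 n / (𝐞 δ * M) := by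
    rw [hM, ← qexp_one, ← qexp_add, ← qexp_add, ← qexp_add, ← qexp_add, ← qexp_sub]; congr 1; ring
  have l7 : 𝐞 (α + β + γ + δ + ν - 1) = 𝐞 α * 𝐞 β * 𝐞 γ * 𝐞 n / M := by
    rw [hM, ← qexp_add, ← qexp_add, ← qexp_add, ← qexp_sub]; congr 1; ring
  have l8 : 𝐞 (-ν - z - δ + n) = M / (q * 𝐞 z) := by
    rw [hM, ← qexp_one, ← qexp_add, ← qexp_sub]; congr 1; ring
  have l9 : 𝐞 (-ν + z - δ + n) = M * 𝐞 z / q := by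
    rw [hM, ← qexp_one, ← qexp_add, ← qexp_sub]; congr 1; ring
  rw [awOp, vwpBasis_add_one n h1 h2 g3 g4 g5, vwpBasis_sub_one n h1 h2 g3 g4 g6, l1, l2, l3, l4,
    l5, l6, l7, k4, k5, k6, k7, l8, l9, hw]
  unfold awCoeff
  have r1 : (1 : ℂ) - 𝐞 α * 𝐞 n * 𝐞 z / q = (q - 𝐞 α * 𝐞 n * 𝐞 z) / q := by field_simp
  have r2 : (1 : ℂ) - 𝐞 α * 𝐞 n / (q * 𝐞 z) = (q * 𝐞 z - 𝐞 α * 𝐞 n) / (q * 𝐞 z) := by field_simp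
  have r3 : 1 - M / 𝐞 z = (𝐞 z - M) / 𝐞 z := by field_simp
  have key2 := congrArg (· * vwpBasis q α δ ν n z) key
  refine Eq.trans ?_ (key2.trans ?_)
  · simp only [qexp_add, qexp_sub, qexp_neg, qexp_two_mul, qexp_one]
    ring
  · have t1 : ∀ X D D' : ℂ, X / (D * (D' / 𝐞 z)) = X * 𝐞 z / (D * D') := by
      intro X D D'
      rw [← mul_div_assoc, div_div_eq_mul_div]
    have t2 : ∀ X D D' : ℂ, X / (D / q * (D' / (q * 𝐞 z))) = X * q ^ 2 * 𝐞 z / (D * D') := by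
      intro X D D'
      rw [div_mul_div_comm, div_div_eq_mul_div]
      ring
    simp only [qexp_add, qexp_sub, qexp_one]
    rw [r1, r2, r3, t1, t2]
    congr 1
    congr 1
    · ring
    congr 2
    · ring

end

/-! ### Telescoping of the very-well-poised series -/

section

variable [hq : Fact (0 < q ∧ q < 1)]

include hq

/-- The coefficient of `vwpBasis` in the very-well-poised series, without its very-well-poised
factor. -/
def vwpCoeff (q : ℝ) (α β γ δ ν : ℂ) (n : ℕ) : ℂ :=
  qrho q (α - ν - δ) n * qrho q (-ν) n * qrho q (1 - ν - β - δ) n * qrho q (1 - ν - γ - δ) n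
    * (qeps q (1 + n) * qeps q (1 + α - δ + n) * qeps q (α + β + n) * qeps q (α + γ + n))
    * qexp q (β + γ + ν) ^ n

/-- By `vwpBasis_succ`, the first term of `awOp_vwpBasis` for n is, up to the coefficients, the
second term for n + 1. The boundary term for N = 0 vanishes because it contains `ε 0`. -/
lemma sum_awOp_vwp {α β γ δ ν z : ℂ} (hz : AwRegular q z) (h1 : θ (α + z) ≠ 0)
    (h2 : θ (α - z) ≠ 0) (g3 : θ (δ + z) ≠ 0) (g4 : θ (δ - z) ≠ 0) (g5 : θ (δ + ν - z) ≠ 0)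
    (g6 : θ (δ + ν + z) ≠ 0) (N : ℕ) :
    ∑ n ∈ Finset.range N, awOp q α β γ δ ν
        (fun w => (1 - 𝐞 (α - ν - δ + 2 * n)) * vwpCoeff q α β γ δ ν n * vwpBasis q α δ ν n w) z
      = (𝐞 (-ν) - 𝐞 (α + δ - 1)) * (ρ (α - ν - δ) N * ρ (-ν) N * ρ (1 - ν - β - δ) N
        * ρ (1 - ν - γ - δ) N * (ε (0 + N) * ε (α - δ + N) * ε (α + β - 1 + N) * ε (α + γ - 1 + N)))
        * 𝐞 (β + γ + ν) ^ N
        * (vwpBasis q α δ ν N z / ((1 - 𝐞 (α + z - 1 + N)) * (1 - 𝐞 (α - z - 1 + N)))) := by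
  induction N with
  | zero => simp
  | succ N ih =>
    have key := awOp_vwpBasis (β := β) (γ := γ) N hz h1 h2 g3 g4 g5 g6
    have m1 : 1 - 𝐞 (α + z + N) ≠ 0 :=
      sub_ne_zero.2 (one_sub_qexp_ne_of_qtheta h1 N (by push_cast; ring)).symm
    have m2 : 1 - 𝐞 (α - z + N) ≠ 0 :=
      sub_ne_zero.2 (one_sub_qexp_ne_of_qtheta h2 N (by push_cast; ring)).symm
    rw [Finset.sum_range_succ, ih, awOp_const_mul, mul_right_comm (1 - 𝐞 (α - ν - δ + 2 * N)), key,
      vwpBasis_succ N g5 g6,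
      vwpCoeff, qrho_succ, qrho_succ, qrho_succ, qrho_succ, pow_succ]
    push_cast
    rw [show (0 : ℂ) + ((N : ℂ) + 1) = 1 + N by ring,
      show α - δ + ((N : ℂ) + 1) = 1 + α - δ + N by ring,
      show α + β - 1 + ((N : ℂ) + 1) = α + β + N by ring,
      show α + γ - 1 + ((N : ℂ) + 1) = α + γ + N by ring,
      show α + z - 1 + ((N : ℂ) + 1) = α + z + N by ring,
      show α - z - 1 + ((N : ℂ) + 1) = α - z + N by ring,
      qeps_eq (0 + N), qeps_eq (α - δ + N), qeps_eq (α + β - 1 + N), qeps_eq (α + γ - 1 + N),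
      show (0 : ℂ) + N + 1 = 1 + N by ring, show α - δ + (N : ℂ) + 1 = 1 + α - δ + N by ring,
      show α + β - 1 + (N : ℂ) + 1 = α + β + N by ring,
      show α + γ - 1 + (N : ℂ) + 1 = α + γ + N by ring, zero_add (N : ℂ)]
    have c : ∀ X Y : ℂ, X * ((1 - 𝐞 (α + z + N)) * (1 - 𝐞 (α - z + N)) / Y)
        / ((1 - 𝐞 (α + z + N)) * (1 - 𝐞 (α - z + N))) = X / Y := by
      intro X Y; field_simp
    rw [c]
    ring

/-- The boundary term is a convergent sequence times the N-th power of q^(β+γ+ν), so it tends to 0.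
Unlike `uHat`, a single series suffices. -/
lemma vwpHat_isSolution {α β γ δ ν : ℂ} (ht : ‖𝐞 (β + γ + ν)‖ < 1) :
    IsSolution q α β γ δ ν δ (fun z => vwpHat q α β γ δ ν z) := by
  refine ⟨?_, fun z => ?_, ?_⟩
  · have := differentiableOn_vwpHat (q := q) (differentiable_const α) (differentiable_const β)
      (differentiable_const γ) (differentiable_const δ) (differentiable_const ν) differentiable_id
    simpa [ht, differentiableOn_univ] using this
  · simp only [vwpHat, vwpTerm]
    refine tsum_congr fun n => ?_
    rw [show α + (z + qperiod q) = α + z + qperiod q by ring,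
      show α - (z + qperiod q) = α - z - qperiod q by ring,
      show 1 - ν + (z + qperiod q) - δ + n = 1 - ν + z - δ + n + qperiod q by ring,
      show 1 - ν - (z + qperiod q) - δ + n = 1 - ν - z - δ + n - qperiod q by ring,
      qrho_add_period, qrho_sub_period, qeps_add_period, qeps_sub_period]
  · have g1 := eventually_qtheta_ne_zero (q := q) one_ne_zero α
    have g2 := eventually_qtheta_ne_zero (q := q) (neg_ne_zero.2 one_ne_zero) α
    have g3 := eventually_qtheta_ne_zero (q := q) one_ne_zero δ
    have g4 := eventually_qtheta_ne_zero (q := q) (neg_ne_zero.2 one_ne_zero) δ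
    have g5 := eventually_qtheta_ne_zero (q := q) (neg_ne_zero.2 one_ne_zero) (δ + ν)
    have g6 := eventually_qtheta_ne_zero (q := q) one_ne_zero (δ + ν)
    filter_upwards [g1, g2, g3, g4, g5, g6, eventually_awRegular (q := q)]
      with z g1 g2 g3 g4 g5 g6 hz
    rw [one_mul] at g1 g3 g6
    rw [neg_mul, one_mul, ← sub_eq_add_neg] at g2 g4 g5
    have hb : ∀ w, HasSum (fun n : ℕ => (1 - 𝐞 (α - ν - δ + 2 * n)) * vwpCoeff q α β γ δ ν n
        * vwpBasis q α δ ν n w) (vwpHat q α β γ δ ν w / qden q δ w) := by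
      intro w
      refine hasSum_of_eq ((summable_vwpHat α β γ δ ν w ht).hasSum.div_const (qden q δ w))
        fun n => ?_
      rw [vwpCoeff, vwpBasis, vwpTerm]
      ring
    have key := (hasSum_awOp (q := q) (α := α) (β := β) (γ := γ) (δ := δ) (ν := ν) (z := z)
      (f := fun w => vwpHat q α β γ δ ν w / qden q δ w)
      (F := fun n w => (1 - 𝐞 (α - ν - δ + 2 * n)) * vwpCoeff q α β γ δ ν n
        * vwpBasis q α δ ν n w) (hb _) (hb _) (hb _)).tendsto_sum_nat
    simp_rw [sum_awOp_vwp hz g1 g2 g3 g4 g5 g6] at key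
    refine tendsto_nhds_unique key ?_
    have t := tendsto_qeps_add_nat (q := q)
    have r := tendsto_qrho (q := q)
    have x := tendsto_qexp_add_nat (q := q)
    have tb : Tendsto (fun N : ℕ => vwpBasis q α δ ν N z
        / ((1 - 𝐞 (α + z - 1 + N)) * (1 - 𝐞 (α - z - 1 + N)))) atTop
        (𝓝 (ε (α + z) * ε (α - z) * (1 * 1) / qden q δ z / ((1 - 0) * (1 - 0)))) := by
      unfold vwpBasis
      exact ((((r _).mul (r _)).mul ((t _).mul (t _))).div_const _).div
        ((tendsto_const_nhds.sub (x _)).mul (tendsto_const_nhds.sub (x _))) (by simp)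
    have tp : Tendsto (fun N : ℕ => 𝐞 (β + γ + ν) ^ N) atTop (𝓝 0) :=
      tendsto_pow_atTop_nhds_zero_of_norm_lt_one ht
    have := (((((((r (α - ν - δ)).mul (r (-ν))).mul (r (1 - ν - β - δ))).mul
      (r (1 - ν - γ - δ))).mul ((((t 0).mul (t (α - δ))).mul (t (α + β - 1))).mul
      (t (α + γ - 1)))).const_mul (𝐞 (-ν) - 𝐞 (α + δ - 1))).mul tp).mul tb
    simpa using this

end

section

/-! ### Elliptic functions without poles -/

lemma qperiod_re : (qperiod q).re = 0 := by
  rw [qperiod, show (2 : ℂ) * Real.pi * I / Real.log q = ((2 * Real.pi / Real.log q : ℝ) : ℂ) * I by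
    push_cast; ring, Complex.re_ofReal_mul]
  simp

/-- Every value is attained on a compact rectangle. Because T is purely imaginary, reducing the
imaginary part modulo T leaves the real part alone, and the period 1 then reduces the latter. -/
lemma isBounded_range_of_periodic {R : ℂ → ℂ} {T : ℂ} (hR : Continuous R)
    (h1 : Function.Periodic R 1) (hT : Function.Periodic R T) (hre : T.re = 0) (him : T.im ≠ 0) :
    Bornology.IsBounded (Set.range R) := by
  have hK : IsCompact (Set.Icc (0 : ℝ) 1 ×ℂ Set.Icc (-|T.im|) |T.im|) :=
    isCompact_Icc.reProdIm isCompact_Icc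
  refine (hK.image hR).isBounded.subset ?_
  rintro _ ⟨z, rfl⟩
  refine ⟨z - ⌊z.im / T.im⌋ • T - ⌊z.re⌋ • (1 : ℂ), ?_, ?_⟩
  · rw [Complex.mem_reProdIm]
    have e1 : (z - ⌊z.im / T.im⌋ • T - ⌊z.re⌋ • (1 : ℂ)).re = Int.fract z.re := by
      rw [← Int.self_sub_floor]; simp [hre]
    have e2 : (z - ⌊z.im / T.im⌋ • T - ⌊z.re⌋ • (1 : ℂ)).im = Int.fract (z.im / T.im) * T.im := by
      rw [← Int.self_sub_floor, sub_mul, div_mul_cancel₀ _ him]; simp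
    rw [e1, e2]
    refine ⟨⟨Int.fract_nonneg _, (Int.fract_lt_one _).le⟩, abs_le.1 ?_⟩
    rw [abs_mul, abs_of_nonneg (Int.fract_nonneg _)]
    exact mul_le_of_le_one_left (abs_nonneg _) (Int.fract_lt_one _).le
  · rw [h1.sub_zsmul_eq, hT.sub_zsmul_eq]

lemma eventually_cocountable_add {P : ℂ → Prop} (h : ∀ᶠ z in cocountable, P z) (x : ℂ) :
    ∀ᶠ z in cocountable, P (z + x) := by
  have := eventually_cocountable_comp (P := P) (by rwa [Filter.Eventually, mem_cocountable] at h)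
    one_ne_zero x
  filter_upwards [this] with z hz
  rwa [one_mul, add_comm] at hz

/-- This is the 1-periodicity of F/G, cross-multiplied so that zeros of G do no harm. The induction
step has to cancel G(z + k), which is allowed off a countable set; continuity covers the rest. -/
lemma ratio_relation_nat {F G : ℂ → ℂ} (hF : Continuous F) (hG : Continuous G)
    (h : ∀ z, F (z + 1) * G z = F z * G (z + 1)) (hG0 : ∀ᶠ z in cocountable, G z ≠ 0) (k : ℕ) :
    ∀ z, F (z + k) * G z = F z * G (z + k) := by
  induction k with
  | zero => simp
  | succ k ih =>
    refine eq_of_eventually_cocountable ?_ (by fun_prop) (by fun_prop)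
    filter_upwards [eventually_cocountable_add hG0 k] with z hz
    have h1 := h (z + k)
    have h2 := ih z
    push_cast
    rw [← add_assoc]
    refine mul_right_cancel₀ hz ?_
    linear_combination G z * h1 + G (z + k + 1) * h2

lemma ratio_relation_int {F G : ℂ → ℂ} (hF : Continuous F) (hG : Continuous G)
    (h : ∀ z, F (z + 1) * G z = F z * G (z + 1)) (hG0 : ∀ᶠ z in cocountable, G z ≠ 0) (n m : ℤ)
    (z : ℂ) : F (z + n) * G (z + m) = F (z + m) * G (z + n) := by
  wlog hnm : m ≤ n generalizing n m
  · exact (this m n (le_of_not_ge hnm)).symm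
  · obtain ⟨k, rfl⟩ := Int.le.dest hnm
    have := ratio_relation_nat hF hG h hG0 k (z + m)
    push_cast
    rw [← add_assoc]
    exact this

variable [hq : Fact (0 < q ∧ q < 1)]

include hq

lemma qperiod_im : (qperiod q).im ≠ 0 := by
  rw [qperiod, show (2 : ℂ) * Real.pi * I / Real.log q = ((2 * Real.pi / Real.log q : ℝ) : ℂ) * I by
    push_cast; ring, Complex.im_ofReal_mul]
  simp [Real.pi_ne_zero, (log_q_neg (q := q)).ne]

/-- Two entire functions with the same multipliers are proportional, provided that the second one
does not vanish identically on any coset of `ℤ`. -/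
lemma proportional_of_ratio_relation {F G : ℂ → ℂ} (hF : Differentiable ℂ F)
    (hG : Differentiable ℂ G) (pF : ∀ z, F (z + qperiod q) = F z)
    (pG : ∀ z, G (z + qperiod q) = G z) (h : ∀ z, F (z + 1) * G z = F z * G (z + 1))
    (hG0 : ∀ᶠ z in cocountable, G z ≠ 0) (hn : ∀ z, ∃ n : ℤ, G (z + n) ≠ 0) :
    ∃ K, ∀ z, F z = K * G z := by
  choose n hn using hn
  -- F/G is 1-periodic, so at a zero of G it may be evaluated at another point of the coset. By `hR`
  -- the choice of that point is immaterial; keeping the shift fixed near a point shows that R is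
  -- entire.
  set R : ℂ → ℂ := fun z => F (z + n z) / G (z + n z) with hRdef
  have hR : ∀ z (m : ℤ), G (z + m) ≠ 0 → R z = F (z + m) / G (z + m) := by
    intro z m hm
    rw [hRdef]
    dsimp only
    rw [div_eq_div_iff (hn z) hm]
    exact ratio_relation_int hF.continuous hG.continuous h hG0 _ _ z
  have hRd : Differentiable ℂ R := by
    intro z₀
    have hc : ∀ᶠ z in 𝓝 z₀, G (z + n z₀) ≠ 0 :=
      (hG.continuous.comp (continuous_id.add continuous_const)).continuousAt.eventually_ne (hn z₀)
    have hd : DifferentiableAt ℂ (fun z => F (z + n z₀) / G (z + n z₀)) z₀ :=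
      (hF.comp (differentiable_id.add_const _)).differentiableAt.div
        (hG.comp (differentiable_id.add_const _)).differentiableAt (hn z₀)
    exact hd.congr_of_eventuallyEq (hc.mono fun z hz => hR z _ hz)
  have p1 : Function.Periodic R 1 := by
    intro z
    have e : z + 1 + (n (z + 1) : ℂ) = z + ((1 + n (z + 1) : ℤ) : ℂ) := by push_cast; ring
    have := hn (z + 1)
    rw [e] at this
    rw [hR z _ this, hR (z + 1) _ (hn (z + 1)), e]
  have pT : Function.Periodic R (qperiod q) := by
    intro z
    have e : z + qperiod q + n z = z + n z + qperiod q := by ring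
    rw [hR (z + qperiod q) (n z) (by rw [e, pG]; exact hn z), e, pF, pG]
  -- R is now an entire elliptic function, hence bounded and by Liouville constant.
  have hb := isBounded_range_of_periodic hRd.continuous p1 pT qperiod_re qperiod_im
  refine ⟨R 0, fun z => ?_⟩
  have h1 : F (z + n z) = R 0 * G (z + n z) := by
    rw [← hRd.apply_eq_apply_of_bounded hb z 0, hRdef, div_mul_cancel₀ _ (hn z)]
  have h2 := ratio_relation_int hF.continuous hG.continuous h hG0 (n z) 0 z
  rw [Int.cast_zero, add_zero] at h2
  refine mul_right_cancel₀ (hn z) ?_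
  rw [← h2, h1]
  ring

end

section

/-! ### Wronskians -/

/-- Zeros are isolated, so each point has a neighbourhood with at most one zero, and countably many
such neighbourhoods cover ℂ. -/
lemma eventually_ne_zero_of_differentiable {f : ℂ → ℂ} (hf : Differentiable ℂ f) {z₀ : ℂ}
    (h0 : f z₀ ≠ 0) : ∀ᶠ z in cocountable, f z ≠ 0 := by
  have ha : AnalyticOnNhd ℂ f Set.univ := hf.differentiableOn.analyticOnNhd isOpen_univ
  have hx : ∀ x, {z | z = x ∨ f z ≠ 0} ∈ 𝓝 x := by
    intro x
    rcases (ha x trivial).eventually_eq_zero_or_eventually_ne_zero with h | h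
    · exact absurd (ha.eqOn_zero_of_preconnected_of_eventuallyEq_zero isPreconnected_univ
        (Set.mem_univ x) h (Set.mem_univ z₀)) h0
    · rw [eventually_nhdsWithin_iff] at h
      filter_upwards [h] with z hz
      by_cases hzx : z = x
      · exact Or.inl hzx
      · exact Or.inr (hz hzx)
  obtain ⟨s, hs, hsu⟩ := TopologicalSpace.countable_cover_nhds hx
  rw [Filter.Eventually, mem_cocountable]
  refine hs.mono fun z hz => ?_
  have : z ∈ ⋃ x ∈ s, {z | z = x ∨ f z ≠ 0} := hsu ▸ Set.mem_univ z
  simp only [Set.mem_iUnion, Set.mem_ofPred_eq] at this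
  obtain ⟨x, hxs, rfl | h⟩ := this
  · exact hxs
  · exact absurd h hz

/-- `(e q ^ z, e q ^ (1 - z); q)_∞` for `e = q ^ η`. -/
def qgauge (q : ℝ) (η z : ℂ) : ℂ := qeps q (η + z) * qeps q (η + 1 - z)

/-- The function `q ^ z - q ^ (1 - z)`, a multiple of `∇ x`. -/
def qskew (q : ℝ) (z : ℂ) : ℂ := qexp q z - qexp q (1 - z)

/-- The Wronskian of `f / qden q d₁` and `g / qden q d₂`, without its denominator. -/
def qwron (q : ℝ) (d₁ d₂ : ℂ) (f g : ℂ → ℂ) (z : ℂ) : ℂ :=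
  f (z - 1) * g z * ((1 - qexp q (1 - z - d₁)) * (1 - qexp q (z - d₂)))
    - f z * g (z - 1) * ((1 - qexp q (z - d₁)) * (1 - qexp q (1 - z - d₂)))

lemma qgauge_symm (η z : ℂ) : qgauge q η (1 - z) = qgauge q η z := by
  rw [qgauge, qgauge, mul_comm]; congr 2 <;> ring

@[fun_prop] lemma differentiable_qskew : Differentiable ℂ (qskew q) := by
  unfold qskew; fun_prop

lemma IsSolution.swap {α β γ δ ν d : ℂ} {f : ℂ → ℂ} (h : IsSolution q α β γ δ ν d f) :
    IsSolution q α β δ γ ν d f := by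
  refine ⟨h.differentiable, h.periodic, h.solves.mono fun z hz => ?_⟩
  rw [← hz]
  unfold awOp awCoeff
  rw [show α + β + δ + γ = α + β + γ + δ by ring]
  ring

lemma IsSolution.reverse {α β γ δ ν d : ℂ} {f : ℂ → ℂ} (h : IsSolution q α β γ δ ν d f) :
    IsSolution q γ β α δ ν d f := by
  refine ⟨h.differentiable, h.periodic, h.solves.mono fun z hz => ?_⟩
  rw [← hz]
  unfold awOp awCoeff
  rw [show γ + β + α + δ = α + β + γ + δ by ring]
  ring

variable [hq : Fact (0 < q ∧ q < 1)]

include hq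

@[fun_prop] lemma differentiable_qgauge (η : ℂ) : Differentiable ℂ (qgauge q η) := by
  unfold qgauge; fun_prop

lemma qgauge_eq_qden (d z : ℂ) : qgauge q (-d) z = (1 - 𝐞 (z - d)) * qden q d z := by
  rw [qgauge, qden, qeps_eq (-d + z), show -d + z = z - d by ring,
    show z - d + 1 = 1 + z - d by ring, show -d + 1 - z = 1 - z - d by ring]
  ring

lemma qgauge_eq_qden_sub_one (d z : ℂ) :
    qgauge q (-d) z = (1 - 𝐞 (1 - z - d)) * qden q d (z - 1) := by
  rw [qgauge, qden, qeps_eq (-d + 1 - z), show -d + z = 1 + (z - 1) - d by ring,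
    show -d + 1 - z + 1 = 1 - (z - 1) - d by ring, show -d + 1 - z = 1 - z - d by ring]
  ring

lemma qgauge_add_one (η z : ℂ) :
    qgauge q η (z + 1) * (1 - 𝐞 (η + z)) = qgauge q η z * (1 - 𝐞 (η - z)) := by
  rw [qgauge, qgauge, qeps_eq (η + z), qeps_eq (η + 1 - (z + 1)),
    show η + 1 - (z + 1) = η - z by ring, show η - z + 1 = η + 1 - z by ring, add_assoc η z 1]
  ring

/-- `qgauge_add_one` for -η, with 1 - q^(-η∓z) rewritten through 1 - q^(η±z). The power of q^z
appears once for γ and once for δ, and together they match the fourth power in `awOp_wronskian`. -/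
lemma qgauge_neg_add_one (η z : ℂ) :
    qgauge q (-η) (z + 1) * (1 - 𝐞 (η - z)) * 𝐞 z ^ 2 = qgauge q (-η) z * (1 - 𝐞 (η + z)) := by
  have h := qgauge_add_one (q := q) (-η) z
  have e : 1 - 𝐞 (-η - z) = -𝐞 (-η - z) * (1 - 𝐞 (η + z)) := by
    rw [qexp_sub, qexp_neg, qexp_add]
    field_simp [qexp_ne_zero]
    ring
  have e' : 1 - 𝐞 (-η + z) = -𝐞 (-η + z) * (1 - 𝐞 (η - z)) := by
    rw [qexp_add, qexp_neg, qexp_sub]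
    field_simp [qexp_ne_zero]
    ring
  rw [e, e'] at h
  clear e e'
  simp only [qexp_sub, qexp_add, qexp_neg] at h ⊢
  have h1 := qexp_ne_zero (q := q) η
  have h2 := qexp_ne_zero (q := q) z
  field_simp at h
  field_simp
  linear_combination -h

lemma qgauge_add_period (η z : ℂ) : qgauge q η (z + qperiod q) = qgauge q η z := by
  rw [qgauge, qgauge, ← add_assoc, ← sub_sub, qeps_add_period, qeps_sub_period]

lemma qskew_add_period (z : ℂ) : qskew q (z + qperiod q) = qskew q z := by
  rw [qskew, qskew, ← sub_sub, qexp_add_period, qexp_sub_period]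

lemma qskew_ne_zero {z : ℂ} (h : 𝐞 (2 * z) ≠ q) : qskew q z ≠ 0 := by
  rw [qskew, sub_ne_zero, qexp_sub, qexp_one]
  intro h'
  rw [eq_div_iff (qexp_ne_zero _)] at h'
  exact h (by rw [qexp_two_mul, sq, h'])

lemma qgauge_ne_zero_of_qtheta {η z : ℂ} (h1 : θ (η + z) ≠ 0) (h2 : θ (η - z) ≠ 0) :
    qgauge q η z ≠ 0 :=
  mul_ne_zero (qeps_ne_of_qtheta h1 0 (by simp)) (qeps_ne_of_qtheta h2 1 (by push_cast; ring))

lemma qtheta_eq_zero_iff (w : ℂ) : θ w = 0 ↔ ∃ n : ℤ, 𝐞 w = (q : ℂ) ^ n := by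
  simpa using (qtheta_ne_zero_iff' (q := q) w).not

/-- The functions `qgauge q η`, `η ∈ E`, have a common point without zeros on each coset of `ℤ`. -/
lemma exists_qgauge_ne_zero {E : Finset ℂ} (hE : ∀ η ∈ E, ∀ η' ∈ E, θ (η + η') ≠ 0) (z : ℂ) :
    ∃ n : ℤ, 𝐞 (2 * (z + n)) ≠ q ∧ ∀ η ∈ E, qgauge q η (z + n) ≠ 0 := by
  have key : ∀ z : ℂ, (∀ η ∈ E, θ (η - z) ≠ 0) →
      ∃ n : ℕ, 𝐞 (2 * (z + n)) ≠ q ∧ ∀ η ∈ E, qgauge q η (z + n) ≠ 0 := by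
    intro z hz
    have h1 : ∀ᶠ n : ℕ in atTop, 𝐞 (2 * (z + n)) ≠ q := by
      have := ((tendsto_qexp_add_nat (q := q) z).pow 2).eventually_ne
        (by simpa using (q_cast_ne_zero (q := q)).symm : (0 : ℂ) ^ 2 ≠ q)
      exact this.mono fun n hn => by rwa [qexp_two_mul]
    have h2 : ∀ᶠ n : ℕ in atTop, ∀ η ∈ E, qgauge q η (z + n) ≠ 0 := by
      rw [Filter.eventually_all_finset]
      intro η hη
      have := (tendsto_qeps_add_nat (q := q) (η + z)).eventually_ne one_ne_zero
      refine this.mono fun n hn => mul_ne_zero ?_ ?_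
      · rwa [← add_assoc]
      · exact qeps_ne_of_qtheta (hz η hη) (1 - n) (by push_cast; ring)
    exact (h1.and h2).exists
  -- Moving far to the right works unless some η₀ - z gives a zero of `θ`. Then one moves far to the
  -- left instead, that is, to the right from 1 - z; an obstruction η there too would make q^(η +
  -- η₀) an integer power of q, against `hE`.
  by_cases hz : ∀ η ∈ E, θ (η - z) ≠ 0
  · obtain ⟨n, hn⟩ := key z hz
    exact ⟨n, by exact_mod_cast hn⟩
  · push Not at hz
    obtain ⟨η₀, h0, hz⟩ := hz
    obtain ⟨n, hn1, hn2⟩ := key (1 - z) fun η hη h => hE η hη η₀ h0 <| by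
      rw [qtheta_eq_zero_iff] at h hz ⊢
      obtain ⟨k, hk⟩ := hz
      obtain ⟨l, hl⟩ := h
      refine ⟨k + l + 1, ?_⟩
      rw [show η + η₀ = (η₀ - z) + (η - (1 - z)) + 1 by ring, qexp_add, qexp_add, hk, hl, qexp_one,
        zpow_add_one₀ q_cast_ne_zero, zpow_add₀ q_cast_ne_zero]
    refine ⟨-n, fun h => hn1 ?_, fun η hη => ?_⟩
    · rw [show 2 * (1 - z + n) = 1 + 1 - 2 * (z + ((-n : ℤ) : ℂ)) by push_cast; ring, qexp_sub, h,
        qexp_add, qexp_one, mul_div_cancel_right₀ _ q_cast_ne_zero]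
    · rw [← qgauge_symm, show 1 - (z + ((-n : ℤ) : ℂ)) = 1 - z + n by push_cast; ring]
      exact hn2 η hη

lemma qwron_eq {d₁ d₂ z : ℂ} (f g : ℂ → ℂ) (h₁ : qgauge q (-d₁) z ≠ 0)
    (h₂ : qgauge q (-d₂) z ≠ 0) :
    qwron q d₁ d₂ f g z = (f (z - 1) / qden q d₁ (z - 1) * (g z / qden q d₂ z)
      - f z / qden q d₁ z * (g (z - 1) / qden q d₂ (z - 1)))
        * (qgauge q (-d₁) z * qgauge q (-d₂) z) := by
  have a₁ := qgauge_eq_qden (q := q) d₁ z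
  have b₁ := qgauge_eq_qden_sub_one (q := q) d₁ z
  have a₂ := qgauge_eq_qden (q := q) d₂ z
  have b₂ := qgauge_eq_qden_sub_one (q := q) d₂ z
  have c₁ : qden q d₁ z ≠ 0 := right_ne_zero_of_mul (a₁ ▸ h₁)
  have c₂ : qden q d₁ (z - 1) ≠ 0 := right_ne_zero_of_mul (b₁ ▸ h₁)
  have c₃ : qden q d₂ z ≠ 0 := right_ne_zero_of_mul (a₂ ▸ h₂)
  have c₄ : qden q d₂ (z - 1) ≠ 0 := right_ne_zero_of_mul (b₂ ▸ h₂)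
  rw [sub_mul, qwron]
  congr 1
  · rw [b₁, a₂]; field_simp
  · rw [a₁, b₂]; field_simp

/-- The relation between the values of the Wronskian at `z + 1` and at `z`. -/
lemma awOp_wronskian {α β γ δ ν z : ℂ} {f g : ℂ → ℂ} (hz : AwRegular q z)
    (hf : awOp q α β γ δ ν f z = 0) (hg : awOp q α β γ δ ν g z = 0) :
    (f z * g (z + 1) - f (z + 1) * g z) * qskew q z
        * ((1 - 𝐞 (α + z)) * (1 - 𝐞 (β + z)) * (1 - 𝐞 (γ + z)) * (1 - 𝐞 (δ + z)))
      = (f (z - 1) * g z - f z * g (z - 1)) * qskew q (z + 1) * 𝐞 z ^ 4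
        * ((1 - 𝐞 (α - z)) * (1 - 𝐞 (β - z)) * (1 - 𝐞 (γ - z)) * (1 - 𝐞 (δ - z))) := by
  obtain ⟨h1, h2, h3⟩ := hz
  -- Eliminating the undifferenced term between the two equations removes the eigenvalue.
  have key : awCoeff q α β γ δ z * (f z * g (z + 1) - f (z + 1) * g z)
      = awCoeff q α β γ δ (-z) * (f (z - 1) * g z - f z * g (z - 1)) := by
    unfold awOp at hf hg
    linear_combination f z * hg - g z * hf
  rw [awCoeff, awCoeff, qexp_add (2 * z), qexp_add (2 * -z), show 2 * -z = -(2 * z) by ring,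
    qexp_neg, qexp_one, ← sub_eq_add_neg, ← sub_eq_add_neg, ← sub_eq_add_neg,
    ← sub_eq_add_neg] at key
  generalize (1 - 𝐞 (α + z)) * (1 - 𝐞 (β + z)) * (1 - 𝐞 (γ + z)) * (1 - 𝐞 (δ + z)) = A at *
  generalize (1 - 𝐞 (α - z)) * (1 - 𝐞 (β - z)) * (1 - 𝐞 (γ - z)) * (1 - 𝐞 (δ - z)) = B at *
  rw [qskew, qskew, show 1 - (z + 1) = -z by ring, qexp_neg, qexp_sub, qexp_add, qexp_one]
  rw [qexp_two_mul] at key h1 h2 h3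
  have hy := qexp_ne_zero (q := q) z
  generalize 𝐞 z = y at *
  have k1 : 1 - y ^ 2 ≠ 0 := sub_ne_zero.2 h1.symm
  have k2 : y ^ 2 - (q : ℂ) ≠ 0 := sub_ne_zero.2 h2
  have k3 : 1 - y ^ 2 * (q : ℂ) ≠ 0 := sub_ne_zero.2 h3.symm
  have e1 : 1 - (y ^ 2)⁻¹ = -(1 - y ^ 2) / y ^ 2 := by field_simp; ring
  have e2 : 1 - (y ^ 2)⁻¹ * (q : ℂ) = (y ^ 2 - q) / y ^ 2 := by field_simp
  rw [e1, e2] at key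
  field_simp at key
  field_simp
  linear_combination key

/-- The product of the Wronskian and the denominators `qgauge q (-γ)`, `qgauge q (-δ)` has the
same multipliers as `qskew q * qgauge q α * qgauge q β`. -/
lemma wronskian_mul_qgauge_relation {α β γ δ ν z : ℂ} {f g : ℂ → ℂ} (hz : AwRegular q z)
    (h1 : 𝐞 (α + z) ≠ 1) (h2 : 𝐞 (β + z) ≠ 1) (h3 : 𝐞 (γ - z) ≠ 1) (h4 : 𝐞 (δ - z) ≠ 1)
    (hf : awOp q α β γ δ ν f z = 0) (hg : awOp q α β γ δ ν g z = 0) :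
    (f z * g (z + 1) - f (z + 1) * g z) * (qgauge q (-γ) (z + 1) * qgauge q (-δ) (z + 1))
        * (qskew q z * qgauge q α z * qgauge q β z)
      = (f (z - 1) * g z - f z * g (z - 1)) * (qgauge q (-γ) z * qgauge q (-δ) z)
        * (qskew q (z + 1) * qgauge q α (z + 1) * qgauge q β (z + 1)) := by
  have key := awOp_wronskian hz hf hg
  have a := qgauge_add_one (q := q) α z
  have b := qgauge_add_one (q := q) β z
  have c := qgauge_neg_add_one (q := q) γ z
  have d := qgauge_neg_add_one (q := q) δ z
  have hy := qexp_ne_zero (q := q) z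
  rw [← sub_ne_zero] at h1 h2 h3 h4
  have k1 : 1 - 𝐞 (α + z) ≠ 0 := by rw [← neg_sub]; exact neg_ne_zero.2 h1
  have k2 : 1 - 𝐞 (β + z) ≠ 0 := by rw [← neg_sub]; exact neg_ne_zero.2 h2
  have k3 : 1 - 𝐞 (γ - z) ≠ 0 := by rw [← neg_sub]; exact neg_ne_zero.2 h3
  have k4 : 1 - 𝐞 (δ - z) ≠ 0 := by rw [← neg_sub]; exact neg_ne_zero.2 h4
  clear h1 h2 h3 h4 hf hg
  rw [← eq_div_iff k1] at a
  rw [← eq_div_iff k2] at b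
  rw [← eq_div_iff (pow_ne_zero 2 hy), ← eq_div_iff k3] at c
  rw [← eq_div_iff (pow_ne_zero 2 hy), ← eq_div_iff k4] at d
  rw [a, b, c, d]
  field_simp
  linear_combination (qgauge q (-γ) z * qgauge q (-δ) z * qgauge q α z * qgauge q β z) * key

end

/-! ### Uniqueness of solutions with prescribed poles -/

section

/-- Sufficiently generic exponents for the uniqueness arguments. -/
structure AwGeneric (q : ℝ) (α β γ δ : ℂ) : Prop where
  αα : qtheta q (α + α) ≠ 0
  ββ : qtheta q (β + β) ≠ 0
  γγ : qtheta q (γ + γ) ≠ 0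
  δδ : qtheta q (δ + δ) ≠ 0
  αβ : qtheta q (α + β) ≠ 0
  αγ : qtheta q (α + γ) ≠ 0
  αδ : qtheta q (α + δ) ≠ 0
  βγ : qtheta q (β + γ) ≠ 0
  γδ : qtheta q (γ + δ) ≠ 0
  αγ' : qtheta q (α - γ) ≠ 0
  αδ' : qtheta q (α - δ) ≠ 0
  βγ' : qtheta q (β - γ) ≠ 0
  βδ' : qtheta q (β - δ) ≠ 0
  γδ' : qtheta q (γ - δ) ≠ 0

variable [hq : Fact (0 < q ∧ q < 1)]

include hq

lemma qtheta_neg_ne_zero {w v : ℂ} (h : θ w ≠ 0) (hv : v = -w) : θ v ≠ 0 :=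
  qtheta_ne_zero_sub h 0 (by simp [hv])

/-- A function with the multipliers of `qskew q * qgauge q α * qgauge q β * qgauge q η` is a
multiple of it. -/
lemma proportional_qskew_qgauge {E : Finset ℂ} {F G : ℂ → ℂ}
    (hE : ∀ η ∈ E, ∀ η' ∈ E, θ (η + η') ≠ 0) (hF : Differentiable ℂ F) (hG : Differentiable ℂ G)
    (pF : ∀ z, F (z + qperiod q) = F z) (pG : ∀ z, G (z + qperiod q) = G z)
    (hGE : ∀ z, 𝐞 (2 * z) ≠ q → (∀ η ∈ E, qgauge q η z ≠ 0) → G z ≠ 0)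
    (h : ∀ᶠ z in cocountable, F (z + 1) * G z = F z * G (z + 1)) : ∃ K, ∀ z, F z = K * G z := by
  have hn : ∀ z, ∃ n : ℤ, G (z + n) ≠ 0 := fun z => by
    obtain ⟨n, h1, h2⟩ := exists_qgauge_ne_zero hE z
    exact ⟨n, hGE _ h1 h2⟩
  refine proportional_of_ratio_relation hF hG pF pG
    (eq_of_eventually_cocountable h
      ((hF.continuous.comp (continuous_id.add continuous_const)).mul hG.continuous)
      (hF.continuous.mul (hG.continuous.comp (continuous_id.add continuous_const))))
    ?_ hn
  obtain ⟨n, hn0⟩ := hn 0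
  exact eventually_ne_zero_of_differentiable hG hn0

omit hq in
lemma differentiable_qwron {f g : ℂ → ℂ} (hf : Differentiable ℂ f) (hg : Differentiable ℂ g)
    (d₁ d₂ : ℂ) : Differentiable ℂ (qwron q d₁ d₂ f g) := by
  unfold qwron; fun_prop

lemma qwron_add_period {f g : ℂ → ℂ} (hf : ∀ z, f (z + qperiod q) = f z)
    (hg : ∀ z, g (z + qperiod q) = g z) (d₁ d₂ z : ℂ) :
    qwron q d₁ d₂ f g (z + qperiod q) = qwron q d₁ d₂ f g z := by
  simp only [qwron, ← sub_sub, add_sub_right_comm _ (qperiod q), sub_right_comm _ (qperiod q),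
    qexp_add_period, qexp_sub_period, hf, hg]

lemma eventually_qtheta_pm (η : ℂ) :
    ∀ᶠ z in cocountable, θ (η + z) ≠ 0 ∧ θ (η - z) ≠ 0 := by
  filter_upwards [eventually_qtheta_ne_zero (q := q) one_ne_zero η,
    eventually_qtheta_ne_zero (q := q) (neg_ne_zero.2 one_ne_zero) η] with z h1 h2
  rw [one_mul] at h1
  rw [neg_mul, one_mul, ← sub_eq_add_neg] at h2
  exact ⟨h1, h2⟩

/-- The common part of the two Wronskian formulas. -/
lemma IsSolution.eventually_wronskian_relation {α β γ δ ν d₁ d₂ : ℂ} {f g : ℂ → ℂ}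
    (hf : IsSolution q α β γ δ ν d₁ f) (hg : IsSolution q α β γ δ ν d₂ g) :
    ∀ᶠ z in cocountable, ∃ w₀ w₁ : ℂ,
      qwron q d₁ d₂ f g z = w₀ * (qgauge q (-d₁) z * qgauge q (-d₂) z) ∧
      qwron q d₁ d₂ f g (z + 1) = w₁ * (qgauge q (-d₁) (z + 1) * qgauge q (-d₂) (z + 1)) ∧
      w₁ * (qgauge q (-γ) (z + 1) * qgauge q (-δ) (z + 1))
          * (qskew q z * qgauge q α z * qgauge q β z)
        = w₀ * (qgauge q (-γ) z * qgauge q (-δ) z)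
          * (qskew q (z + 1) * qgauge q α (z + 1) * qgauge q β (z + 1)) := by
  filter_upwards [hf.solves, hg.solves, eventually_awRegular (q := q), eventually_qtheta_pm (q := q) α,
    eventually_qtheta_pm (q := q) β, eventually_qtheta_pm (q := q) γ,
    eventually_qtheta_pm (q := q) δ, eventually_qtheta_pm (q := q) d₁,
    eventually_qtheta_pm (q := q) d₂] with z s1 s2 hz ha hb hc hd h1 h2
  have k : ∀ d, θ (d + z) ≠ 0 ∧ θ (d - z) ≠ 0 →
      qgauge q (-d) z ≠ 0 ∧ qgauge q (-d) (z + 1) ≠ 0 := fun d h =>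
    ⟨qgauge_ne_zero_of_qtheta (qtheta_neg_ne_zero h.2 (by ring))
      (qtheta_neg_ne_zero h.1 (by ring)),
    qgauge_ne_zero_of_qtheta (qtheta_ne_zero_sub h.2 1 (by push_cast; ring))
      (qtheta_ne_zero_sub h.1 (-1) (by push_cast; ring))⟩
  have e0 := qwron_eq f g (k _ h1).1 (k _ h2).1
  have e1 := qwron_eq f g (k _ h1).2 (k _ h2).2
  refine ⟨_, _, e0, e1, ?_⟩
  have := wronskian_mul_qgauge_relation hz (one_sub_qexp_ne_of_qtheta ha.1 0 (by simp))
    (one_sub_qexp_ne_of_qtheta hb.1 0 (by simp)) (one_sub_qexp_ne_of_qtheta hc.2 0 (by simp))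
    (one_sub_qexp_ne_of_qtheta hd.2 0 (by simp)) s1 s2
  rw [add_sub_cancel_right]
  exact this

/-- The denominators belong to δ and γ, so `qwron` is the Wronskian times exactly the two gauge
factors whose multipliers are known. The conditions on α and β keep the comparison function from
vanishing on a whole coset of ℤ. -/
lemma IsSolution.exists_qwron_eq {α β γ δ ν : ℂ} {f g : ℂ → ℂ}
    (hG : AwGeneric q α β γ δ) (hf : IsSolution q α β γ δ ν δ f)
    (hg : IsSolution q α β γ δ ν γ g) :
    ∃ K, ∀ z, qwron q δ γ f g z = K * (qskew q z * qgauge q α z * qgauge q β z) := by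
  refine proportional_qskew_qgauge (E := {α, β}) ?_
    (differentiable_qwron hf.differentiable hg.differentiable _ _) (by fun_prop)
    (qwron_add_period hf.periodic hg.periodic _ _)
    (fun z => by simp only [qskew_add_period, qgauge_add_period]) ?_ ?_
  · have := hG.αβ
    have := add_comm α β ▸ this
    simp [hG.αα, hG.ββ, *]
  · intro z h1 h2
    exact mul_ne_zero (mul_ne_zero (qskew_ne_zero h1) (h2 _ (by simp))) (h2 _ (by simp))
  · filter_upwards [hf.eventually_wronskian_relation hg] with z ⟨w₀, w₁, h0, h1, h2⟩
    rw [h0, h1]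
    linear_combination h2

/-- With both denominators belonging to δ, `qwron` contains the gauge factor of -δ twice and that of
-γ not at all. Multiplying by the latter restores the known multipliers, but it also forces a zero
that the comparison function does not have. -/
lemma IsSolution.qwron_eq_zero {α β γ δ ν : ℂ} {f g : ℂ → ℂ}
    (hG : AwGeneric q α β γ δ) (hf : IsSolution q α β γ δ ν δ f)
    (hg : IsSolution q α β γ δ ν δ g) (z : ℂ) : qwron q δ δ f g z = 0 := by
  have hw := differentiable_qwron (q := q) hf.differentiable hg.differentiable δ δ
  obtain ⟨K, hK⟩ := proportional_qskew_qgauge (q := q) (E := {α, β, -δ})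
    (F := fun z => qwron q δ δ f g z * qgauge q (-γ) z)
    (G := fun z => qskew q z * qgauge q α z * qgauge q β z * qgauge q (-δ) z)
    (by
      have h1 := qtheta_neg_ne_zero hG.δδ (show -δ + -δ = _ by ring)
      have h2 := hG.αδ'
      have h3 := hG.βδ'
      have h4 : θ (-δ + α) ≠ 0 := by rw [neg_add_eq_sub]; exact h2
      have h5 : θ (-δ + β) ≠ 0 := by rw [neg_add_eq_sub]; exact h3
      have h6 := hG.αβ
      have h7 := add_comm α β ▸ h6
      rw [sub_eq_add_neg] at h2 h3
      simp [hG.αα, hG.ββ, *])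
    (by fun_prop) (by fun_prop)
    (fun z => by simp only [qwron_add_period hf.periodic hg.periodic, qgauge_add_period])
    (fun z => by simp only [qskew_add_period, qgauge_add_period])
    (fun z h1 h2 => mul_ne_zero (mul_ne_zero (mul_ne_zero (qskew_ne_zero h1) (h2 _ (by simp)))
      (h2 _ (by simp))) (h2 _ (by simp)))
    (by
      filter_upwards [hf.eventually_wronskian_relation hg] with z ⟨w₀, w₁, h0, h1, h2⟩
      rw [h0, h1]
      linear_combination qgauge q (-δ) (z + 1) * qgauge q (-δ) z * h2)
  -- At z = γ the factor `qgauge q (-γ)` contains `ε 0`, while every factor of the comparison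
  -- function is nonzero there.
  have h0 : K = 0 := by
    have := hK γ
    rw [show qgauge q (-γ) γ = 0 by simp [qgauge], mul_zero] at this
    refine (mul_eq_zero.1 this.symm).resolve_right
      (mul_ne_zero (mul_ne_zero (mul_ne_zero (qskew_ne_zero ?_) ?_) ?_) ?_)
    · have := (qtheta_ne_zero_iff' _).1 hG.γγ 1
      rwa [zpow_one, ← two_mul] at this
    · exact qgauge_ne_zero_of_qtheta hG.αγ hG.αγ'
    · exact qgauge_ne_zero_of_qtheta hG.βγ hG.βγ'
    · exact qgauge_ne_zero_of_qtheta (by rw [neg_add_eq_sub]; exact hG.γδ')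
        (qtheta_neg_ne_zero hG.γδ (by ring))
  refine eq_of_eventually_cocountable (G := fun _ => 0) ?_ hw.continuous continuous_const z
  filter_upwards [eventually_qtheta_pm (q := q) γ] with z hz
  refine (mul_eq_zero.1 (?_ : qwron q δ δ f g z * qgauge q (-γ) z = 0)).resolve_right
    (qgauge_ne_zero_of_qtheta (qtheta_neg_ne_zero hz.2 (by ring))
      (qtheta_neg_ne_zero hz.1 (by ring)))
  rw [hK, h0, zero_mul]

/-- If some Wronskian with `f` does not vanish, then `f` is, up to a factor, the only solution with
its poles. -/
lemma IsSolution.proportional {α β γ δ ν K : ℂ} {f g h : ℂ → ℂ}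
    (hG : AwGeneric q α β γ δ) (hf : IsSolution q α β γ δ ν δ f) (hh : IsSolution q α β γ δ ν δ h)
    (hK : ∀ z, qwron q δ γ f g z = K * (qskew q z * qgauge q α z * qgauge q β z)) (hK0 : K ≠ 0) :
    ∃ κ, ∀ z, h z = κ * f z := by
  -- If f vanished at two neighbouring points z + n - 1 and z + n, so would its Wronskian with g,
  -- whereas its formula has a nonzero value somewhere on each coset.
  have hn : ∀ z, ∃ n : ℤ, f (z + n) ≠ 0 := by
    intro z
    obtain ⟨n, h1, h2⟩ := exists_qgauge_ne_zero (q := q) (E := {α, β}) (by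
      have := hG.αβ
      have := add_comm α β ▸ this
      simp [hG.αα, hG.ββ, *]) z
    by_contra! hc
    have := hK (z + n)
    have e1 := hc (n - 1)
    push_cast at e1
    rw [qwron, hc n, add_sub_assoc, e1] at this
    simp only [zero_mul, sub_zero] at this
    exact mul_ne_zero hK0 (mul_ne_zero (mul_ne_zero (qskew_ne_zero h1) (h2 _ (by simp)))
      (h2 _ (by simp))) this.symm
  obtain ⟨n, hn0⟩ := hn 0
  have hd := hf.differentiable
  have hd' := hh.differentiable
  refine proportional_of_ratio_relation hd' hd hh.periodic hf.periodic ?_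
    (eventually_ne_zero_of_differentiable hd hn0) hn
  refine eq_of_eventually_cocountable ?_
    ((hd'.continuous.comp (continuous_id.add continuous_const)).mul hd.continuous)
    (hd'.continuous.mul (hd.continuous.comp (continuous_id.add continuous_const)))
  filter_upwards [eventually_qtheta_pm (q := q) δ] with z hz
  -- For equal denominators the two products in `qwron` carry the same factor. Once it is cancelled,
  -- the vanishing of `qwron` is the ratio relation for h and f.
  have h1 := IsSolution.qwron_eq_zero hG hf hh (z + 1)
  rw [qwron, add_sub_cancel_right, show 1 - (z + 1) - δ = -z - δ by ring] at h1
  have k1 : 1 - 𝐞 (-z - δ) ≠ 0 := sub_ne_zero.2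
    (one_sub_qexp_ne_of_qtheta (qtheta_neg_ne_zero hz.1 rfl) 0 (by push_cast; ring)).symm
  have k2 : 1 - 𝐞 (z + 1 - δ) ≠ 0 := sub_ne_zero.2
    (one_sub_qexp_ne_of_qtheta (qtheta_neg_ne_zero hz.2 rfl) 1 (by push_cast; ring)).symm
  refine mul_right_cancel₀ (mul_ne_zero k1 k2) ?_
  linear_combination h1

end

section

variable [hq : Fact (0 < q ∧ q < 1)]

include hq

/-! ### Special values -/

lemma balSeries_of_zero₁ (x₂ x₃ x₄ y₁ y₂ y₃ : ℂ) :
    balSeries q 0 x₂ x₃ x₄ y₁ y₂ y₃ = ε 1 * ε y₁ * ε y₂ * ε y₃ := by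
  rw [balSeries, tsum_eq_single 0 fun n hn => by rw [qrho_zero_left hn]; ring]
  simp

lemma balSeries_of_zero₄ (x₁ x₂ x₃ y₁ y₂ y₃ : ℂ) :
    balSeries q x₁ x₂ x₃ 0 y₁ y₂ y₃ = ε 1 * ε y₁ * ε y₂ * ε y₃ := by
  rw [balSeries, tsum_eq_single 0 fun n hn => by rw [qrho_zero_left hn]; ring]
  simp

omit hq in
lemma uHat_neg (α β γ δ ν z : ℂ) : uHat q α β γ δ ν (-z) = uHat q α β γ δ ν z := by
  unfold uHat balSeries
  simp only [sub_neg_eq_add, ← sub_eq_add_neg]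
  congr 2
  · ring
  · refine tsum_congr fun n => ?_; ring
  · ring
  · refine tsum_congr fun n => ?_; ring

/-- At z = α the factor `ε (α - z)` removes the second series and reduces the first one to its
initial term. -/
lemma uHat_self (α β γ δ ν : ℂ) : uHat q α β γ δ ν α
    = ε (β + γ + ν) * ε (1 - ν - α - δ) * ε (1 + α - δ) * ε 1 * ε (α + β) * ε (α + γ)
      * θ (α + δ) := by
  rw [uHat, sub_self, balSeries_of_zero₄, qeps_zero, qtheta, show 1 - (α + δ) = 1 - α - δ by ring]
  ring

/-- At z = 1 - δ the roles are exchanged: `ε (1 - z - δ)` removes the first series and only the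
initial term of the second one remains. -/
lemma uHat_one_sub (α β γ δ ν : ℂ) : uHat q α β γ δ ν (1 - δ)
    = ε (-ν) * ε (α + β + γ + δ + ν - 1) * ε 1 * ε (1 + α - δ) * ε (1 + β - δ) * ε (1 + γ - δ)
      * θ (α + δ) := by
  rw [uHat, show 1 - (1 - δ) - δ = 0 by ring, balSeries_of_zero₄, qeps_zero, qtheta,
    show 1 - (α + δ) = 1 - α - δ by ring, qeps_eq (1 - α - δ), qeps_eq (α - (1 - δ)),
    show α - (1 - δ) + 1 = α + δ by ring, show 1 - α - δ + 1 = 2 - α - δ by ring,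
    show α - (1 - δ) = -(1 - α - δ) by ring, qexp_neg, show α + (1 - δ) = 1 + α - δ by ring]
  have := qexp_ne_zero (q := q) (1 - α - δ)
  field_simp
  ring

lemma uHat_nu_zero (α β γ δ z : ℂ) : uHat q α β γ δ 0 z
    = ε (β + γ) * θ (α + δ) * (ε (1 + z - δ) * ε (1 - z - δ))
      * (ε 1 * ε (α + β) * ε (α + γ)) := by
  rw [uHat, neg_zero, balSeries_of_zero₁, qeps_zero, qtheta, show 1 - (α + δ) = 1 - 0 - α - δ by ring,
    add_zero (β + γ)]
  ring

lemma vwpHat_self (α β γ δ ν : ℂ) : vwpHat q α β γ δ ν α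
    = ε (α - ν - δ) * ε (1 - ν - α - δ) * ε (1 + α - δ) * ε 1 * ε (α + β) * ε (α + γ) := by
  rw [vwpHat, tsum_eq_single 0 fun n hn => by rw [vwpTerm, sub_self, qrho_zero_left hn]; ring,
    qeps_eq (α - ν - δ), vwpTerm, show α - ν - δ + 1 = 1 - ν + α - δ by ring]
  simp
  ring

/-! ### The connection coefficient -/

/-- The speeds 1, 2, 4, 8 make each exponent that occurs in `AwGeneric` a nonconstant linear
function of s, so each condition fails only for countably many s. -/
lemma AwGeneric.eventually (α β γ δ : ℂ) : ∀ᶠ s in cocountable,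
    AwGeneric q (α + s) (β + 2 * s) (γ + 4 * s) (δ + 8 * s) := by
  have h : ∀ (k : ℂ) (_ : k ≠ 0) (x : ℂ) (w : ℂ → ℂ) (_ : ∀ s, w s = x + k * s),
      ∀ᶠ s in cocountable, θ (w s) ≠ 0 := fun k hk x w hw => by
    simpa only [hw] using eventually_qtheta_ne_zero (q := q) hk x
  filter_upwards [h 2 (by norm_num) (α + α) (fun s => (α + s) + (α + s)) (fun s => by ring),
    h 4 (by norm_num) (β + β) (fun s => (β + 2 * s) + (β + 2 * s)) (fun s => by ring),
    h 8 (by norm_num) (γ + γ) (fun s => (γ + 4 * s) + (γ + 4 * s)) (fun s => by ring),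
    h 16 (by norm_num) (δ + δ) (fun s => (δ + 8 * s) + (δ + 8 * s)) (fun s => by ring),
    h 3 (by norm_num) (α + β) (fun s => (α + s) + (β + 2 * s)) (fun s => by ring),
    h 5 (by norm_num) (α + γ) (fun s => (α + s) + (γ + 4 * s)) (fun s => by ring),
    h 9 (by norm_num) (α + δ) (fun s => (α + s) + (δ + 8 * s)) (fun s => by ring),
    h 6 (by norm_num) (β + γ) (fun s => (β + 2 * s) + (γ + 4 * s)) (fun s => by ring),
    h 12 (by norm_num) (γ + δ) (fun s => (γ + 4 * s) + (δ + 8 * s)) (fun s => by ring),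
    h (-3) (by norm_num) (α - γ) (fun s => (α + s) - (γ + 4 * s)) (fun s => by ring),
    h (-7) (by norm_num) (α - δ) (fun s => (α + s) - (δ + 8 * s)) (fun s => by ring),
    h (-2) (by norm_num) (β - γ) (fun s => (β + 2 * s) - (γ + 4 * s)) (fun s => by ring),
    h (-6) (by norm_num) (β - δ) (fun s => (β + 2 * s) - (δ + 8 * s)) (fun s => by ring),
    h (-4) (by norm_num) (γ - δ) (fun s => (γ + 4 * s) - (δ + 8 * s)) (fun s => by ring)]
    with s h1 h2 h3 h4 h5 h6 h7 h8 h10 h12 h13 h14 h15 h16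
  exact ⟨h1, h2, h3, h4, h5, h6, h7, h8, h10, h12, h13, h14, h15, h16⟩

omit hq in
/-- The constant in the Wronskian of the two solutions. -/
def wronConst (q : ℝ) (α β γ δ ν : ℂ) : ℂ :=
  -qexp q (-γ) * (qeps q (γ - δ) * qeps q (1 + δ - γ)) * qtheta q (α + δ) * qtheta q (α + γ)
    * qeps q 1 ^ 2 * qeps q (-ν) * qeps q (α + β + γ + δ + ν - 1) * qeps q (α + β + ν)
    * qeps q (1 - ν - γ - δ)

/-- The constant in the Wronskian, in terms of a value of the first solution. -/
lemma wronskian_const_eq {α β γ δ ν K : ℂ} (hG : AwGeneric q α β γ δ)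
    (hK : ∀ z, qwron q δ γ (fun z => uHat q α β γ δ ν z) (fun z => uHat q α β δ γ ν z) z
      = K * (qskew q z * qgauge q α z * qgauge q β z)) :
    K * (ε (α + γ) * ε (β + γ)) = -𝐞 (-γ) * uHat q α β γ δ ν γ * (1 - 𝐞 (γ - δ)) * ε (1 + δ - γ)
      * θ (α + γ) * ε 1 * ε (-ν) * ε (α + β + γ + δ + ν - 1) := by
  -- At z = γ the factor 1 - q^(z-γ) kills one product of the Wronskian. The other one contains the
  -- second solution at γ - 1, which by evenness is its explicit value at 1 - γ.
  have h := hK γ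
  have hv : uHat q α β δ γ ν (γ - 1) = uHat q α β δ γ ν (1 - γ) := by
    rw [← uHat_neg, neg_sub]
  rw [qwron, sub_self γ, qexp_zero, hv, uHat_one_sub, qgauge, qgauge, qskew,
    show α + β + δ + γ + ν - 1 = α + β + γ + δ + ν - 1 by ring,
    show (1 : ℂ) - γ - γ = (1 - γ) - γ by ring, show α + 1 - γ = 1 + α - γ by ring,
    show β + 1 - γ = 1 + β - γ by ring, qexp_sub (1 - γ) γ] at h
  have k1 : ε (1 + α - γ) ≠ 0 := qeps_ne_of_qtheta hG.αγ' 1 (by push_cast; ring)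
  have k2 : ε (1 + β - γ) ≠ 0 := qeps_ne_of_qtheta hG.βγ' 1 (by push_cast; ring)
  have k3 : 𝐞 γ - 𝐞 (1 - γ) ≠ 0 := by
    have := (qtheta_ne_zero_iff' _).1 hG.γγ 1
    rw [zpow_one, ← two_mul] at this
    exact qskew_ne_zero this
  rw [qexp_neg]
  have k4 := qexp_ne_zero (q := q) γ
  have k5 : 1 - 𝐞 (1 - γ) / 𝐞 γ = (𝐞 γ - 𝐞 (1 - γ)) / 𝐞 γ := by field_simp
  rw [k5] at h
  refine mul_right_cancel₀ (mul_ne_zero (mul_ne_zero k1 k2) k3) ?_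
  linear_combination -h

end

/-! ### The connection value, the Wronskian constant and the two forms of the solution -/

section

variable [hq : Fact (0 < q ∧ q < 1)]

include hq

lemma eventually_qeps_of_eq {k : ℂ} (hk : k ≠ 0) (x : ℂ) (w : ℂ → ℂ) (hw : ∀ s, w s = x + k * s) :
    ∀ᶠ s in cocountable, ε (w s) ≠ 0 := by
  simpa only [hw] using eventually_qeps_ne_zero (q := q) hk x

/-- The only two possible values of the connection coefficient. -/
lemma uHat_third_eq_zero_or {α β γ δ ν : ℂ} (hG : AwGeneric q α β γ δ) (h1 : ε (-ν) ≠ 0)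
    (h2 : ε (α + β + γ + δ + ν - 1) ≠ 0) :
    uHat q α β γ δ ν γ = 0 ∨ uHat q α β γ δ ν γ = θ (α + δ) * ε (α + β + ν) * ε (1 - ν - γ - δ)
      * ε (1 + γ - δ) * ε 1 * ε (β + γ) * ε (α + γ) := by
  by_cases hX : uHat q α β γ δ ν γ = 0
  · exact Or.inl hX
  right
  have hU := uHat_isSolution (q := q) α β γ δ ν
  obtain ⟨K, hK⟩ := IsSolution.exists_qwron_eq hG hU (uHat_isSolution (q := q) α β δ γ ν).swap
  have hK1 := wronskian_const_eq hG hK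
  -- Uniqueness needs a nonzero Wronskian, and K is a nonzero multiple of the very value sought.
  -- Hence the value 0 cannot be excluded at this stage.
  have hK0 : K ≠ 0 := by
    rintro rfl
    rw [zero_mul] at hK1
    refine mul_ne_zero (mul_ne_zero (mul_ne_zero (mul_ne_zero (mul_ne_zero (mul_ne_zero
      (mul_ne_zero (neg_ne_zero.2 (qexp_ne_zero _)) hX) ?_) ?_) hG.αγ) qeps_one_ne_zero) h1) h2
      hK1.symm
    · exact sub_ne_zero.2 (one_sub_qexp_ne_of_qtheta hG.γδ' 0 (by simp)).symm
    · exact qeps_ne_zero_of_qtheta' hG.γδ' 1 (by push_cast; ring)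
  -- The equation is symmetric in α and γ, and the exchange keeps the poles, which depend on δ only.
  -- The exchanged solution is explicit both at 1 - δ, which gives κ, and at γ.
  obtain ⟨κ, hκ⟩ := hU.proportional hG (uHat_isSolution (q := q) γ β α δ ν).reverse hK hK0
  have e1 := hκ (1 - δ)
  have e2 := hκ γ
  rw [uHat_self] at e2
  rw [uHat_one_sub, uHat_one_sub, show γ + β + α + δ + ν - 1 = α + β + γ + δ + ν - 1 by ring] at e1
  have k1 : ε (1 + α - δ) ≠ 0 := qeps_ne_of_qtheta hG.αδ' 1 (by push_cast; ring)
  have k2 : ε (1 + β - δ) ≠ 0 := qeps_ne_of_qtheta hG.βδ' 1 (by push_cast; ring)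
  have k3 : ε (1 + γ - δ) ≠ 0 := qeps_ne_of_qtheta hG.γδ' 1 (by push_cast; ring)
  have e3 : θ (γ + δ) = κ * θ (α + δ) := by
    refine mul_left_cancel₀ (mul_ne_zero (mul_ne_zero (mul_ne_zero h1 h2)
      (qeps_one_ne_zero (q := q))) (mul_ne_zero k1 (mul_ne_zero k2 k3))) ?_
    linear_combination e1
  rw [add_comm γ β, add_comm γ α, add_comm β α] at e2
  have hκ0 : κ ≠ 0 := fun h => hG.γδ (by rw [e3, h, zero_mul])
  refine mul_left_cancel₀ hκ0 ?_
  rw [← e2, e3]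
  ring

/-- Both sides are entire in ν. The left one is not zero at ν = 0, hence is zero only countably
often; if the two sides differed anywhere, they would differ off a countable set. Together this
contradicts the alternative in `uHat_third_eq_zero_or`. -/
lemma uHat_third {α β γ δ : ℂ} (hG : AwGeneric q α β γ δ) (ν : ℂ) :
    uHat q α β γ δ ν γ = θ (α + δ) * ε (α + β + ν) * ε (1 - ν - γ - δ)
      * ε (1 + γ - δ) * ε 1 * ε (β + γ) * ε (α + γ) := by
  set Y : ℂ → ℂ := fun ν => θ (α + δ) * ε (α + β + ν) * ε (1 - ν - γ - δ)
      * ε (1 + γ - δ) * ε 1 * ε (β + γ) * ε (α + γ) with hY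
  have dX : Differentiable ℂ fun ν => uHat q α β γ δ ν γ := by fun_prop
  have dY : Differentiable ℂ Y := by fun_prop
  change uHat q α β γ δ ν γ = Y ν
  have h0 : uHat q α β γ δ 0 γ ≠ 0 := by
    rw [uHat_nu_zero]
    refine mul_ne_zero (mul_ne_zero (mul_ne_zero ?_ hG.αδ) (mul_ne_zero ?_ ?_))
      (mul_ne_zero (mul_ne_zero qeps_one_ne_zero ?_) ?_)
    · exact qeps_ne_of_qtheta hG.βγ 0 (by simp)
    · exact qeps_ne_of_qtheta hG.γδ' 1 (by push_cast; ring)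
    · exact qeps_ne_zero_of_qtheta' hG.γδ 1 (by push_cast; ring)
    · exact qeps_ne_of_qtheta hG.αβ 0 (by simp)
    · exact qeps_ne_of_qtheta hG.αγ 0 (by simp)
  by_contra hν
  have e1 := eventually_ne_zero_of_differentiable dX h0
  have e2 := eventually_ne_zero_of_differentiable (dX.sub dY) (z₀ := ν) (sub_ne_zero.2 hν)
  have e3 := eventually_qeps_of_eq (q := q) (k := -1) (by norm_num) 0 (fun ν => -ν)
    (fun s => by ring)
  have e4 := eventually_qeps_of_eq (q := q) (k := 1) (by norm_num) (α + β + γ + δ - 1)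
    (fun ν => α + β + γ + δ + ν - 1) (fun s => by ring)
  obtain ⟨s, h1, h2, h3, h4⟩ := (dense_of_eventually_cocountable
    (e1.and (e2.and (e3.and e4)))).nonempty
  rcases uHat_third_eq_zero_or hG h3 h4 with h | h
  · exact h1 h
  · exact h2 (sub_eq_zero.2 h)

lemma qwron_uHat_of_generic {α β γ δ : ℂ} (hG : AwGeneric q α β γ δ) (ν z : ℂ) :
    qwron q δ γ (fun z => uHat q α β γ δ ν z) (fun z => uHat q α β δ γ ν z) z
      = wronConst q α β γ δ ν * (qskew q z * qgauge q α z * qgauge q β z) := by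
  obtain ⟨K, hK⟩ := IsSolution.exists_qwron_eq hG (uHat_isSolution (q := q) α β γ δ ν)
    (uHat_isSolution (q := q) α β δ γ ν).swap
  have hK1 := wronskian_const_eq hG hK
  rw [hK]
  congr 1
  have k1 : ε (α + γ) ≠ 0 := qeps_ne_of_qtheta hG.αγ 0 (by simp)
  have k2 : ε (β + γ) ≠ 0 := qeps_ne_of_qtheta hG.βγ 0 (by simp)
  refine mul_right_cancel₀ (mul_ne_zero k1 k2) ?_
  rw [hK1, uHat_third hG, wronConst, qeps_eq (γ - δ), show γ - δ + 1 = 1 + γ - δ by ring]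
  ring

/-- The Wronskian of the two solutions, for all parameters. -/
theorem qwron_uHat (α β γ δ ν z : ℂ) :
    qwron q δ γ (fun z => uHat q α β γ δ ν z) (fun z => uHat q α β δ γ ν z) z
      = wronConst q α β γ δ ν * (qskew q z * qgauge q α z * qgauge q β z) := by
  have := eq_of_eventually_cocountable
    (F := fun s => qwron q (δ + 8 * s) (γ + 4 * s)
      (fun z => uHat q (α + s) (β + 2 * s) (γ + 4 * s) (δ + 8 * s) ν z)
      (fun z => uHat q (α + s) (β + 2 * s) (δ + 8 * s) (γ + 4 * s) ν z) z)
    (G := fun s => wronConst q (α + s) (β + 2 * s) (γ + 4 * s) (δ + 8 * s) ν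
      * (qskew q z * qgauge q (α + s) z * qgauge q (β + 2 * s) z))
    ((AwGeneric.eventually (q := q) α β γ δ).mono fun s hs => qwron_uHat_of_generic hs ν z)
    (Differentiable.continuous (by unfold qwron; fun_prop))
    (Differentiable.continuous (by unfold wronConst qgauge; fun_prop)) 0
  simpa only [mul_zero, add_zero] using this

/-! ### The very-well-poised series -/

/-- Both functions solve the equation with the same denominator and the Wronskian constant is
nonzero, so they are proportional. At z = α both reduce to their initial terms, which gives the
factor. -/
lemma uHat_eq_vwpHat_of_generic {α β γ δ ν : ℂ} (hG : AwGeneric q α β γ δ)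
    (ht : ‖𝐞 (β + γ + ν)‖ < 1) (h1 : ε (-ν) ≠ 0) (h2 : ε (α + β + γ + δ + ν - 1) ≠ 0)
    (h3 : ε (α + β + ν) ≠ 0) (h4 : ε (1 - ν - γ - δ) ≠ 0) (h5 : ε (1 - ν - α - δ) ≠ 0) (z : ℂ) :
    uHat q α β γ δ ν z * ε (α - ν - δ)
      = θ (α + δ) * ε (β + γ + ν) * vwpHat q α β γ δ ν z := by
  obtain ⟨κ, hκ⟩ := (uHat_isSolution (q := q) α β γ δ ν).proportional hG
    (vwpHat_isSolution ht) (qwron_uHat α β γ δ ν) (by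
      have k1 : ε (γ - δ) ≠ 0 := qeps_ne_of_qtheta hG.γδ' 0 (by simp)
      have k2 : ε (1 + δ - γ) ≠ 0 := qeps_ne_zero_of_qtheta' hG.γδ' 1 (by push_cast; ring)
      exact mul_ne_zero (mul_ne_zero (mul_ne_zero (mul_ne_zero (mul_ne_zero (mul_ne_zero
        (mul_ne_zero (mul_ne_zero (neg_ne_zero.2 (qexp_ne_zero _)) (mul_ne_zero k1 k2)) hG.αδ)
        hG.αγ) (pow_ne_zero 2 qeps_one_ne_zero)) h1) h2) h3) h4)
  have e := hκ α
  rw [uHat_self, vwpHat_self] at e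
  have k1 : ε (1 + α - δ) ≠ 0 := qeps_ne_of_qtheta hG.αδ' 1 (by push_cast; ring)
  have k2 : ε (α + β) ≠ 0 := qeps_ne_of_qtheta hG.αβ 0 (by simp)
  have k3 : ε (α + γ) ≠ 0 := qeps_ne_of_qtheta hG.αγ 0 (by simp)
  have e' : ε (α - ν - δ) = κ * (ε (β + γ + ν) * θ (α + δ)) := by
    refine mul_left_cancel₀ (mul_ne_zero (mul_ne_zero h5
      (qeps_one_ne_zero (q := q))) (mul_ne_zero k1 (mul_ne_zero k2 k3))) ?_
    linear_combination e
  rw [hκ z, e']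
  ring

/-- The two forms of the solution agree, for all parameters. -/
theorem uHat_eq_vwpHat (α β γ δ ν z : ℂ) (ht : ‖𝐞 (β + γ + ν)‖ < 1) :
    uHat q α β γ δ ν z * ε (α - ν - δ)
      = θ (α + δ) * ε (β + γ + ν) * vwpHat q α β γ δ ν z := by
  -- Now ν moves too, with speed 16, so that the five additional factors also have nonzero slopes.
  -- The convergence condition depends on s, hence the restriction to an open set around 0.
  set U : Set ℂ := {s | ‖𝐞 (β + 2 * s + (γ + 4 * s) + (ν + 16 * s))‖ < 1} with hU
  have hUo : IsOpen U := isOpen_lt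
    (Differentiable.continuous (𝕜 := ℂ) (by fun_prop)).norm continuous_const
  have := eqOn_of_eventually_cocountable (U := U)
    (F := fun s => uHat q (α + s) (β + 2 * s) (γ + 4 * s) (δ + 8 * s) (ν + 16 * s) z
      * ε (α + s - (ν + 16 * s) - (δ + 8 * s)))
    (G := fun s => θ (α + s + (δ + 8 * s)) * ε (β + 2 * s + (γ + 4 * s) + (ν + 16 * s))
      * vwpHat q (α + s) (β + 2 * s) (γ + 4 * s) (δ + 8 * s) (ν + 16 * s) z) hUo
    (by
      filter_upwards [AwGeneric.eventually (q := q) α β γ δ,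
        eventually_qeps_of_eq (q := q) (k := -16) (by norm_num) (-ν) (fun s => -(ν + 16 * s))
          (fun s => by ring),
        eventually_qeps_of_eq (q := q) (k := 31) (by norm_num) (α + β + γ + δ + ν - 1)
          (fun s => α + s + (β + 2 * s) + (γ + 4 * s) + (δ + 8 * s) + (ν + 16 * s) - 1)
          (fun s => by ring),
        eventually_qeps_of_eq (q := q) (k := 19) (by norm_num) (α + β + ν)
          (fun s => α + s + (β + 2 * s) + (ν + 16 * s)) (fun s => by ring),
        eventually_qeps_of_eq (q := q) (k := -28) (by norm_num) (1 - ν - γ - δ)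
          (fun s => 1 - (ν + 16 * s) - (γ + 4 * s) - (δ + 8 * s)) (fun s => by ring),
        eventually_qeps_of_eq (q := q) (k := -25) (by norm_num) (1 - ν - α - δ)
          (fun s => 1 - (ν + 16 * s) - (α + s) - (δ + 8 * s)) (fun s => by ring)]
        with s hs h1 h2 h3 h4 h5 hsU
      exact uHat_eq_vwpHat_of_generic hs hsU h1 h2 h3 h4 h5 z)
    (Differentiable.continuous (𝕜 := ℂ) (by fun_prop)).continuousOn
    (ContinuousOn.mul (Differentiable.continuous (𝕜 := ℂ) (by fun_prop)).continuousOn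
      (differentiableOn_vwpHat (by fun_prop) (by fun_prop) (by fun_prop) (by fun_prop)
        (by fun_prop) (by fun_prop)).continuousOn)
    (show (0 : ℂ) ∈ U by simpa [hU] using ht)
  simpa only [mul_zero, add_zero] using this

end

section

variable [hq : Fact (0 < q ∧ q < 1)]

include hq

/-! ### The difference of a solution -/

/-- The terms of index 0 cancel. In the others, the products of the two z-dependent factors differ
by a multiple of 1 - q^(n+1), which `ε (1 + n)` absorbs after the index is shifted by one. -/
lemma balSeries_sub_shift (α z x₁ x₂ y₁ y₂ y₃ : ℂ) :
    balSeries q x₁ x₂ (α + z) (α - z) y₁ y₂ y₃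
        - balSeries q x₁ x₂ (α + (z - 1)) (α - (z - 1)) y₁ y₂ y₃
      = 𝐞 α * qskew q z * (1 - 𝐞 x₁) * (1 - 𝐞 x₂)
        * balSeries q (x₁ + 1) (x₂ + 1) (α + z) (α + 1 - z) (y₁ + 1) (y₂ + 1) (y₃ + 1) := by
  have h := (hasSum_balSeries (q := q) x₁ x₂ (α + z) (α - z) y₁ y₂ y₃).sub
    (hasSum_balSeries (q := q) x₁ x₂ (α + (z - 1)) (α - (z - 1)) y₁ y₂ y₃)
  have h' := (hasSum_balSeries (q := q) (x₁ + 1) (x₂ + 1) (α + z) (α + 1 - z) (y₁ + 1) (y₂ + 1)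
    (y₃ + 1)).mul_left (𝐞 α * qskew q z * (1 - 𝐞 x₁) * (1 - 𝐞 x₂))
  rw [← hasSum_nat_add_iff' 1] at h
  simp only [Finset.range_one, Finset.sum_singleton, qrho_zero_right, sub_self, sub_zero] at h
  refine h.unique (hasSum_of_eq h' fun n => ?_)
  rw [qrho_succ_left x₁, qrho_succ_left x₂, qrho_succ (α + z), qrho_succ_left (α - z),
    qrho_succ_left (α + (z - 1)), qrho_succ (α - (z - 1)), show α - z + 1 = α + 1 - z by ring,
    show α + (z - 1) + 1 = α + z by ring, show α - (z - 1) = α + 1 - z by ring, qeps_eq (1 + n),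
    pow_succ, qskew]
  push_cast
  rw [show y₁ + 1 + (n : ℂ) = y₁ + (n + 1) by ring, show y₂ + 1 + (n : ℂ) = y₂ + (n + 1) by ring,
    show y₃ + 1 + (n : ℂ) = y₃ + (n + 1) by ring, add_assoc (1 : ℂ) n 1]
  simp only [qexp_add, qexp_sub, qexp_one, qexp_nat]
  have h1 := qexp_ne_zero (q := q) z
  have h2 := q_cast_ne_zero (q := q)
  field_simp
  ring

/-- Termwise, without a shift of the index: the difference produces the factor 1 - q^(1-α-δ+n) (see
`e3`), which turns the lower parameter 2 - α - δ into 1 - α - δ. -/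
lemma balSeries_sub_shift' (α δ z x₁ x₂ y₁ y₂ : ℂ) :
    ε (α + z) * ε (α - z) * balSeries q x₁ x₂ (1 + z - δ) (1 - z - δ) y₁ y₂ (2 - α - δ)
          * (1 - 𝐞 (z - δ))
        - ε (α + (z - 1)) * ε (α - (z - 1))
          * balSeries q x₁ x₂ (1 + (z - 1) - δ) (1 - (z - 1) - δ) y₁ y₂ (2 - α - δ)
          * (1 - 𝐞 (1 - z - δ))
      = 𝐞 (α - 1) * qskew q z * (ε (α + z) * ε (α + 1 - z))
        * balSeries q x₁ x₂ (z - δ) (1 - z - δ) y₁ y₂ (1 - α - δ) := by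
  have h := (((hasSum_balSeries (q := q) x₁ x₂ (1 + z - δ) (1 - z - δ) y₁ y₂ (2 - α - δ)).mul_left
    (ε (α + z) * ε (α - z))).mul_right (1 - 𝐞 (z - δ))).sub
    (((hasSum_balSeries (q := q) x₁ x₂ (1 + (z - 1) - δ) (1 - (z - 1) - δ) y₁ y₂
      (2 - α - δ)).mul_left (ε (α + (z - 1)) * ε (α - (z - 1)))).mul_right (1 - 𝐞 (1 - z - δ)))
  have h' := (hasSum_balSeries (q := q) x₁ x₂ (z - δ) (1 - z - δ) y₁ y₂ (1 - α - δ)).mul_left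
    (𝐞 (α - 1) * qskew q z * (ε (α + z) * ε (α + 1 - z)))
  refine h.unique (hasSum_of_eq h' fun n => ?_)
  have e1 : ρ (1 + z - δ) n * (1 - 𝐞 (z - δ)) = ρ (z - δ) n * (1 - 𝐞 (z - δ + n)) := by
    rw [← qrho_succ, qrho_succ_left, show z - δ + 1 = 1 + z - δ by ring, mul_comm]
  have e2 : ρ (1 - (z - 1) - δ) n * (1 - 𝐞 (1 - z - δ))
      = ρ (1 - z - δ) n * (1 - 𝐞 (1 - z - δ + n)) := by
    rw [← qrho_succ, qrho_succ_left, show 1 - z - δ + 1 = 1 - (z - 1) - δ by ring, mul_comm]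
  have e3 : (1 - 𝐞 (α - z)) * (1 - 𝐞 (z - δ + n)) - (1 - 𝐞 (α + z - 1)) * (1 - 𝐞 (1 - z - δ + n))
      = 𝐞 (α - 1) * qskew q z * (1 - 𝐞 (1 - α - δ + n)) := by
    rw [qskew]
    simp only [qexp_add, qexp_sub, qexp_one, qexp_nat]
    have h1 := qexp_ne_zero (q := q) z
    have h2 := q_cast_ne_zero (q := q)
    have h3 := qexp_ne_zero (q := q) α
    have h4 := qexp_ne_zero (q := q) δ
    field_simp
    ring
  rw [show 1 + (z - 1) - δ = z - δ by ring, show α + (z - 1) = α + z - 1 by ring,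
    show α - (z - 1) = α + 1 - z by ring, qeps_eq (α - z), qeps_eq (α + z - 1),
    qeps_eq (1 - α - δ + n), show α - z + 1 = α + 1 - z by ring, sub_add_cancel,
    show 1 - α - δ + n + 1 = 2 - α - δ + n by ring]
  generalize ε (2 - α - δ + n) = E4
  generalize ε (y₁ + n) = E1
  generalize ε (y₂ + n) = E2
  generalize ε (1 + (n : ℂ)) = E3
  linear_combination (ρ x₁ n * ρ x₂ n * E1 * E2 * E3 * E4 * (q : ℂ) ^ n * ε (α + z) * ε (α + 1 - z))
    * ((1 - 𝐞 (α - z)) * ρ (1 - z - δ) n * e1 - (1 - 𝐞 (α + z - 1)) * ρ (z - δ) n * e2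
      + ρ (z - δ) n * ρ (1 - z - δ) n * e3)

/-- The difference of a solution is a solution with shifted parameters. -/
theorem uHat_sub_shift (α β γ δ ν z : ℂ) :
    uHat q α β γ δ ν z * (1 - 𝐞 (z - δ)) - uHat q α β γ δ ν (z - 1) * (1 - 𝐞 (1 - z - δ))
      = 𝐞 α * qskew q z * (1 - 𝐞 (-ν)) * (1 - 𝐞 (α + β + γ + δ + ν - 1))
        * uHat q (α + 1 / 2) (β + 1 / 2) (γ + 1 / 2) (δ + 1 / 2) (ν - 1) (z - 1 / 2) := by
  have h1 := balSeries_sub_shift (q := q) α z (-ν) (α + β + γ + δ + ν - 1) (α + β) (α + γ) (α + δ)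
  have h2 := balSeries_sub_shift' (q := q) α δ z (1 - ν - α - δ) (β + γ + ν) (1 + β - δ)
    (1 + γ - δ)
  have g1 := qgauge_eq_qden (q := q) δ z
  have g2 := qgauge_eq_qden_sub_one (q := q) δ z
  unfold uHat
  rw [show β + 1 / 2 + (γ + 1 / 2) + (ν - 1) = β + γ + ν by ring,
    show 1 - (ν - 1) - (α + 1 / 2) - (δ + 1 / 2) = 1 - ν - α - δ by ring,
    show 1 + (z - 1 / 2) - (δ + 1 / 2) = z - δ by ring,
    show 1 - (z - 1 / 2) - (δ + 1 / 2) = 1 - z - δ by ring,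
    show -(ν - 1) = -ν + 1 by ring,
    show α + 1 / 2 + (β + 1 / 2) + (γ + 1 / 2) + (δ + 1 / 2) + (ν - 1) - 1
      = α + β + γ + δ + ν - 1 + 1 by ring,
    show α + 1 / 2 + (z - 1 / 2) = α + z by ring, show α + 1 / 2 - (z - 1 / 2) = α + 1 - z by ring,
    show α + 1 / 2 + (β + 1 / 2) = α + β + 1 by ring,
    show α + 1 / 2 + (γ + 1 / 2) = α + γ + 1 by ring,
    show α + 1 / 2 + (δ + 1 / 2) = α + δ + 1 by ring,
    show 1 - (α + 1 / 2) - (δ + 1 / 2) = -α - δ by ring,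
    show 1 + (β + 1 / 2) - (δ + 1 / 2) = 1 + β - δ by ring,
    show 1 + (γ + 1 / 2) - (δ + 1 / 2) = 1 + γ - δ by ring,
    show 2 - (α + 1 / 2) - (δ + 1 / 2) = 1 - α - δ by ring]
  have g3 : qgauge q (-δ) z = ε (z - δ) * ε (1 - z - δ) := by
    rw [qgauge, show -δ + z = z - δ by ring, show -δ + 1 - z = 1 - z - δ by ring]
  rw [g3] at g1 g2
  unfold qden at g1 g2
  have e1 := qeps_eq (q := q) (-ν)
  have e2 := qeps_eq (q := q) (α + β + γ + δ + ν - 1)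
  have e3 : 𝐞 (1 - α - δ) * 𝐞 (α - 1) = 𝐞 α * 𝐞 (-α - δ) := by
    rw [← qexp_add, ← qexp_add]; congr 1; ring
  generalize balSeries q (-ν) (α + β + γ + δ + ν - 1) (α + z) (α - z) (α + β) (α + γ) (α + δ) = B1
    at *
  generalize balSeries q (-ν) (α + β + γ + δ + ν - 1) (α + (z - 1)) (α - (z - 1)) (α + β) (α + γ)
    (α + δ) = B2 at *
  generalize balSeries q (-ν + 1) (α + β + γ + δ + ν - 1 + 1) (α + z) (α + 1 - z) (α + β + 1)
    (α + γ + 1) (α + δ + 1) = B3 at *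
  generalize balSeries q (1 - ν - α - δ) (β + γ + ν) (1 + z - δ) (1 - z - δ) (1 + β - δ)
    (1 + γ - δ) (2 - α - δ) = B4 at *
  generalize balSeries q (1 - ν - α - δ) (β + γ + ν) (1 + (z - 1) - δ) (1 - (z - 1) - δ)
    (1 + β - δ) (1 + γ - δ) (2 - α - δ) = B5 at *
  generalize balSeries q (1 - ν - α - δ) (β + γ + ν) (z - δ) (1 - z - δ) (1 + β - δ) (1 + γ - δ)
    (1 - α - δ) = B6 at *
  rw [e1, e2]
  generalize 1 - 𝐞 (-ν) = X1 at *
  generalize 1 - 𝐞 (α + β + γ + δ + ν - 1) = X2 at *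
  linear_combination ε (β + γ + ν) * ε (1 - ν - α - δ) * (-B1 * g1 + B2 * g2
      + ε (z - δ) * ε (1 - z - δ) * h1)
    - 𝐞 (1 - α - δ) * X1 * X2 * ε (-ν + 1) * ε (α + β + γ + δ + ν - 1 + 1) * h2
    - qskew q z * (ε (α + z) * ε (α + 1 - z)) * B6 * X1 * X2 * ε (-ν + 1)
      * ε (α + β + γ + δ + ν - 1 + 1) * e3

end

section

variable [hq : Fact (0 < q ∧ q < 1)]

include hq

/-! ### The bilinear identity -/

/-- The Wronskian equals f times the difference of g minus g times the difference of f, and both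
differences are given by `uHat_sub_shift`. Three common factors that may vanish are cancelled;
perturbing ν and z makes them nonzero. -/
lemma uHat_bilinear (α β γ δ ν z : ℂ) :
    𝐞 α * (uHat q α β γ δ ν z * (1 - 𝐞 (z - δ))
          * uHat q (α + 1 / 2) (β + 1 / 2) (δ + 1 / 2) (γ + 1 / 2) (ν - 1) (z - 1 / 2)
        - uHat q α β δ γ ν z * (1 - 𝐞 (z - γ))
          * uHat q (α + 1 / 2) (β + 1 / 2) (γ + 1 / 2) (δ + 1 / 2) (ν - 1) (z - 1 / 2))
      = -𝐞 (-γ) * (ε (γ - δ) * ε (1 + δ - γ)) * θ (α + δ) * θ (α + γ) * ε 1 ^ 2 * ε (1 - ν)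
        * ε (α + β + γ + δ + ν) * ε (α + β + ν) * ε (1 - ν - γ - δ)
        * (qgauge q α z * qgauge q β z) := by
  have := eq_of_eventually_cocountable
    (F := fun s => 𝐞 α * (uHat q α β γ δ (ν + s) (z + s) * (1 - 𝐞 (z + s - δ))
          * uHat q (α + 1 / 2) (β + 1 / 2) (δ + 1 / 2) (γ + 1 / 2) (ν + s - 1) (z + s - 1 / 2)
        - uHat q α β δ γ (ν + s) (z + s) * (1 - 𝐞 (z + s - γ))
          * uHat q (α + 1 / 2) (β + 1 / 2) (γ + 1 / 2) (δ + 1 / 2) (ν + s - 1) (z + s - 1 / 2)))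
    (G := fun s => -𝐞 (-γ) * (ε (γ - δ) * ε (1 + δ - γ)) * θ (α + δ) * θ (α + γ) * ε 1 ^ 2
        * ε (1 - (ν + s)) * ε (α + β + γ + δ + (ν + s)) * ε (α + β + (ν + s))
        * ε (1 - (ν + s) - γ - δ) * (qgauge q α (z + s) * qgauge q β (z + s))) ?_
    (Differentiable.continuous (𝕜 := ℂ) (by fun_prop))
    (Differentiable.continuous (𝕜 := ℂ) (by fun_prop)) 0
  · simpa only [add_zero] using this
  filter_upwards [eventually_qexp_ne (q := q) two_ne_zero (2 * z) q,
    eventually_qexp_ne (q := q) (neg_ne_zero.2 one_ne_zero) (-ν) 1,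
    eventually_qexp_ne (q := q) one_ne_zero (α + β + γ + δ + ν - 1) 1] with s h1 h2 h3
  have k1 : qskew q (z + s) ≠ 0 := qskew_ne_zero (by rwa [mul_add])
  have k2 : 1 - 𝐞 (-(ν + s)) ≠ 0 := by
    rw [show -(ν + s) = -ν + -1 * s by ring]; exact sub_ne_zero.2 h2.symm
  have k3 : 1 - 𝐞 (α + β + γ + δ + (ν + s) - 1) ≠ 0 := by
    rw [show α + β + γ + δ + (ν + s) - 1 = α + β + γ + δ + ν - 1 + 1 * s by ring]
    exact sub_ne_zero.2 h3.symm
  have e1 := uHat_sub_shift (q := q) α β γ δ (ν + s) (z + s)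
  have e2 := uHat_sub_shift (q := q) α β δ γ (ν + s) (z + s)
  have e3 := qwron_uHat (q := q) α β γ δ (ν + s) (z + s)
  rw [qwron, wronConst, qeps_eq (-(ν + s)), qeps_eq (α + β + γ + δ + (ν + s) - 1), sub_add_cancel,
    neg_add_eq_sub] at e3
  rw [show α + β + δ + γ + (ν + s) - 1 = α + β + γ + δ + (ν + s) - 1 by ring] at e2
  refine mul_left_cancel₀ (mul_ne_zero k1 (mul_ne_zero k2 k3)) ?_
  linear_combination e3 + uHat q α β δ γ (ν + s) (z + s) * (1 - 𝐞 (z + s - γ)) * e1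
    - uHat q α β γ δ (ν + s) (z + s) * (1 - 𝐞 (z + s - δ)) * e2

/-- `uHat_bilinear` with all four functions replaced through `uHat_eq_vwpHat`. The hypotheses on `θ`
serve to cancel the factor θ(α+γ)θ(α+δ) common to both sides. -/
lemma vwpHat_bilinear_of_generic {α β γ δ ν : ℂ} (z : ℂ) (hc : ‖𝐞 (β + γ + ν)‖ < 1)
    (hd : ‖𝐞 (β + δ + ν)‖ < 1) (h1 : θ (α + γ) ≠ 0) (h2 : θ (α + δ) ≠ 0) :
    ε (β + γ + ν) * ε (β + δ + ν) * (𝐞 (-γ) * (1 - 𝐞 (z - δ)) * (1 - 𝐞 (α - ν - γ))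
          * vwpHat q α β γ δ ν z
          * vwpHat q (α + 1 / 2) (β + 1 / 2) (δ + 1 / 2) (γ + 1 / 2) (ν - 1) (z - 1 / 2)
        - 𝐞 (-δ) * (1 - 𝐞 (z - γ)) * (1 - 𝐞 (α - ν - δ)) * vwpHat q α β δ γ ν z
          * vwpHat q (α + 1 / 2) (β + 1 / 2) (γ + 1 / 2) (δ + 1 / 2) (ν - 1) (z - 1 / 2))
      = 𝐞 (-γ) * (ε (γ - δ) * ε (1 + δ - γ)) * ε 1 ^ 2 * ε (1 - ν)
        * ε (α + β + γ + δ + ν) * ε (α + β + ν) * ε (1 - ν - γ - δ)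
        * (qgauge q α z * qgauge q β z) * (ε (α - ν - δ) * ε (α - ν - γ)) := by
  have hc' : β + 1 / 2 + (γ + 1 / 2) + (ν - 1) = β + γ + ν := by ring
  have hd' : β + 1 / 2 + (δ + 1 / 2) + (ν - 1) = β + δ + ν := by ring
  have e1 := uHat_eq_vwpHat (q := q) α β γ δ ν z hc
  have e2 := uHat_eq_vwpHat (q := q) α β δ γ ν z hd
  have e3 := uHat_eq_vwpHat (q := q) (α + 1 / 2) (β + 1 / 2) (γ + 1 / 2) (δ + 1 / 2) (ν - 1)
    (z - 1 / 2) (by rwa [hc'])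
  have e4 := uHat_eq_vwpHat (q := q) (α + 1 / 2) (β + 1 / 2) (δ + 1 / 2) (γ + 1 / 2) (ν - 1)
    (z - 1 / 2) (by rwa [hd'])
  have e5 := uHat_bilinear (q := q) α β γ δ ν z
  rw [hc', show α + 1 / 2 - (ν - 1) - (δ + 1 / 2) = α - ν - δ + 1 by ring,
    show α + 1 / 2 + (δ + 1 / 2) = α + δ + 1 by ring, qtheta_add_one, ← qexp_neg] at e3
  rw [hd', show α + 1 / 2 - (ν - 1) - (γ + 1 / 2) = α - ν - γ + 1 by ring,
    show α + 1 / 2 + (γ + 1 / 2) = α + γ + 1 by ring, qtheta_add_one, ← qexp_neg] at e4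
  have f1 := qeps_eq (q := q) (α - ν - δ)
  have f2 := qeps_eq (q := q) (α - ν - γ)
  have f3 : 𝐞 α * 𝐞 (-(α + γ)) = 𝐞 (-γ) := by rw [← qexp_add]; congr 1; ring
  have f4 : 𝐞 α * 𝐞 (-(α + δ)) = 𝐞 (-δ) := by rw [← qexp_add]; congr 1; ring
  refine mul_left_cancel₀ (mul_ne_zero h1 h2) ?_
  generalize vwpHat q α β γ δ ν z = G1 at *
  generalize vwpHat q α β δ γ ν z = G2 at *
  generalize vwpHat q (α + 1 / 2) (β + 1 / 2) (γ + 1 / 2) (δ + 1 / 2) (ν - 1) (z - 1 / 2) = G3 at *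
  generalize vwpHat q (α + 1 / 2) (β + 1 / 2) (δ + 1 / 2) (γ + 1 / 2) (ν - 1) (z - 1 / 2) = G4 at *
  generalize uHat q α β γ δ ν z = U1 at *
  generalize uHat q α β δ γ ν z = U2 at *
  generalize uHat q (α + 1 / 2) (β + 1 / 2) (γ + 1 / 2) (δ + 1 / 2) (ν - 1) (z - 1 / 2) = U3 at *
  generalize uHat q (α + 1 / 2) (β + 1 / 2) (δ + 1 / 2) (γ + 1 / 2) (ν - 1) (z - 1 / 2) = U4 at *
  have p1 : U1 * U4 * (ε (α - ν - δ) * ε (α - ν - γ))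
      = (θ (α + δ) * ε (β + γ + ν) * G1) * (-𝐞 (-(α + γ)) * θ (α + γ) * ε (β + δ + ν) * G4)
        * (1 - 𝐞 (α - ν - γ)) := by
    rw [← e1, ← e4, f2]; ring
  have p2 : U2 * U3 * (ε (α - ν - δ) * ε (α - ν - γ))
      = (θ (α + γ) * ε (β + δ + ν) * G2) * (-𝐞 (-(α + δ)) * θ (α + δ) * ε (β + γ + ν) * G3)
        * (1 - 𝐞 (α - ν - δ)) := by
    rw [← e2, ← e3, f1]; ring
  rw [← f3, ← f4]
  rw [← f3] at e5
  linear_combination -(ε (α - ν - δ) * ε (α - ν - γ)) * e5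
    + 𝐞 α * (1 - 𝐞 (z - δ)) * p1 - 𝐞 α * (1 - 𝐞 (z - γ)) * p2

/-- The bilinear identity without denominators. -/
theorem vwpHat_bilinear {α β γ δ ν : ℂ} (z : ℂ) (hc : ‖𝐞 (β + γ + ν)‖ < 1)
    (hd : ‖𝐞 (β + δ + ν)‖ < 1) :
    ε (β + γ + ν) * ε (β + δ + ν) * (𝐞 (-γ) * (1 - 𝐞 (z - δ)) * (1 - 𝐞 (α - ν - γ))
          * vwpHat q α β γ δ ν z
          * vwpHat q (α + 1 / 2) (β + 1 / 2) (δ + 1 / 2) (γ + 1 / 2) (ν - 1) (z - 1 / 2)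
        - 𝐞 (-δ) * (1 - 𝐞 (z - γ)) * (1 - 𝐞 (α - ν - δ)) * vwpHat q α β δ γ ν z
          * vwpHat q (α + 1 / 2) (β + 1 / 2) (γ + 1 / 2) (δ + 1 / 2) (ν - 1) (z - 1 / 2))
      = 𝐞 (-γ) * (ε (γ - δ) * ε (1 + δ - γ)) * ε 1 ^ 2 * ε (1 - ν)
        * ε (α + β + γ + δ + ν) * ε (α + β + ν) * ε (1 - ν - γ - δ)
        * (qgauge q α z * qgauge q β z) * (ε (α - ν - δ) * ε (α - ν - γ)) := by
  have hc' : β + 1 / 2 + (γ + 1 / 2) + (ν - 1) = β + γ + ν := by ring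
  have hd' : β + 1 / 2 + (δ + 1 / 2) + (ν - 1) = β + δ + ν := by ring
  have dG : Differentiable ℂ fun s => 𝐞 (-γ) * (ε (γ - δ) * ε (1 + δ - γ)) * ε 1 ^ 2 * ε (1 - ν)
        * ε (α + s + β + γ + δ + ν) * ε (α + s + β + ν) * ε (1 - ν - γ - δ)
        * (qgauge q (α + s) z * qgauge q β z) * (ε (α + s - ν - δ) * ε (α + s - ν - γ)) := by
    unfold qgauge; fun_prop
  have d3 : Differentiable ℂ fun s => 𝐞 (-γ) * (1 - 𝐞 (z - δ)) * (1 - 𝐞 (α + s - ν - γ)) := by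
    fun_prop
  have d4 : Differentiable ℂ fun s => 𝐞 (-δ) * (1 - 𝐞 (z - γ)) * (1 - 𝐞 (α + s - ν - δ)) := by
    fun_prop
  have d1 : ∀ β γ δ ν z : ℂ, ‖𝐞 (β + γ + ν)‖ < 1 →
      Differentiable ℂ fun s => vwpHat q (α + s) β γ δ ν z := fun β γ δ ν z h => by
    have := differentiableOn_vwpHat (q := q) (differentiable_const (c := α) |>.add differentiable_id)
      (differentiable_const β)
      (differentiable_const γ) (differentiable_const δ) (differentiable_const ν)
      (differentiable_const z)
    simpa [h, differentiableOn_univ] using this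
  have d2 : ∀ β γ δ ν z : ℂ, ‖𝐞 (β + γ + ν)‖ < 1 →
      Differentiable ℂ fun s => vwpHat q (α + s + 1 / 2) β γ δ ν z := fun β γ δ ν z h => by
    have := differentiableOn_vwpHat (q := q)
      ((differentiable_const (c := α) |>.add differentiable_id).add_const (1 / 2))
      (differentiable_const β)
      (differentiable_const γ) (differentiable_const δ) (differentiable_const ν)
      (differentiable_const z)
    simpa [h, differentiableOn_univ] using this
  have k1 := d1 β γ δ ν z hc
  have k2 := d1 β δ γ ν z hd
  have k3 := d2 _ _ (δ + 1 / 2) _ (z - 1 / 2) (hc'.symm ▸ hc)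
  have k4 := d2 _ _ (γ + 1 / 2) _ (z - 1 / 2) (hd'.symm ▸ hd)
  have dF := (((d3.mul k1).mul k4).sub ((d4.mul k2).mul k3)).const_mul
    (ε (β + γ + ν) * ε (β + δ + ν))
  have := eq_of_eventually_cocountable
    (F := fun s => ε (β + γ + ν) * ε (β + δ + ν) * (𝐞 (-γ) * (1 - 𝐞 (z - δ))
          * (1 - 𝐞 (α + s - ν - γ)) * vwpHat q (α + s) β γ δ ν z
          * vwpHat q (α + s + 1 / 2) (β + 1 / 2) (δ + 1 / 2) (γ + 1 / 2) (ν - 1) (z - 1 / 2)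
        - 𝐞 (-δ) * (1 - 𝐞 (z - γ)) * (1 - 𝐞 (α + s - ν - δ)) * vwpHat q (α + s) β δ γ ν z
          * vwpHat q (α + s + 1 / 2) (β + 1 / 2) (γ + 1 / 2) (δ + 1 / 2) (ν - 1) (z - 1 / 2)))
    (G := fun s => 𝐞 (-γ) * (ε (γ - δ) * ε (1 + δ - γ)) * ε 1 ^ 2 * ε (1 - ν)
        * ε (α + s + β + γ + δ + ν) * ε (α + s + β + ν) * ε (1 - ν - γ - δ)
        * (qgauge q (α + s) z * qgauge q β z) * (ε (α + s - ν - δ) * ε (α + s - ν - γ))) ?_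
    dF.continuous dG.continuous 0
  · simpa only [add_zero] using this
  -- Moving α alone is enough, and the convergence conditions do not involve α.
  filter_upwards [eventually_qtheta_ne_zero (q := q) one_ne_zero (α + γ),
    eventually_qtheta_ne_zero (q := q) one_ne_zero (α + δ)] with s h1 h2
  rw [one_mul, add_right_comm] at h1 h2
  have := vwpHat_bilinear_of_generic (α := α + s) z hc hd h1 h2
  exact this

end

section

variable [hq : Fact (0 < q ∧ q < 1)]

include hq

/-! ### Translation to exponents -/

lemma regular_iff {t x : ℂ} (h : t = 𝐞 x) : Regular q t ↔ ε x ≠ 0 := by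
  rw [h, qeps_ne_zero_iff]

omit hq in
lemma qPochInf_eq_qeps {t : ℂ} (x : ℂ) (h : t = 𝐞 x) : qPochInf q t = ε x := by
  rw [h, qPochInf_qexp]

lemma inDomain_iff {δ z : ℂ} :
    InDomain q (𝐞 δ) z ↔ ε (1 + z - δ) ≠ 0 ∧ ε (1 - z - δ) ≠ 0 := by
  rw [InDomain, regular_iff (x := 1 + z - δ) (by rw [cpow_eq_qexp, qexp_sub]),
    regular_iff (x := 1 - z - δ) (by rw [cpow_eq_qexp, qexp_sub _ δ])]

lemma nonzeroAt_iff {η z : ℂ} :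
    NonzeroAt q (𝐞 η) z ↔ ε (η + z) ≠ 0 ∧ ε (η + 1 - z) ≠ 0 := by
  rw [NonzeroAt, regular_iff (x := η + z) (by rw [cpow_eq_qexp, qexp_add]),
    regular_iff (x := η + 1 - z) (by rw [cpow_eq_qexp, add_sub_assoc, qexp_add])]

lemma nonzeroAt_one_div_iff {δ z : ℂ} :
    NonzeroAt q (1 / 𝐞 δ) z ↔ ε (z - δ) ≠ 0 ∧ ε (1 - z - δ) ≠ 0 := by
  rw [one_div, ← qexp_neg, nonzeroAt_iff, neg_add_eq_sub, show -δ + 1 - z = 1 - z - δ by ring]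

lemma inDomain_of_nonzeroAt {δ z : ℂ} (h : NonzeroAt q (1 / 𝐞 δ) z) :
    InDomain q (𝐞 δ) z ∧ InDomain q (𝐞 δ) (z - 1) := by
  rw [nonzeroAt_one_div_iff] at h
  rw [inDomain_iff, inDomain_iff, show 1 + (z - 1) - δ = z - δ by ring,
    show 1 + z - δ = z - δ + (1 : ℕ) by push_cast; ring,
    show 1 - (z - 1) - δ = 1 - z - δ + (1 : ℕ) by push_cast; ring]
  exact ⟨⟨qeps_add_ne_zero h.1 1, h.2⟩, h.1, qeps_add_ne_zero h.2 1⟩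

/-- The factor between `u` and `uHat / qden`. -/
lemma Generic.norm_ne_zero {α β γ δ : ℂ} (h : Generic q (𝐞 α) (𝐞 β) (𝐞 γ) (𝐞 δ)) :
    ε (α + β) ≠ 0 ∧ ε (α + γ) ≠ 0 ∧ ε (β + γ) ≠ 0 ∧ θ (α + δ) ≠ 0 := by
  refine ⟨(regular_iff (qexp_add _ _).symm).1 h.ab, (regular_iff (qexp_add _ _).symm).1 h.ac,
    (regular_iff (qexp_add _ _).symm).1 h.bc, ?_⟩
  rw [qtheta_ne_zero_iff']
  intro n
  rw [qexp_add]
  exact h.ad n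

lemma Generic.u_eq {α β γ δ ν z : ℂ} (h : Generic q (𝐞 α) (𝐞 β) (𝐞 γ) (𝐞 δ))
    (hz : InDomain q (𝐞 δ) z) :
    u q ν (𝐞 α) (𝐞 β) (𝐞 γ) (𝐞 δ) z = uHat q α β γ δ ν z / qden q δ z
      / (ε (α + β) * ε (α + γ) * ε (β + γ) * ε 1 * θ (α + δ)) := by
  obtain ⟨h1, h2, h3, h4⟩ := h.norm_ne_zero
  rw [inDomain_iff] at hz
  have h5 : ε (1 + β - δ) ≠ 0 :=
    (regular_iff (by rw [qexp_sub, qexp_add, qexp_one])).1 h.bd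
  have h6 : ε (1 + γ - δ) ≠ 0 :=
    (regular_iff (by rw [qexp_sub, qexp_add, qexp_one])).1 h.cd
  exact u_eq_uHat h1 h2 h3 h4 h5 h6 hz.1 hz.2

/-! ### The very-well-poised form -/

theorem u_eq_uSeries {α β γ δ ν z : ℂ} (h : Generic q (𝐞 α) (𝐞 β) (𝐞 γ) (𝐞 δ))
    (ht : ‖𝐞 β * 𝐞 γ * (q : ℂ) ^ ν‖ < 1) (h1 : Regular q (𝐞 α * (q : ℂ) ^ (-ν) / 𝐞 δ))
    (h2 : Regular q ((q : ℂ) * 𝐞 α / 𝐞 δ)) (h3 : Regular q ((q : ℂ) ^ (1 - ν + z) / 𝐞 δ))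
    (h4 : Regular q ((q : ℂ) ^ (1 - ν - z) / 𝐞 δ)) (hz : InDomain q (𝐞 δ) z) :
    u q ν (𝐞 α) (𝐞 β) (𝐞 γ) (𝐞 δ) z = uSeries q ν (𝐞 α) (𝐞 β) (𝐞 γ) (𝐞 δ) z := by
  have c1 : 𝐞 α * (q : ℂ) ^ (-ν) / 𝐞 δ = 𝐞 (α - ν - δ) := by
    rw [cpow_eq_qexp, sub_eq_add_neg α, qexp_sub, qexp_add]
  have c2 : (q : ℂ) * 𝐞 α / 𝐞 δ = 𝐞 (1 + α - δ) := by rw [qexp_sub, qexp_add, qexp_one]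
  have c3 : (q : ℂ) ^ (1 - ν + z) / 𝐞 δ = 𝐞 (1 - ν + z - δ) := by rw [cpow_eq_qexp, ← qexp_sub]
  have c4 : (q : ℂ) ^ (1 - ν - z) / 𝐞 δ = 𝐞 (1 - ν - z - δ) := by rw [cpow_eq_qexp, ← qexp_sub]
  have c5 : 𝐞 β * 𝐞 γ * (q : ℂ) ^ ν = 𝐞 (β + γ + ν) := by rw [cpow_eq_qexp, qexp_add, qexp_add]
  have c6 : (q : ℂ) ^ (1 + z) / 𝐞 δ = 𝐞 (1 + z - δ) := by rw [cpow_eq_qexp, ← qexp_sub]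
  have c7 : (q : ℂ) ^ (1 - z) / 𝐞 δ = 𝐞 (1 - z - δ) := by rw [cpow_eq_qexp, ← qexp_sub]
  have c8 : (q : ℂ) ^ (1 - ν) * 𝐞 α / 𝐞 δ = 𝐞 (1 - ν + α - δ) := by
    rw [cpow_eq_qexp, qexp_sub _ δ, qexp_add]
  obtain ⟨n1, n2, n3, n4⟩ := h.norm_ne_zero
  rw [Generic.u_eq h hz, uSeries]
  rw [inDomain_iff] at hz
  rw [regular_iff c1] at h1
  rw [regular_iff c2] at h2
  rw [regular_iff c3] at h3
  rw [regular_iff c4] at h4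
  rw [c5] at ht
  have key := uHat_eq_vwpHat α β γ δ ν z ht
  rw [basicHyp_eq_vwpHat (α := α) (β := β) (γ := γ) (δ := δ) (ν := ν) (z := z) c1
    (cpow_eq_qexp _) (by rw [cpow_eq_qexp, ← qexp_add, ← qexp_sub]; congr 1; ring)
    (by rw [cpow_eq_qexp, ← qexp_add, ← qexp_sub]; congr 1; ring)
    (by rw [cpow_eq_qexp, qexp_add]) (by rw [cpow_eq_qexp, sub_eq_add_neg, qexp_add])
    (by rw [mul_comm, c2]) (qexp_add _ _).symm (qexp_add _ _).symm (Or.inr ⟨c3, c4⟩) c5 h1 h2 n1 n2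
    h3 h4, c1, c3, c4, c5, c6, c7, c8, c2, ← qexp_add]
  simp only [qPochsInf_cons, qPochsInf_nil, qPochInf_qexp, mul_one]
  have e := qeps_eq (q := q) (α - ν - δ)
  rw [show α - ν - δ + 1 = 1 - ν + α - δ by ring] at e
  have m1 : 1 - 𝐞 (α - ν - δ) ≠ 0 := left_ne_zero_of_mul (e ▸ h1)
  have m2 : ε (1 - ν + α - δ) ≠ 0 := right_ne_zero_of_mul (e ▸ h1)
  have m3 := qeps_one_ne_zero (q := q)
  obtain ⟨z1, z2⟩ := hz
  rw [e] at key
  rw [qden]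
  have key' : uHat q α β γ δ ν z = θ (α + δ) * ε (β + γ + ν) * vwpHat q α β γ δ ν z
      / ((1 - 𝐞 (α - ν - δ)) * ε (1 - ν + α - δ)) := by
    rw [eq_div_iff (mul_ne_zero m1 m2), key]
  rw [key']
  field_simp

/-! ### The bilinear identity in terms of very-well-poised series -/

/-- The first series of the term comes from the difference of v: all exponents are raised by 1/2, γ
and δ are exchanged, and ν and z become ν - 1 and z - 1/2. The halves cancel in every parameter of
the series. -/
lemma bilinearTerm_eq {α β γ δ ν z : ℂ} (hαβ : ε (α + β) ≠ 0) (hαγ : ε (α + γ) ≠ 0)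
    (hαδ : ε (α + δ) ≠ 0) (h1 : ε (1 + α - γ) ≠ 0) (h2 : ε (1 + α - δ) ≠ 0)
    (h3 : ε (α - ν - γ) ≠ 0) (h4 : ε (α - ν - δ) ≠ 0) (h5 : ε (1 - ν + z - γ) ≠ 0)
    (h6 : ε (1 - ν - z - γ) ≠ 0) (h7 : ε (1 - ν + z - δ) ≠ 0) (h8 : ε (1 - ν - z - δ) ≠ 0)
    (hγ : ε (z - γ) ≠ 0 ∧ ε (1 - z - γ) ≠ 0) (hδ : ε (z - δ) ≠ 0 ∧ ε (1 - z - δ) ≠ 0) :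
    bilinearTerm q ν (𝐞 α) (𝐞 β) (𝐞 γ) (𝐞 δ) z
      = 𝐞 δ * (1 - 𝐞 (z - δ)) * (1 - 𝐞 (α - ν - γ)) * vwpHat q α β γ δ ν z
          * vwpHat q (α + 1 / 2) (β + 1 / 2) (δ + 1 / 2) (γ + 1 / 2) (ν - 1) (z - 1 / 2)
        / (ε (α - ν - δ) * ε (α - ν - γ) * ε 1 ^ 2 * ε (1 + α - δ) * ε (1 + α - γ) * ε (α + β)
          * ε (α + β + 1) * (ε (z - γ) * ε (1 - z - γ) * (ε (z - δ) * ε (1 - z - δ)))) := by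
  have c1 : (q : ℂ) ^ (1 - ν) * 𝐞 α / 𝐞 γ = 𝐞 (1 - ν + α - γ) := by
    rw [cpow_eq_qexp, qexp_sub _ γ, qexp_add]
  have c2 : (q : ℂ) ^ (-ν) * 𝐞 α / 𝐞 δ = 𝐞 (α - ν - δ) := by
    rw [cpow_eq_qexp, mul_comm, sub_eq_add_neg α, qexp_sub, qexp_add]
  have a1 : ε (α + β + 1) ≠ 0 := by exact_mod_cast qeps_add_ne_zero hαβ 1
  have a2 : ε (α + δ + 1) ≠ 0 := by exact_mod_cast qeps_add_ne_zero hαδ 1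
  have a3 : ε (1 - ν + α - γ) ≠ 0 := by
    have := qeps_add_ne_zero h3 1
    rwa [show α - ν - γ + (1 : ℕ) = 1 - ν + α - γ by push_cast; ring] at this
  have a4 : ε (2 - ν - z - γ) ≠ 0 := by
    have := qeps_add_ne_zero h6 1
    rwa [show 1 - ν - z - γ + (1 : ℕ) = 2 - ν - z - γ by push_cast; ring] at this
  have w1 : veryWellPoised q ((q : ℂ) ^ (-ν) * 𝐞 α / 𝐞 δ)
        [(q : ℂ) ^ (-ν), (q : ℂ) ^ (1 - ν) / (𝐞 β * 𝐞 δ), (q : ℂ) ^ (1 - ν) / (𝐞 γ * 𝐞 δ),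
          𝐞 α * (q : ℂ) ^ z, 𝐞 α * (q : ℂ) ^ (-z)] (𝐞 β * 𝐞 γ * (q : ℂ) ^ ν)
      = vwpHat q α β γ δ ν z / ((1 - 𝐞 (α - ν - δ)) * ε 1 * ε (1 + α - δ) * ε (α + β) * ε (α + γ)
        * ε (1 - ν + z - δ) * ε (1 - ν - z - δ)) := by
    rw [← c2]
    simp only [cpow_eq_qexp]
    have k := qexp_ne_zero (q := q)
    refine basicHyp_eq_vwpHat (c2 ▸ by rw [cpow_eq_qexp]) rfl ?_ ?_ ?_ ?_ ?_ ?_ ?_ (Or.inl ⟨?_, ?_⟩)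
      ?_ h4 h2 hαβ hαγ h7 h8
    all_goals try simp only [← qexp_add, ← qexp_sub, ← qexp_one]
    all_goals congr 1 <;> ring
  have w2 : veryWellPoised q ((q : ℂ) ^ (1 - ν) * 𝐞 α / 𝐞 γ)
        [(q : ℂ) ^ (1 - ν), (q : ℂ) ^ (1 - ν) / (𝐞 β * 𝐞 γ), (q : ℂ) ^ (1 - ν) / (𝐞 γ * 𝐞 δ),
          𝐞 α * (q : ℂ) ^ z, 𝐞 α * (q : ℂ) ^ (1 - z)] (𝐞 β * 𝐞 δ * (q : ℂ) ^ ν)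
      = vwpHat q (α + 1 / 2) (β + 1 / 2) (δ + 1 / 2) (γ + 1 / 2) (ν - 1) (z - 1 / 2)
        / ((1 - 𝐞 (1 - ν + α - γ)) * ε 1 * ε (1 + α - γ) * ε (α + β + 1) * ε (α + δ + 1)
        * ε (1 - ν + z - γ) * ε (2 - ν - z - γ)) := by
    have s1 : α + 1 / 2 - (ν - 1) - (γ + 1 / 2) = 1 - ν + α - γ := by ring
    have s2 : 1 + (α + 1 / 2) - (γ + 1 / 2) = 1 + α - γ := by ring
    have s3 : α + 1 / 2 + (β + 1 / 2) = α + β + 1 := by ring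
    have s4 : α + 1 / 2 + (δ + 1 / 2) = α + δ + 1 := by ring
    have s5 : 1 - (ν - 1) + (z - 1 / 2) - (γ + 1 / 2) = 1 - ν + z - γ := by ring
    have s6 : 1 - (ν - 1) - (z - 1 / 2) - (γ + 1 / 2) = 2 - ν - z - γ := by ring
    rw [← s1, ← s2, ← s3, ← s4, ← s5, ← s6, s1, ← c1]
    simp only [cpow_eq_qexp]
    refine basicHyp_eq_vwpHat (by rw [s1, ← c1, cpow_eq_qexp]) ?_ ?_ ?_ ?_ ?_ ?_ ?_ ?_
      (Or.inl ⟨?_, ?_⟩) ?_ (s1 ▸ a3) (s2 ▸ h1) (s3 ▸ a1) (s4 ▸ a2) (s5 ▸ h5) (s6 ▸ a4)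
    all_goals try simp only [← qexp_add, ← qexp_sub, ← qexp_one]
    all_goals
      congr 1
      ring
  rw [bilinearTerm, w1, w2]
  generalize vwpHat q α β γ δ ν z = G1
  generalize vwpHat q (α + 1 / 2) (β + 1 / 2) (δ + 1 / 2) (γ + 1 / 2) (ν - 1) (z - 1 / 2) = G2
  simp only [qPochsInf_cons, qPochsInf_nil, mul_one]
  rw [qPochInf_eq_qeps (α + γ) (qexp_add _ _).symm,
    qPochInf_eq_qeps (α + δ + 1) (by rw [qexp_add, qexp_add, qexp_one]),
    qPochInf_eq_qeps (2 - ν + α - γ) (by rw [cpow_eq_qexp, ← qexp_add, ← qexp_sub]),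
    qPochInf_eq_qeps (1 - ν + α - δ) (by rw [cpow_eq_qexp, ← qexp_add, ← qexp_sub]),
    qPochInf_eq_qeps (1 - ν + z - γ) (by rw [cpow_eq_qexp, ← qexp_sub]),
    qPochInf_eq_qeps (2 - ν - z - γ) (by rw [cpow_eq_qexp, ← qexp_sub]),
    qPochInf_eq_qeps (1 - ν + z - δ) (by rw [cpow_eq_qexp, ← qexp_sub]),
    qPochInf_eq_qeps (1 - ν - z - δ) (by rw [cpow_eq_qexp, ← qexp_sub]),
    qPochInf_eq_qeps (z - γ) (by rw [cpow_eq_qexp, ← qexp_sub]),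
    qPochInf_eq_qeps (1 - z - γ) (by rw [cpow_eq_qexp, ← qexp_sub]),
    qPochInf_eq_qeps (1 + z - δ) (by rw [cpow_eq_qexp, ← qexp_sub]),
    qPochInf_eq_qeps (1 - z - δ) (by rw [cpow_eq_qexp, ← qexp_sub])]
  have e1 := qeps_eq (q := q) (α - ν - δ)
  have e2 := qeps_eq (q := q) (α - ν - γ)
  have e3 := qeps_eq (q := q) (1 - ν + α - γ)
  have e4 := qeps_eq (q := q) (z - δ)
  rw [show α - ν - δ + 1 = 1 - ν + α - δ by ring] at e1
  rw [show α - ν - γ + 1 = 1 - ν + α - γ by ring] at e2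
  rw [show 1 - ν + α - γ + 1 = 2 - ν + α - γ by ring] at e3
  rw [show z - δ + 1 = 1 + z - δ by ring] at e4
  have m1 := left_ne_zero_of_mul (e1 ▸ h4)
  have m2 := right_ne_zero_of_mul (e1 ▸ h4)
  have m3 := left_ne_zero_of_mul (e2 ▸ h3)
  have m4 := left_ne_zero_of_mul (e3 ▸ a3)
  have m5 := right_ne_zero_of_mul (e3 ▸ a3)
  have m6 := left_ne_zero_of_mul (e4 ▸ hδ.1)
  have m7 := right_ne_zero_of_mul (e4 ▸ hδ.1)
  have m8 := qeps_one_ne_zero (q := q)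
  obtain ⟨g1, g2⟩ := hγ
  obtain ⟨-, g4⟩ := hδ
  rw [e1, e2, e3, e4]
  clear e1 e2 e3 e4
  field_simp

theorem bilinearTerm_sub {α β γ δ ν z : ℂ} (hc : ‖𝐞 (β + γ + ν)‖ < 1)
    (hd : ‖𝐞 (β + δ + ν)‖ < 1) (hαβ : ε (α + β) ≠ 0) (hαγ : ε (α + γ) ≠ 0)
    (hαδ : ε (α + δ) ≠ 0) (h1 : ε (1 + α - γ) ≠ 0) (h2 : ε (1 + α - δ) ≠ 0)
    (h3 : ε (α - ν - γ) ≠ 0) (h4 : ε (α - ν - δ) ≠ 0) (h5 : ε (1 - ν + z - γ) ≠ 0)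
    (h6 : ε (1 - ν - z - γ) ≠ 0) (h7 : ε (1 - ν + z - δ) ≠ 0) (h8 : ε (1 - ν - z - δ) ≠ 0)
    (hγ : ε (z - γ) ≠ 0 ∧ ε (1 - z - γ) ≠ 0) (hδ : ε (z - δ) ≠ 0 ∧ ε (1 - z - δ) ≠ 0) :
    bilinearTerm q ν (𝐞 α) (𝐞 β) (𝐞 γ) (𝐞 δ) z - bilinearTerm q ν (𝐞 α) (𝐞 β) (𝐞 δ) (𝐞 γ) z
      = 𝐞 δ * (ε (γ - δ) * ε (1 + δ - γ) * ε (1 - ν) * ε (α + β + γ + δ + ν) * ε (α + β + ν)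
          * ε (1 - ν - γ - δ))
        / (ε (α + β) * ε (α + β + 1) * ε (1 + α - γ) * ε (1 + α - δ) * ε (β + γ + ν)
          * ε (β + δ + ν))
        * (qgauge q α z * qgauge q β z
          / (ε (z - γ) * ε (1 - z - γ) * (ε (z - δ) * ε (1 - z - δ)))) := by
  have key := vwpHat_bilinear (α := α) z hc hd
  rw [bilinearTerm_eq hαβ hαγ hαδ h1 h2 h3 h4 h5 h6 h7 h8 hγ hδ,
    bilinearTerm_eq hαβ hαδ hαγ h2 h1 h4 h3 h7 h8 h5 h6 hδ hγ]
  -- Convergence already implies that (bcq^ν, bdq^ν; q)_∞ is nonzero, so no separate hypothesis is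
  -- needed.
  have reg : ∀ w, ‖𝐞 w‖ < 1 → ε w ≠ 0 := fun w hw => by
    rw [qeps_ne_zero_iff']
    intro n hn
    rw [qexp_add, qexp_nat] at hn
    have := congrArg norm hn
    rw [norm_mul, norm_pow, norm_q, norm_one] at this
    exact absurd this ((mul_le_of_le_one_right (norm_nonneg _)
      (pow_le_one₀ q_pos.le q_lt_one.le)).trans_lt hw).ne
  have r1 := reg _ hc
  have r2 := reg _ hd
  have a1 : ε (α + β + 1) ≠ 0 := by exact_mod_cast qeps_add_ne_zero hαβ 1
  have m8 := qeps_one_ne_zero (q := q)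
  have kγ := qexp_ne_zero (q := q) γ
  have kδ := qexp_ne_zero (q := q) δ
  rw [qexp_neg, qexp_neg] at key
  obtain ⟨g1, g2⟩ := hγ
  obtain ⟨g3, g4⟩ := hδ
  generalize vwpHat q α β γ δ ν z = G1 at *
  generalize vwpHat q α β δ γ ν z = G2 at *
  generalize vwpHat q (α + 1 / 2) (β + 1 / 2) (γ + 1 / 2) (δ + 1 / 2) (ν - 1) (z - 1 / 2) = G3 at *
  generalize vwpHat q (α + 1 / 2) (β + 1 / 2) (δ + 1 / 2) (γ + 1 / 2) (ν - 1) (z - 1 / 2) = G4 at *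
  generalize qgauge q α z * qgauge q β z = g at *
  generalize 1 - 𝐞 (z - δ) = x1 at *
  generalize 1 - 𝐞 (α - ν - γ) = x2 at *
  generalize 1 - 𝐞 (z - γ) = x3 at *
  generalize 1 - 𝐞 (α - ν - δ) = x4 at *
  field_simp at key
  field_simp
  linear_combination key

end

section

variable [hq : Fact (0 < q ∧ q < 1)]

include hq

/-! ### The difference equation -/

/-- The equation extends by continuity from almost all points to the open set where everything is
defined. The two conditions on `ε` make the denominator nonzero at z - 1, z and z + 1
simultaneously. -/
lemma IsSolution.awOp_eq_zero {α β γ δ ν d z : ℂ} {f : ℂ → ℂ} (h : IsSolution q α β γ δ ν d f)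
    (hz : AwRegular q z) (h1 : ε (z - d) ≠ 0) (h2 : ε (-z - d) ≠ 0) :
    awOp q α β γ δ ν (fun w => f w / qden q d w) z = 0 := by
  set U : Set ℂ := {z | AwRegular q z ∧ ε (z - d) ≠ 0 ∧ ε (-z - d) ≠ 0} with hU
  have hUo : IsOpen U := by
    have k1 : Continuous fun z => 𝐞 (2 * z) := Differentiable.continuous (𝕜 := ℂ) (by fun_prop)
    have k2 : Continuous fun z => ε (z - d) := Differentiable.continuous (𝕜 := ℂ) (by fun_prop)
    have k3 : Continuous fun z => ε (-z - d) := Differentiable.continuous (𝕜 := ℂ) (by fun_prop)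
    exact ((isOpen_ne_fun k1 continuous_const).inter ((isOpen_ne_fun k1 continuous_const).inter
      (isOpen_ne_fun (k1.mul continuous_const) continuous_const))).inter
      ((isOpen_ne_fun k2 continuous_const).inter (isOpen_ne_fun k3 continuous_const))
  have sh : ∀ w : ℂ, ε w ≠ 0 → ε (w + 1) ≠ 0 := fun w hw => by
    exact_mod_cast qeps_add_ne_zero hw 1
  refine eqOn_of_eventually_cocountable (G := fun _ => 0) hUo (h.solves.mono fun s hs _ => hs) ?_
    continuousOn_const (show z ∈ U from ⟨hz, h1, h2⟩)
  have hf := h.differentiable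
  have hcoe : ∀ p : ℂ, Continuous fun z => 𝐞 (p + z) := fun p =>
    Differentiable.continuous (𝕜 := ℂ) (by fun_prop)
  have A1 : ContinuousOn (fun z => awCoeff q α β γ δ z) U := by
    unfold awCoeff
    refine ContinuousOn.div (Differentiable.continuous (𝕜 := ℂ) (by fun_prop)).continuousOn
      (Differentiable.continuous (𝕜 := ℂ) (by fun_prop)).continuousOn fun w hw => ?_
    refine mul_ne_zero (sub_ne_zero.2 hw.1.1.symm) (sub_ne_zero.2 ?_)
    rw [qexp_add, qexp_one]
    exact hw.1.2.2.symm
  have A2 : ContinuousOn (fun z => awCoeff q α β γ δ (-z)) U := by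
    unfold awCoeff
    refine ContinuousOn.div (Differentiable.continuous (𝕜 := ℂ) (by fun_prop)).continuousOn
      (Differentiable.continuous (𝕜 := ℂ) (by fun_prop)).continuousOn fun w hw => ?_
    have hy := qexp_ne_zero (q := q) (2 * w)
    rw [mul_neg, qexp_add, qexp_one, qexp_neg]
    refine mul_ne_zero (sub_ne_zero.2 fun h => hw.1.1 ?_) (sub_ne_zero.2 fun h => hw.1.2.1 ?_)
    · rw [← inv_inv (𝐞 (2 * w)), ← h, inv_one]
    · field_simp at h
      exact h
  have F : ∀ k : ℂ, (∀ w ∈ U, qden q d (w + k) ≠ 0) →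
      ContinuousOn (fun z => f (z + k) / qden q d (z + k)) U := fun k hk => by
    refine ContinuousOn.div (Differentiable.continuous (𝕜 := ℂ) (by fun_prop)).continuousOn
      (Differentiable.continuous (𝕜 := ℂ) (by unfold qden; fun_prop)).continuousOn hk
  have F0 := F 0 fun w hw => by
    rw [add_zero, qden, show 1 + w - d = w - d + 1 by ring, show 1 - w - d = -w - d + 1 by ring]
    exact mul_ne_zero (sh _ hw.2.1) (sh _ hw.2.2)
  have F1 := F 1 fun w hw => by
    rw [qden, show 1 + (w + 1) - d = w - d + 1 + 1 by ring, show 1 - (w + 1) - d = -w - d by ring]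
    exact mul_ne_zero (sh _ (sh _ hw.2.1)) hw.2.2
  have F2 := F (-1) fun w hw => by
    rw [qden, show 1 + (w + -1) - d = w - d by ring, show 1 - (w + -1) - d = -w - d + 1 + 1 by ring]
    exact mul_ne_zero hw.2.1 (sh _ (sh _ hw.2.2))
  simp only [add_zero, ← sub_eq_add_neg] at F0 F2
  unfold awOp
  exact ((A1.mul (F1.sub F0)).add (A2.mul (F2.sub F0))).sub (F0.const_mul _)

omit hq in
/-- The rational identity that relates the two forms of the difference equation. -/
lemma difference_equation_rational {a b c d y p w fp f0 fm : ℂ} (hp : p ≠ 0) (hy : y ≠ 0)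
    (hw : w ≠ 0) (hp1 : p ^ 2 ≠ 1) (h1 : y ^ 2 ≠ 1) (h2 : y ^ 2 ≠ p ^ 2)
    (h3 : y ^ 2 * p ^ 2 ≠ 1) :
    (y ^ 2)⁻¹ * (y - a) * (y - b) * (y - c) * (y - d)
        * (((fp - f0) / ((y * p ^ 2 + (y * p ^ 2)⁻¹) / 2 - (y + y⁻¹) / 2)
          - (f0 - fm) / ((y + y⁻¹) / 2 - (y / p ^ 2 + (y / p ^ 2)⁻¹) / 2))
          / ((y * p + (y * p)⁻¹) / 2 - (y / p + (y / p)⁻¹) / 2))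
      + 2 * p / (1 - p ^ 2) * (a * b * c + a * b * d + a * c * d + b * c * d - a - b - c - d
          + 2 * (1 - a * b * c * d) * ((y + y⁻¹) / 2))
        * ((fp - f0) / ((y * p ^ 2 + (y * p ^ 2)⁻¹) / 2 - (y + y⁻¹) / 2))
      + 4 * (p ^ 2 * p) / (1 - p ^ 2) ^ 2 * (1 - w⁻¹) * (1 - a * b * c * d * (w / p ^ 2)) * f0
    = 4 * (p ^ 2 * p) / (1 - p ^ 2) ^ 2
      * ((1 - a * y) * (1 - b * y) * (1 - c * y) * (1 - d * y)
          / ((1 - y ^ 2) * (1 - y ^ 2 * p ^ 2)) * (fp - f0)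
        + (1 - a / y) * (1 - b / y) * (1 - c / y) * (1 - d / y)
          / ((1 - (y ^ 2)⁻¹) * (1 - (y ^ 2)⁻¹ * p ^ 2)) * (fm - f0)
        - (w⁻¹ - 1) * (1 - a * b * c * d * w / p ^ 2) * f0) := by
  have k1 : 1 - y ^ 2 ≠ 0 := sub_ne_zero.2 h1.symm
  have k2 : y ^ 2 - p ^ 2 ≠ 0 := sub_ne_zero.2 h2
  have k3 : 1 - y ^ 2 * p ^ 2 ≠ 0 := sub_ne_zero.2 h3.symm
  have k4 : 1 - p ^ 2 ≠ 0 := sub_ne_zero.2 hp1.symm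
  have e1 : (y * p ^ 2 + (y * p ^ 2)⁻¹) / 2 - (y + y⁻¹) / 2
      = (1 - p ^ 2) * (1 - y ^ 2 * p ^ 2) / (2 * p ^ 2 * y) := by field_simp; ring
  have e2 : (y + y⁻¹) / 2 - (y / p ^ 2 + (y / p ^ 2)⁻¹) / 2
      = -(1 - p ^ 2) * (y ^ 2 - p ^ 2) / (2 * p ^ 2 * y) := by field_simp; ring
  have e3 : (y * p + (y * p)⁻¹) / 2 - (y / p + (y / p)⁻¹) / 2
      = (1 - p ^ 2) * (1 - y ^ 2) / (2 * p * y) := by field_simp; ring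
  have e4 : 1 - (y ^ 2)⁻¹ = -(1 - y ^ 2) / y ^ 2 := by field_simp; ring
  have e5 : 1 - (y ^ 2)⁻¹ * p ^ 2 = (y ^ 2 - p ^ 2) / y ^ 2 := by field_simp
  rw [e1, e2, e3, e4, e5]
  clear e1 e2 e3 e4 e5 h1 h2 h3 hp1
  field_simp
  ring

/-- The left-hand side of the equation is `awOp` times 4q^(3/2)/(1-q)², by
`difference_equation_rational` with p = q^(1/2), y = q^z and w = q^ν. -/
lemma solvesAt_of_awOp {α β γ δ ν z : ℂ} {f : ℂ → ℂ} (hz : AwRegular q z)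
    (hf : awOp q α β γ δ ν f z = 0) :
    SolvesAt q (𝐞 α) (𝐞 β) (𝐞 γ) (𝐞 δ) (eigenvalue q (𝐞 α) (𝐞 β) (𝐞 γ) (𝐞 δ) ν) f z := by
  obtain ⟨h1, h2, h3⟩ := hz
  have hp2 : 𝐞 (1 / 2) ^ 2 = q := by
    rw [← qexp_two_mul, show (2 : ℂ) * (1 / 2) = 1 by norm_num, qexp_one]
  have hp3 : 𝐞 (3 / 2) = 𝐞 (1 / 2) ^ 2 * 𝐞 (1 / 2) := by
    rw [hp2, ← qexp_one, ← qexp_add]; norm_num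
  rw [qexp_two_mul] at h1 h2 h3
  rw [← hp2] at h2 h3
  have key := difference_equation_rational (a := 𝐞 α) (b := 𝐞 β) (c := 𝐞 γ) (d := 𝐞 δ)
    (fp := f (z + 1)) (f0 := f z) (fm := f (z - 1)) (qexp_ne_zero (q := q) (1 / 2))
    (qexp_ne_zero (q := q) z) (qexp_ne_zero (q := q) ν) (hp2 ▸ q_cast_ne_one) h1 h2 h3
  have hR : awOp q α β γ δ ν f z = (1 - 𝐞 α * 𝐞 z) * (1 - 𝐞 β * 𝐞 z) * (1 - 𝐞 γ * 𝐞 z)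
          * (1 - 𝐞 δ * 𝐞 z) / ((1 - 𝐞 z ^ 2) * (1 - 𝐞 z ^ 2 * 𝐞 (1 / 2) ^ 2)) * (f (z + 1) - f z)
        + (1 - 𝐞 α / 𝐞 z) * (1 - 𝐞 β / 𝐞 z) * (1 - 𝐞 γ / 𝐞 z) * (1 - 𝐞 δ / 𝐞 z)
          / ((1 - (𝐞 z ^ 2)⁻¹) * (1 - (𝐞 z ^ 2)⁻¹ * 𝐞 (1 / 2) ^ 2)) * (f (z - 1) - f z)
        - ((𝐞 ν)⁻¹ - 1) * (1 - 𝐞 α * 𝐞 β * 𝐞 γ * 𝐞 δ * 𝐞 ν / 𝐞 (1 / 2) ^ 2) * f z := by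
    rw [awOp, awCoeff, awCoeff, hp2, mul_neg]
    simp only [qexp_add, qexp_sub, qexp_neg, qexp_two_mul, qexp_one, div_eq_mul_inv]
  rw [← hR, hf, mul_zero] at key
  unfold SolvesAt
  refine Eq.trans ?_ key
  rw [sigma, tau, eigenvalue, fwd, bwd, fwd, fwd, bwd, bwd, bwd, bwd, lat1, lat1,
    add_sub_cancel_right, show z - 1 + 1 / 2 = z - 1 / 2 by ring]
  simp only [lat, cpow_eq_qexp]
  rw [show -2 * z = -(2 * z) by ring, hp3]
  simp only [qexp_add, qexp_sub, qexp_neg, qexp_two_mul, qexp_one, ← hp2]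

end

section

variable [hq : Fact (0 < q ∧ q < 1)]

include hq

omit hq in
lemma SolvesAt.congr {a b c d l z : ℂ} {f g : ℂ → ℂ} (h : SolvesAt q a b c d l g z)
    (h0 : f z = g z) (h1 : f (z + 1) = g (z + 1)) (h2 : f (z - 1) = g (z - 1)) :
    SolvesAt q a b c d l f z := by
  simp only [SolvesAt, fwd, bwd, add_sub_cancel_right] at h ⊢
  rwa [h0, h1, h2]

/-- A function that agrees with a solution, up to a factor, off its poles solves the difference
equation. -/
lemma IsSolution.solvesAt {α β γ δ ν d z N : ℂ} {f g : ℂ → ℂ} (hf : IsSolution q α β γ δ ν d f)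
    (hg : ∀ z, InDomain q (𝐞 d) z → g z = f z / qden q d z / N) (hz : AwRegular q z)
    (h1 : Regular q ((q : ℂ) ^ z / 𝐞 d)) (h2 : Regular q ((q : ℂ) ^ (-z) / 𝐞 d)) :
    SolvesAt q (𝐞 α) (𝐞 β) (𝐞 γ) (𝐞 δ) (eigenvalue q (𝐞 α) (𝐞 β) (𝐞 γ) (𝐞 δ) ν) g z := by
  rw [regular_iff (x := z - d) (by rw [cpow_eq_qexp, qexp_sub])] at h1
  rw [regular_iff (x := -z - d) (by rw [cpow_eq_qexp, qexp_sub])] at h2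
  have sh : ∀ w v : ℂ, ε w ≠ 0 → ∀ n : ℕ, v = w + n → ε v ≠ 0 := fun w v hw n hv =>
    hv ▸ qeps_add_ne_zero hw n
  have key : awOp q α β γ δ ν (fun w => N⁻¹ * (f w / qden q d w)) z = 0 := by
    rw [awOp_const_mul, hf.awOp_eq_zero hz h1 h2, mul_zero]
  refine (solvesAt_of_awOp hz key).congr ?_ ?_ ?_
  · rw [hg _ (inDomain_iff.2 ⟨sh _ _ h1 1 (by push_cast; ring), sh _ _ h2 1 (by push_cast; ring)⟩),
      div_eq_mul_inv _ N, mul_comm]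
  · rw [hg _ (inDomain_iff.2 ⟨sh _ _ h1 2 (by push_cast; ring), sh _ _ h2 0 (by push_cast; ring)⟩),
      div_eq_mul_inv _ N, mul_comm]
  · rw [hg _ (inDomain_iff.2 ⟨sh _ _ h1 0 (by push_cast; ring), sh _ _ h2 2 (by push_cast; ring)⟩),
      div_eq_mul_inv _ N, mul_comm]

/-! ### The Wronskian -/

lemma bwd_lat (z : ℂ) : bwd (lat q) z = -(1 - (q : ℂ)) / (2 * q) * qskew q z := by
  have h1 := qexp_ne_zero (q := q) z
  have h2 := q_cast_ne_zero (q := q)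
  simp only [bwd, lat, qskew, cpow_eq_qexp, qexp_neg, qexp_sub, qexp_one]
  field_simp
  ring

omit hq in
lemma wronskian_eq (f g : ℂ → ℂ) (z : ℂ) :
    wronskian q f g z = (f (z - 1) * g z - f z * g (z - 1)) / bwd (lat q) z := by
  simp only [wronskian, bwd]
  ring

/-- `qwron_uHat` divided by the normalizations of the two solutions and by ∇x. The latter cancels
`qskew`, and the normalizations cancel both `θ` factors and the square of `ε 1`. -/
theorem wronskian_u {α β γ δ ν z : ℂ} (hu : Generic q (𝐞 α) (𝐞 β) (𝐞 γ) (𝐞 δ))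
    (hv : Generic q (𝐞 α) (𝐞 β) (𝐞 δ) (𝐞 γ)) (hz : 𝐞 (2 * z) ≠ q)
    (hγ : NonzeroAt q (1 / 𝐞 γ) z) (hδ : NonzeroAt q (1 / 𝐞 δ) z) :
    wronskian q (u q ν (𝐞 α) (𝐞 β) (𝐞 γ) (𝐞 δ)) (u q ν (𝐞 α) (𝐞 β) (𝐞 δ) (𝐞 γ)) z
      = 2 * q * (ε (γ - δ) * ε (1 + δ - γ) * ε (-ν) * ε (α + β + γ + δ + ν - 1) * ε (α + β + ν)
          * ε (1 - ν - γ - δ))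
        / ((1 - q) * 𝐞 γ * (ε (α + β) ^ 2 * ε (α + γ) * ε (α + δ) * ε (β + γ) * ε (β + δ)))
        * (qgauge q α z * qgauge q β z / (qgauge q (-γ) z * qgauge q (-δ) z)) := by
  have key := qwron_uHat (q := q) α β γ δ ν z
  obtain ⟨u1, u2, u3, u4⟩ := hu.norm_ne_zero
  obtain ⟨-, v2, v3, v4⟩ := hv.norm_ne_zero
  obtain ⟨g1, g2⟩ := inDomain_of_nonzeroAt hγ
  obtain ⟨d1, d2⟩ := inDomain_of_nonzeroAt hδ
  rw [nonzeroAt_one_div_iff] at hγ hδ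
  have n1 : qgauge q (-γ) z ≠ 0 := by
    rw [qgauge, neg_add_eq_sub, show -γ + 1 - z = 1 - z - γ by ring]
    exact mul_ne_zero hγ.1 hγ.2
  have n2 : qgauge q (-δ) z ≠ 0 := by
    rw [qgauge, neg_add_eq_sub, show -δ + 1 - z = 1 - z - δ by ring]
    exact mul_ne_zero hδ.1 hδ.2
  rw [qwron_eq _ _ n2 n1, wronConst, qexp_neg] at key
  rw [wronskian_eq, bwd_lat, hu.u_eq d1, hu.u_eq d2, hv.u_eq g1, hv.u_eq g2]
  have h1 : (q : ℂ) ≠ 0 := q_cast_ne_zero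
  have h2 : 1 - (q : ℂ) ≠ 0 := sub_ne_zero.2 q_cast_ne_one.symm
  have h3 := qskew_ne_zero hz
  have h4 := qexp_ne_zero (q := q) γ
  have h5 := qeps_one_ne_zero (q := q)
  generalize uHat q α β γ δ ν (z - 1) / qden q δ (z - 1) = U0 at *
  generalize uHat q α β γ δ ν z / qden q δ z = U1 at *
  generalize uHat q α β δ γ ν (z - 1) / qden q γ (z - 1) = V0 at *
  generalize uHat q α β δ γ ν z / qden q γ z = V1 at *
  have key' : U0 * V1 - U1 * V0 = -(𝐞 γ)⁻¹ * (ε (γ - δ) * ε (1 + δ - γ)) * θ (α + δ) * θ (α + γ)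
      * ε 1 ^ 2 * ε (-ν) * ε (α + β + γ + δ + ν - 1) * ε (α + β + ν) * ε (1 - ν - γ - δ)
      * (qskew q z * qgauge q α z * qgauge q β z) / (qgauge q (-δ) z * qgauge q (-γ) z) := by
    rw [eq_div_iff (mul_ne_zero n2 n1), key]
  have e : ∀ M N : ℂ, U0 / M * (V1 / N) - U1 / M * (V0 / N) = (U0 * V1 - U1 * V0) / (M * N) := by
    intro M N
    rw [div_mul_div_comm, div_mul_div_comm, sub_div]
  rw [e, key']
  field_simp

/-! ### Polynomial solutions -/

omit hq in
lemma basicHyp_comm_last (l : List ℂ) (b₁ b₂ b₃ t : ℂ) :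
    basicHyp q l [b₁, b₂, b₃] t = basicHyp q l [b₁, b₃, b₂] t := by
  unfold basicHyp qPochs
  refine tsum_congr fun n => ?_
  simp only [List.map_cons, List.map_nil, List.prod_cons, List.prod_nil, List.length_cons,
    List.length_nil]
  ring

/-- The factor (q^(-n); q)_∞ = 0 removes the second series, and the remaining one is symmetric in c
and d. Only the prefactors differ, and these are nonzero. -/
lemma u_proportional_of_nat {α β γ δ : ℂ} (hu : Generic q (𝐞 α) (𝐞 β) (𝐞 γ) (𝐞 δ))
    (hv : Generic q (𝐞 α) (𝐞 β) (𝐞 δ) (𝐞 γ)) (n : ℕ) :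
    ∃ k : ℂ, k ≠ 0 ∧ ∀ z,
      u q n (𝐞 α) (𝐞 β) (𝐞 γ) (𝐞 δ) z = k * u q n (𝐞 α) (𝐞 β) (𝐞 δ) (𝐞 γ) z := by
  have hn : qPochInf q ((q : ℂ) ^ (-(n : ℂ))) = 0 := by
    by_contra h
    rw [qPochInf_eq_qeps (-(n : ℂ)) (cpow_eq_qexp _), ← ne_eq, qeps_ne_zero_iff'] at h
    exact h n (by simp)
  have pre : ∀ {γ δ : ℂ}, Generic q (𝐞 α) (𝐞 β) (𝐞 γ) (𝐞 δ) →
      qPochsInf q [𝐞 β * 𝐞 γ * (q : ℂ) ^ (n : ℂ), (q : ℂ) ^ (1 - (n : ℂ)) / (𝐞 α * 𝐞 δ)]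
        / qPochsInf q [𝐞 β * 𝐞 γ, (q : ℂ) / (𝐞 α * 𝐞 δ)] ≠ 0 := by
    intro γ δ h
    obtain ⟨-, -, h3, h4⟩ := h.norm_ne_zero
    simp only [qPochsInf_cons, qPochsInf_nil, mul_one]
    rw [qPochInf_eq_qeps (β + γ + n) (by rw [cpow_eq_qexp, qexp_add, qexp_add]),
      qPochInf_eq_qeps (1 - n - (α + δ)) (by rw [cpow_eq_qexp, qexp_sub _ (α + δ), qexp_add]),
      qPochInf_eq_qeps (β + γ) (by rw [qexp_add]),
      qPochInf_eq_qeps (1 - (α + δ)) (by rw [qexp_sub, qexp_add, qexp_one])]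
    exact div_ne_zero
      (mul_ne_zero (qeps_add_ne_zero h3 n)
        (qeps_ne_zero_of_qtheta' h4 (1 - n) (by push_cast; ring)))
      (mul_ne_zero h3 (qeps_ne_zero_of_qtheta' h4 1 (by push_cast; ring)))
  refine ⟨_, div_ne_zero (pre hu) (pre hv), fun z => ?_⟩
  have zero : ∀ l : List ℂ, qPochsInf q ((q : ℂ) ^ (-(n : ℂ)) :: l) = 0 := fun l => by
    rw [qPochsInf_cons, hn, zero_mul]
  rw [u, u, zero, zero, zero_div, zero_div, zero_mul, zero_mul, zero_mul, zero_mul, add_zero,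
    add_zero, mul_right_comm _ (𝐞 δ) (𝐞 γ), basicHyp_comm_last _ _ (𝐞 α * 𝐞 δ), ← mul_assoc,
    div_mul_cancel₀ _ (pre hv)]

end

/-! ### The formulas in the given parameters and linear independence -/

section

variable [hq : Fact (0 < q ∧ q < 1)]

include hq

lemma qgauge_eq_qPochInf (η z : ℂ) :
    qgauge q η z = qPochInf q (𝐞 η * (q : ℂ) ^ z) * qPochInf q (𝐞 η * (q : ℂ) ^ (1 - z)) := by
  rw [qgauge, qPochInf_eq_qeps (η + z) (by rw [cpow_eq_qexp, qexp_add]),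
    qPochInf_eq_qeps (η + 1 - z) (by rw [cpow_eq_qexp, add_sub_assoc, qexp_add])]

lemma qgauge_neg_eq_qPochInf (η z : ℂ) :
    qgauge q (-η) z = qPochInf q ((q : ℂ) ^ z / 𝐞 η) * qPochInf q ((q : ℂ) ^ (1 - z) / 𝐞 η) := by
  rw [qgauge_eq_qPochInf, qexp_neg, div_eq_inv_mul, div_eq_inv_mul]

lemma wronskian_u_eq {α β γ δ ν z : ℂ} (hu : Generic q (𝐞 α) (𝐞 β) (𝐞 γ) (𝐞 δ))
    (hv : Generic q (𝐞 α) (𝐞 β) (𝐞 δ) (𝐞 γ)) (hz : (q : ℂ) ^ (2 * z) ≠ q)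
    (hγ : NonzeroAt q (1 / 𝐞 γ) z) (hδ : NonzeroAt q (1 / 𝐞 δ) z) :
    wronskian q (u q ν (𝐞 α) (𝐞 β) (𝐞 γ) (𝐞 δ)) (u q ν (𝐞 α) (𝐞 β) (𝐞 δ) (𝐞 γ)) z =
      2 * q * qPochsInf q [𝐞 γ / 𝐞 δ, q * 𝐞 δ / 𝐞 γ, (q : ℂ) ^ (-ν),
          𝐞 α * 𝐞 β * 𝐞 γ * 𝐞 δ * (q : ℂ) ^ (ν - 1), 𝐞 α * 𝐞 β * (q : ℂ) ^ ν,
          (q : ℂ) ^ (1 - ν) / (𝐞 γ * 𝐞 δ)]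
        / ((1 - q) * 𝐞 γ * qPochsInf q [𝐞 α * 𝐞 β, 𝐞 α * 𝐞 β, 𝐞 α * 𝐞 γ, 𝐞 α * 𝐞 δ, 𝐞 β * 𝐞 γ,
          𝐞 β * 𝐞 δ])
        * (qPochsInf q [𝐞 α * (q : ℂ) ^ z, 𝐞 α * (q : ℂ) ^ (1 - z),
            𝐞 β * (q : ℂ) ^ z, 𝐞 β * (q : ℂ) ^ (1 - z)]
          / qPochsInf q [(q : ℂ) ^ z / 𝐞 γ, (q : ℂ) ^ (1 - z) / 𝐞 γ,
            (q : ℂ) ^ z / 𝐞 δ, (q : ℂ) ^ (1 - z) / 𝐞 δ]) := by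
  rw [cpow_eq_qexp] at hz
  rw [wronskian_u hu hv hz hγ hδ]
  simp only [qPochsInf_cons, qPochsInf_nil, mul_one]
  rw [qPochInf_eq_qeps (γ - δ) (qexp_sub _ _).symm,
    qPochInf_eq_qeps (1 + δ - γ) (by rw [qexp_sub, qexp_add, qexp_one]),
    qPochInf_eq_qeps (-ν) (cpow_eq_qexp _),
    qPochInf_eq_qeps (α + β + γ + δ + ν - 1) (by
      rw [cpow_eq_qexp, add_sub_assoc, qexp_add, qexp_add, qexp_add, qexp_add]),
    qPochInf_eq_qeps (α + β + ν) (by rw [cpow_eq_qexp, qexp_add, qexp_add]),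
    qPochInf_eq_qeps (1 - ν - γ - δ) (by rw [cpow_eq_qexp, sub_sub _ γ, qexp_sub _ (γ + δ), qexp_add]),
    qPochInf_eq_qeps (α + β) (qexp_add _ _).symm, qPochInf_eq_qeps (α + γ) (qexp_add _ _).symm,
    qPochInf_eq_qeps (α + δ) (qexp_add _ _).symm, qPochInf_eq_qeps (β + γ) (qexp_add _ _).symm,
    qPochInf_eq_qeps (β + δ) (qexp_add _ _).symm, qgauge_eq_qPochInf, qgauge_eq_qPochInf,
    qgauge_neg_eq_qPochInf, qgauge_neg_eq_qPochInf]
  congr 2 <;> ring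

/-! ### Linear independence -/

/-- Each factor of the product formula is kept from vanishing by a hypothesis; the condition on c/d
serves both (c/d; q)_∞ and (qd/c; q)_∞. -/
lemma wronskian_u_ne_zero {α β γ δ ν z : ℂ} (hu : Generic q (𝐞 α) (𝐞 β) (𝐞 γ) (𝐞 δ))
    (hv : Generic q (𝐞 α) (𝐞 β) (𝐞 δ) (𝐞 γ)) (h1 : ∀ n : ℕ, (q : ℂ) ^ ν ≠ (q : ℂ) ^ n)
    (h2 : ∀ n : ℤ, 𝐞 γ / 𝐞 δ ≠ (q : ℂ) ^ n)
    (h3 : Regular q (𝐞 α * 𝐞 β * 𝐞 γ * 𝐞 δ * (q : ℂ) ^ (ν - 1)))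
    (h4 : Regular q (𝐞 α * 𝐞 β * (q : ℂ) ^ ν)) (h5 : Regular q ((q : ℂ) ^ (1 - ν) / (𝐞 γ * 𝐞 δ)))
    (hz : (q : ℂ) ^ (2 * z) ≠ q)
    (hγ : NonzeroAt q (1 / 𝐞 γ) z) (hδ : NonzeroAt q (1 / 𝐞 δ) z)
    (hα : NonzeroAt q (𝐞 α) z) (hβ : NonzeroAt q (𝐞 β) z) :
    wronskian q (u q ν (𝐞 α) (𝐞 β) (𝐞 γ) (𝐞 δ)) (u q ν (𝐞 α) (𝐞 β) (𝐞 δ) (𝐞 γ)) z ≠ 0 := by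
  rw [cpow_eq_qexp] at hz
  rw [wronskian_u hu hv hz hγ hδ]
  rw [regular_iff (x := α + β + γ + δ + ν - 1) (by
    rw [cpow_eq_qexp, add_sub_assoc, qexp_add, qexp_add, qexp_add, qexp_add])] at h3
  rw [regular_iff (x := α + β + ν) (by rw [cpow_eq_qexp, qexp_add, qexp_add])] at h4
  rw [regular_iff (x := 1 - ν - γ - δ) (by
    rw [cpow_eq_qexp, sub_sub _ γ, qexp_sub _ (γ + δ), qexp_add])] at h5
  have k1 : ε (-ν) ≠ 0 := by
    rw [qeps_ne_zero_iff']
    intro n hn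
    apply h1 n
    rw [← qexp_nat, cpow_eq_qexp]
    rw [qexp_add, qexp_neg, inv_mul_eq_one₀ (qexp_ne_zero _)] at hn
    exact hn
  have k2 : θ (γ - δ) ≠ 0 := by
    rw [qtheta_ne_zero_iff', qexp_sub]
    exact h2
  have k3 : ε (γ - δ) ≠ 0 := qeps_ne_of_qtheta k2 0 (by simp)
  have k4 : ε (1 + δ - γ) ≠ 0 := qeps_ne_zero_of_qtheta' k2 1 (by push_cast; ring)
  obtain ⟨u1, u2, u3, u4⟩ := hu.norm_ne_zero
  obtain ⟨-, v2, v3, v4⟩ := hv.norm_ne_zero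
  rw [nonzeroAt_iff] at hα hβ
  rw [one_div, ← qexp_neg, nonzeroAt_iff] at hγ hδ
  have g1 : qgauge q α z ≠ 0 := mul_ne_zero hα.1 hα.2
  have g2 : qgauge q β z ≠ 0 := mul_ne_zero hβ.1 hβ.2
  have g3 : qgauge q (-γ) z ≠ 0 := mul_ne_zero hγ.1 hγ.2
  have g4 : qgauge q (-δ) z ≠ 0 := mul_ne_zero hδ.1 hδ.2
  have m1 : (q : ℂ) ≠ 0 := q_cast_ne_zero
  have m2 : 1 - (q : ℂ) ≠ 0 := sub_ne_zero.2 q_cast_ne_one.symm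
  have m3 := qexp_ne_zero (q := q) γ
  simp only [ne_eq, mul_eq_zero, div_eq_zero_iff, pow_eq_zero_iff two_ne_zero, two_ne_zero, not_or]
  tauto

/-- By periodicity the relations at z and z - 1 are two linear equations for the same pair A(z),
B(z), and their determinant is a multiple of the Wronskian. -/
lemma eq_zero_of_wronskian_ne_zero {γ δ z : ℂ} {f g A B : ℂ → ℂ} (pA : ∀ z, A (z + 1) = A z)
    (pB : ∀ z, B (z + 1) = B z)
    (h : ∀ z, InDomain q (𝐞 γ) z → InDomain q (𝐞 δ) z → A z * f z + B z * g z = 0)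
    (hγ : NonzeroAt q (1 / 𝐞 γ) z) (hδ : NonzeroAt q (1 / 𝐞 δ) z) (hW : wronskian q f g z ≠ 0) :
    A z = 0 ∧ B z = 0 := by
  obtain ⟨g1, g2⟩ := inDomain_of_nonzeroAt hγ
  obtain ⟨d1, d2⟩ := inDomain_of_nonzeroAt hδ
  have e1 := h z g1 d1
  have e2 := h (z - 1) g2 d2
  have a := pA (z - 1)
  have b := pB (z - 1)
  rw [sub_add_cancel] at a b
  rw [← a, ← b] at e2
  rw [wronskian_eq] at hW
  have hW' : f (z - 1) * g z - f z * g (z - 1) ≠ 0 := fun h => hW (by rw [h, zero_div])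
  constructor
  · refine (mul_eq_zero.1 ?_).resolve_right hW'
    linear_combination g z * e2 - g (z - 1) * e1
  · refine (mul_eq_zero.1 ?_).resolve_right hW'
    linear_combination f (z - 1) * e1 - f z * e2

lemma exists_nonzeroAt (α β γ δ : ℂ) :
    ∃ z : ℂ, (q : ℂ) ^ (2 * z) ≠ q ∧ NonzeroAt q (1 / 𝐞 γ) z ∧ NonzeroAt q (1 / 𝐞 δ) z ∧
      NonzeroAt q (𝐞 α) z ∧ NonzeroAt q (𝐞 β) z := by
  have k : ∀ η : ℂ, ∀ᶠ z in cocountable, NonzeroAt q (𝐞 η) z := fun η => by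
    filter_upwards [eventually_qtheta_pm (q := q) η] with z hz
    rw [nonzeroAt_iff]
    exact ⟨qeps_ne_of_qtheta hz.1 0 (by simp), qeps_ne_of_qtheta hz.2 1 (by push_cast; ring)⟩
  simp only [one_div, ← qexp_neg]
  obtain ⟨z, h1, h2, h3, h4, h5⟩ := (dense_of_eventually_cocountable
    ((eventually_awRegular (q := q)).and ((k (-γ)).and ((k (-δ)).and ((k α).and (k β)))))).nonempty
  exact ⟨z, by rw [cpow_eq_qexp]; exact h1.2.1, h2, h3, h4, h5⟩

/-! ### The bilinear identity in the given parameters -/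

lemma bilinearTerm_sub_eq {α β γ δ ν z : ℂ} (hc : ‖𝐞 β * 𝐞 γ * (q : ℂ) ^ ν‖ < 1)
    (hd : ‖𝐞 β * 𝐞 δ * (q : ℂ) ^ ν‖ < 1)
    (hαβ : Regular q (𝐞 α * 𝐞 β)) (hαγ : Regular q (𝐞 α * 𝐞 γ)) (hαδ : Regular q (𝐞 α * 𝐞 δ))
    (h1 : Regular q ((q : ℂ) * 𝐞 α / 𝐞 γ)) (h2 : Regular q ((q : ℂ) * 𝐞 α / 𝐞 δ))
    (h3 : Regular q ((q : ℂ) ^ (-ν) * 𝐞 α / 𝐞 γ)) (h4 : Regular q ((q : ℂ) ^ (-ν) * 𝐞 α / 𝐞 δ))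
    (h5 : Regular q ((q : ℂ) ^ (1 - ν + z) / 𝐞 γ)) (h6 : Regular q ((q : ℂ) ^ (1 - ν - z) / 𝐞 γ))
    (h7 : Regular q ((q : ℂ) ^ (1 - ν + z) / 𝐞 δ)) (h8 : Regular q ((q : ℂ) ^ (1 - ν - z) / 𝐞 δ))
    (hγ : NonzeroAt q (1 / 𝐞 γ) z) (hδ : NonzeroAt q (1 / 𝐞 δ) z) :
    bilinearTerm q ν (𝐞 α) (𝐞 β) (𝐞 γ) (𝐞 δ) z - bilinearTerm q ν (𝐞 α) (𝐞 β) (𝐞 δ) (𝐞 γ) z =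
      𝐞 δ * qPochsInf q [𝐞 γ / 𝐞 δ, q * 𝐞 δ / 𝐞 γ, (q : ℂ) ^ (1 - ν),
          𝐞 α * 𝐞 β * 𝐞 γ * 𝐞 δ * (q : ℂ) ^ ν, 𝐞 α * 𝐞 β * (q : ℂ) ^ ν,
          (q : ℂ) ^ (1 - ν) / (𝐞 γ * 𝐞 δ)]
        / qPochsInf q [𝐞 α * 𝐞 β, 𝐞 α * 𝐞 β * q, q * 𝐞 α / 𝐞 γ, q * 𝐞 α / 𝐞 δ,
            𝐞 β * 𝐞 γ * (q : ℂ) ^ ν, 𝐞 β * 𝐞 δ * (q : ℂ) ^ ν]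
        * (qPochsInf q [𝐞 α * (q : ℂ) ^ z, 𝐞 α * (q : ℂ) ^ (1 - z),
            𝐞 β * (q : ℂ) ^ z, 𝐞 β * (q : ℂ) ^ (1 - z)]
          / qPochsInf q [(q : ℂ) ^ z / 𝐞 γ, (q : ℂ) ^ (1 - z) / 𝐞 γ,
            (q : ℂ) ^ z / 𝐞 δ, (q : ℂ) ^ (1 - z) / 𝐞 δ]) := by
  have c0 : ∀ x y : ℂ, 𝐞 x * 𝐞 y = 𝐞 (x + y) := fun x y => (qexp_add x y).symm
  have c1 : ∀ x : ℂ, (q : ℂ) * 𝐞 α / 𝐞 x = 𝐞 (1 + α - x) := fun x => by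
    rw [qexp_sub, qexp_add, qexp_one]
  have c2 : ∀ x : ℂ, (q : ℂ) ^ (-ν) * 𝐞 α / 𝐞 x = 𝐞 (α - ν - x) := fun x => by
    rw [cpow_eq_qexp, mul_comm, sub_eq_add_neg α, qexp_sub, qexp_add]
  have c3 : ∀ w x : ℂ, (q : ℂ) ^ w / 𝐞 x = 𝐞 (w - x) := fun w x => by rw [cpow_eq_qexp, qexp_sub]
  have c4 : ∀ x y : ℂ, 𝐞 x * 𝐞 y * (q : ℂ) ^ ν = 𝐞 (x + y + ν) := fun x y => by
    rw [cpow_eq_qexp, qexp_add, qexp_add]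
  rw [regular_iff (c0 _ _)] at hαβ hαγ hαδ
  rw [regular_iff (c1 _)] at h1 h2
  rw [regular_iff (c2 _)] at h3 h4
  rw [regular_iff (c3 _ _)] at h5 h6 h7 h8
  rw [nonzeroAt_one_div_iff] at hγ hδ
  rw [c4] at hc hd
  rw [bilinearTerm_sub hc hd hαβ hαγ hαδ h1 h2 h3 h4 h5 h6 h7 h8 hγ hδ]
  simp only [qPochsInf_cons, qPochsInf_nil, mul_one]
  rw [qPochInf_eq_qeps (γ - δ) (qexp_sub _ _).symm,
    qPochInf_eq_qeps (1 + δ - γ) (by rw [qexp_sub, qexp_add, qexp_one]),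
    qPochInf_eq_qeps (1 - ν) (cpow_eq_qexp _),
    qPochInf_eq_qeps (α + β + γ + δ + ν) (by
      rw [cpow_eq_qexp, qexp_add, qexp_add, qexp_add, qexp_add]),
    qPochInf_eq_qeps _ (c4 α β),
    qPochInf_eq_qeps (1 - ν - γ - δ) (by rw [cpow_eq_qexp, sub_sub _ γ, qexp_sub _ (γ + δ), qexp_add]),
    qPochInf_eq_qeps _ (c0 α β),
    qPochInf_eq_qeps (α + β + 1) (by rw [qexp_add, qexp_add, qexp_one]),
    qPochInf_eq_qeps _ (c1 γ), qPochInf_eq_qeps _ (c1 δ), qPochInf_eq_qeps _ (c4 β γ),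
    qPochInf_eq_qeps _ (c4 β δ), qPochInf_eq_qeps _ (c3 z γ), qPochInf_eq_qeps _ (c3 (1 - z) γ),
    qPochInf_eq_qeps _ (c3 z δ), qPochInf_eq_qeps _ (c3 (1 - z) δ), qgauge_eq_qPochInf,
    qgauge_eq_qPochInf]
  congr 2 <;> ring

end

end

end AskeyWilson

theorem mainTheorem8 (q : ℝ) (hq0 : 0 < q) (hq1 : q < 1) (a b c d : ℂ)
    (ha : a ≠ 0) (hb : b ≠ 0) (hc : c ≠ 0) (hd : d ≠ 0) (ν : ℂ) :
    -- the two forms of `u_ν(x; a, b, c; d)` agree where both are defined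
    (∀ z : ℂ, Generic q a b c d → ‖b * c * (q : ℂ) ^ ν‖ < 1 →
      Regular q (a * (q : ℂ) ^ (-ν) / d) → Regular q ((q : ℂ) * a / d) →
      Regular q ((q : ℂ) ^ (1 - ν + z) / d) → Regular q ((q : ℂ) ^ (1 - ν - z) / d) →
      InDomain q d z →
      u q ν a b c d z = uSeries q ν a b c d z) ∧
    (Generic q a b c d → Generic q a b d c →
      -- `u` and `v` solve the difference equation with the same eigenvalue
      (∀ z : ℂ, (q : ℂ) ^ (2 * z) ≠ 1 → (q : ℂ) ^ (2 * z) ≠ q → (q : ℂ) ^ (2 * z) * q ≠ 1 →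
        (Regular q ((q : ℂ) ^ z / d) → Regular q ((q : ℂ) ^ (-z) / d) →
          SolvesAt q a b c d (eigenvalue q a b c d ν) (u q ν a b c d) z) ∧
        (Regular q ((q : ℂ) ^ z / c) → Regular q ((q : ℂ) ^ (-z) / c) →
          SolvesAt q a b c d (eigenvalue q a b c d ν) (u q ν a b d c) z)) ∧
      -- the value of the Wronskian
      (∀ z : ℂ, (q : ℂ) ^ (2 * z) ≠ q → NonzeroAt q (1 / c) z → NonzeroAt q (1 / d) z →
        wronskian q (u q ν a b c d) (u q ν a b d c) z =
          2 * q * qPochsInf q [c / d, q * d / c, (q : ℂ) ^ (-ν),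
              a * b * c * d * (q : ℂ) ^ (ν - 1), a * b * (q : ℂ) ^ ν, (q : ℂ) ^ (1 - ν) / (c * d)]
            / ((1 - q) * c * qPochsInf q [a * b, a * b, a * c, a * d, b * c, b * d])
            * (qPochsInf q [a * (q : ℂ) ^ z, a * (q : ℂ) ^ (1 - z),
                b * (q : ℂ) ^ z, b * (q : ℂ) ^ (1 - z)]
              / qPochsInf q [(q : ℂ) ^ z / c, (q : ℂ) ^ (1 - z) / c,
                (q : ℂ) ^ z / d, (q : ℂ) ^ (1 - z) / d])) ∧
      -- independence
      ((∀ n : ℕ, (q : ℂ) ^ ν ≠ (q : ℂ) ^ n) → (∀ n : ℤ, c / d ≠ (q : ℂ) ^ n) →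
        Regular q (a * b * c * d * (q : ℂ) ^ (ν - 1)) → Regular q (a * b * (q : ℂ) ^ ν) →
        Regular q ((q : ℂ) ^ (1 - ν) / (c * d)) →
        (∀ z : ℂ, (q : ℂ) ^ (2 * z) ≠ q → NonzeroAt q (1 / c) z → NonzeroAt q (1 / d) z →
          NonzeroAt q a z → NonzeroAt q b z →
          wronskian q (u q ν a b c d) (u q ν a b d c) z ≠ 0) ∧
        (∀ α β : ℂ → ℂ, (∀ z, α (z + 1) = α z) → (∀ z, β (z + 1) = β z) →
          (∀ z, InDomain q c z → InDomain q d z →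
            α z * u q ν a b c d z + β z * u q ν a b d c z = 0) →
          ∀ z : ℂ, (q : ℂ) ^ (2 * z) ≠ q → NonzeroAt q (1 / c) z → NonzeroAt q (1 / d) z →
            NonzeroAt q a z → NonzeroAt q b z → α z = 0 ∧ β z = 0) ∧
        (∀ α β : ℂ,
          (∀ z, InDomain q c z → InDomain q d z →
            α * u q ν a b c d z + β * u q ν a b d c z = 0) →
          α = 0 ∧ β = 0)) ∧
      -- dependence in the polynomial case
      (∀ n : ℕ, ν = n → ∃ k : ℂ, k ≠ 0 ∧
        ∀ z, InDomain q c z → InDomain q d z → u q ν a b c d z = k * u q ν a b d c z)) ∧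
    -- the bilinear identity for four very-well-poised series
    (∀ z : ℂ, ‖b * c * (q : ℂ) ^ ν‖ < 1 → ‖b * d * (q : ℂ) ^ ν‖ < 1 →
      Regular q (a * b) → Regular q (a * c) → Regular q (a * d) →
      Regular q ((q : ℂ) * a / c) → Regular q ((q : ℂ) * a / d) →
      Regular q ((q : ℂ) ^ (-ν) * a / c) → Regular q ((q : ℂ) ^ (-ν) * a / d) →
      Regular q ((q : ℂ) ^ (1 - ν + z) / c) → Regular q ((q : ℂ) ^ (1 - ν - z) / c) →
      Regular q ((q : ℂ) ^ (1 - ν + z) / d) → Regular q ((q : ℂ) ^ (1 - ν - z) / d) →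
      NonzeroAt q (1 / c) z → NonzeroAt q (1 / d) z →
      bilinearTerm q ν a b c d z - bilinearTerm q ν a b d c z =
        d * qPochsInf q [c / d, q * d / c, (q : ℂ) ^ (1 - ν),
            a * b * c * d * (q : ℂ) ^ ν, a * b * (q : ℂ) ^ ν, (q : ℂ) ^ (1 - ν) / (c * d)]
          / qPochsInf q [a * b, a * b * q, q * a / c, q * a / d,
              b * c * (q : ℂ) ^ ν, b * d * (q : ℂ) ^ ν]
          * (qPochsInf q [a * (q : ℂ) ^ z, a * (q : ℂ) ^ (1 - z),
              b * (q : ℂ) ^ z, b * (q : ℂ) ^ (1 - z)]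
            / qPochsInf q [(q : ℂ) ^ z / c, (q : ℂ) ^ (1 - z) / c,
              (q : ℂ) ^ z / d, (q : ℂ) ^ (1 - z) / d])) := by
  have : Fact (0 < q ∧ q < 1) := ⟨hq0, hq1⟩
  -- Any choice of logarithms will do, since the statement involves only the powers q^α, q^β, q^γ,
  -- q^δ. Nonzero parameters are needed exactly here.
  obtain ⟨α, rfl⟩ := exists_qexp_eq (q := q) ha
  obtain ⟨β, rfl⟩ := exists_qexp_eq (q := q) hb
  obtain ⟨γ, rfl⟩ := exists_qexp_eq (q := q) hc
  obtain ⟨δ, rfl⟩ := exists_qexp_eq (q := q) hd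
  refine ⟨fun z h ht h1 h2 h3 h4 hz => u_eq_uSeries h ht h1 h2 h3 h4 hz, fun hu hv => ?_, ?_⟩
  · refine ⟨fun z h1 h2 h3 => ?_, fun z h1 h2 h3 => wronskian_u_eq hu hv h1 h2 h3,
      fun h1 h2 h3 h4 h5 => ?_, ?_⟩
    · rw [cpow_eq_qexp] at h1 h2 h3
      exact ⟨fun k1 k2 => (uHat_isSolution α β γ δ ν).solvesAt (fun z hz => hu.u_eq hz)
          ⟨h1, h2, h3⟩ k1 k2,
        fun k1 k2 => (uHat_isSolution α β δ γ ν).swap.solvesAt (fun z hz => hv.u_eq hz)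
          ⟨h1, h2, h3⟩ k1 k2⟩
    · have hW := fun z k1 k2 k3 k4 k5 => wronskian_u_ne_zero hu hv h1 h2 h3 h4 h5 (z := z) k1 k2 k3
        k4 k5
      refine ⟨hW, fun A B pA pB h z k1 k2 k3 k4 k5 =>
        eq_zero_of_wronskian_ne_zero pA pB h k2 k3 (hW z k1 k2 k3 k4 k5), fun A B h => ?_⟩
      obtain ⟨z, k1, k2, k3, k4, k5⟩ := exists_nonzeroAt (q := q) α β γ δ
      exact eq_zero_of_wronskian_ne_zero (A := fun _ => A) (B := fun _ => B) (fun _ => rfl)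
        (fun _ => rfl) h k2 k3 (hW z k1 k2 k3 k4 k5)
    · rintro n rfl
      obtain ⟨k, hk, h⟩ := u_proportional_of_nat hu hv n
      exact ⟨k, hk, fun z _ _ => h z⟩
  · intro z hc hd h1 h2 h3 h4 h5 h6 h7 h8 h9 h10 h11 h12 h13
    exact bilinearTerm_sub_eq hc hd h1 h2 h3 h4 h5 h6 h7 h8 h9 h10 h11 h12 h13
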